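/- Let $\mathbb K$ be a field (of any characteristic). A graded $\mathbb S$-module is a family $\mathcal V=(\mathcal V(n))_{n\ge 0}$ of $\mathbb Z$-graded $\mathbb K$-modules with a right action of $\mathbb S_n$ on $\mathcal V(n)$; graded $\mathbb S$-modules form a monoidal category for the composition product $\circ$ (with $(\mathcal V\circ\mathcal W)=\bigoplus_k \mathcal V(k)\otimes_{\mathbb S_k}\mathcal W^{\otimes k}$ and Koszul signs), with unit $\mathcal I$ ($\mathbb K$ in arity $1$ and degree $0$). A cooperad is a comonoid $(\mathcal C,\Delta,\epsilon)$ in this category; it is coaugmented if it is equipped with a morphism of cooperads $\mathcal I\to\mathcal C$, $1\mapsto 1$. Put $\overline{\mathcal C}=\ker\epsilon$ and let $\pi:\mathcal C\to\overline{\mathcal C}$ be the projection along $\mathbb K\cdot 1$. The coaugmented cooperad is conilpotent if the process of successive decomposition stabilizes in finite time on each element: with $T_0=\mathcal I$, $T_{n+1}=\mathcal I\oplus(\overline{\mathcal C}\circ T_n)$, $t_0=\epsilon$ and $t_{n+1}=(\epsilon,(\pi\circ t_n)\Delta):\mathcal C\to T_{n+1}$, for any $x\in\mathcal C$ there is an $N$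 such that $t_{n+1}(x)$ is the image of $t_n(x)$ under the canonical inclusion $T_n\subset T_{n+1}$ for all $n\ge N$. A curved cooperad $\mathscr C=(\mathcal C,\Delta,\epsilon,1,d,\theta)$ is a coaugmented graded cooperad with a degree $-1$ coderivation $d$ (that is, $\Delta d=(d\circ \mathrm{Id}+\mathrm{Id}\circ' d)\Delta$ and $d(1)=0$) and a degree $-2$ map $\theta:\mathcal C(1)\to\mathbb K$ such that $$d^2=(\theta\otimes \mathrm{Id}-\mathrm{Id}\otimes\theta)\Delta_2,\qquad \theta d=0,$$ where $\Delta_2$ is the component of the decomposition in the trees with exactly two vertices, both labelled by $\overline{\mathcal C}$, and the map written on the left acts on the lower vertex. A $\mathscr C$-coalgebra is a $\mathbb Z$-graded $\mathbb K$-module $\mathcal D$, viewed as a graded $\mathbb S$-module concentrated in arity $0$, with a coassociative and counital left coaction $\Delta_{\mathscr D}:\mathcal D\to\mathcal C\circ\mathcal D$ and a degree $-1$ map $d_{\mathcal D}$ such that $$\Delta_{\mathscr D}d_{\mathcal D}=(d\circ\mathrm{Id}+\mathrm{Id}\circ' d_{\mathcal D})\Delta_{\mathscr D},\qquad d_{\mathcal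 D}^2=(\theta\circ\mathrm{Id})\Delta_{\mathscr D}.$$ Morphisms of $\mathscr C$-coalgebras are the degree $0$ linear maps which commute with the coactions and with the maps $d$. A sub-coalgebra of $\mathscr D$ is a $\mathscr C$-coalgebra with an injective morphism to $\mathscr D$; a $\mathscr C$-coalgebra is finite-dimensional if the sum of all its homogeneous components is. An object $X$ of a cocomplete category is compact if $\hom(X,-)$ commutes with filtered colimits; a category is presentable if it is cocomplete and there is a set of compact objects such that any object is the colimit of a filtered diagram of these compact objects. Theorem. Let $\mathscr C$ be a conilpotent curved cooperad over $\mathbb K$. Then: 1. the category of $\mathscr C$-coalgebras is presentable; 2. for any $\mathscr C$-coalgebra $\mathscr D$, the category of finite-dimensional sub-coalgebras of $\mathscr D$ and inclusions between them is filtered, every homogeneous element of $\mathscr D$ lies in a finite-dimensional sub-coalgebra, and $\mathscr D$, with the inclusions, is the colimit of the diagram of its finite-dimensional sub-coalgebras in the category of $\mathscr C$-coalgebras; 3. every finite-dimensional $\mathscr C$-coalgebra is a compact object of the category of $\mathscr C$-coalgebras. -/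

import Mathlib

open CategoryTheory Limits Opposite
open scoped DirectSum TensorProduct

universe u

noncomputable section

/-- The groupoid `𝕊`: objects are natural numbers, and `Hom(n, m)` is the set of bijections from
`{1, …, n}` to `{1, …, m}`; it is empty for `n ≠ m` and the symmetric group for `n = m`. -/
structure SymGrpd where
  n : ℕ

namespace SymGrpd

instance : Category SymGrpd where
  Hom X Y := Fin X.n ≃ Fin Y.n
  id _ := Equiv.refl _
  comp f g := f.trans g

end SymGrpd

/-- Graded `𝕊`-modules: presheaves on `𝕊` with values in `ℤ`-graded `K`-modules. -/
abbrev SMod (K : Type u) [Field K] := SymGrpdᵒᵖ ⥤ GradedObject ℤ (ModuleCat.{u} K)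

namespace SMod

variable {K : Type u} [Field K]

/-- The component of arity `n` and degree `a`. -/
abbrev at' (V : SMod K) (n : ℕ) (a : ℤ) : ModuleCat.{u} K := V.obj (op ⟨n⟩) a

/-- The (right) action of a bijection. -/
def act (V : SMod K) {n n' : ℕ} (φ : Fin n ≃ Fin n') (a : ℤ) : V.at' n' a →ₗ[K] V.at' n a :=
  (V.map (Quiver.Hom.op (X := SymGrpd.mk n) (Y := SymGrpd.mk n') φ) a).hom

/-- The component of a morphism of `𝕊`-modules. -/
def appl {V W : SMod K} (f : V ⟶ W) (n : ℕ) (a : ℤ) : V.at' n a →ₗ[K] W.at' n a :=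
  (f.app (op ⟨n⟩) a).hom

lemma act_refl (V : SMod K) (n : ℕ) (a : ℤ) (x : V.at' n a) : V.act (Equiv.refl (Fin n)) a x = x := by
  have := V.map_id (op ⟨n⟩)
  have h2 := congrArg (fun f => (f a).hom x) this
  exact h2

lemma act_trans (V : SMod K) {n n' n'' : ℕ} (φ : Fin n ≃ Fin n') (ψ : Fin n' ≃ Fin n'') (a : ℤ)
    (x : V.at' n'' a) : V.act (φ.trans ψ) a x = V.act φ a (V.act ψ a x) := by
  have := V.map_comp (Quiver.Hom.op (X := SymGrpd.mk n') (Y := SymGrpd.mk n'') ψ)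
    (Quiver.Hom.op (X := SymGrpd.mk n) (Y := SymGrpd.mk n') φ)
  have h2 := congrArg (fun f => (f a).hom x) this
  exact h2

lemma appl_act {V W : SMod K} (f : V ⟶ W) {n n' : ℕ} (φ : Fin n ≃ Fin n') (a : ℤ)
    (x : V.at' n' a) : appl f n a (V.act φ a x) = W.act φ a (appl f n' a x) := by
  have := f.naturality (Quiver.Hom.op (X := SymGrpd.mk n) (Y := SymGrpd.mk n') φ)
  have h2 := congrArg (fun f => (f a).hom x) this
  exact h2

/-- Build a graded `𝕊`-module from its components and its right action. -/
def of (V : ℕ → ℤ → Type u) [∀ n a, AddCommGroup (V n a)] [∀ n a, Module K (V n a)]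
    (act : ∀ {n n' : ℕ} (_ : Fin n ≃ Fin n') (a : ℤ), V n' a →ₗ[K] V n a)
    (act_refl : ∀ n a x, act (Equiv.refl (Fin n)) a x = x)
    (act_trans : ∀ {n n' n'' : ℕ} (φ : Fin n ≃ Fin n') (ψ : Fin n' ≃ Fin n'') (a : ℤ)
      (x : V n'' a), act (φ.trans ψ) a x = act φ a (act ψ a x)) : SMod K where
  obj n a := ModuleCat.of K (V n.unop.n a)
  map f a := ModuleCat.ofHom (act f.unop a)
  map_id n := by
    funext a
    ext x
    exact act_refl _ _ x
  map_comp f g := by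
    funext a
    ext x
    exact act_trans g.unop f.unop a x

/-- Build a morphism of graded `𝕊`-modules from its components. -/
def homMk {V W : SMod K} (f : ∀ n a, V.at' n a →ₗ[K] W.at' n a)
    (comm : ∀ {n n' : ℕ} (φ : Fin n ≃ Fin n') (a : ℤ) (x : V.at' n' a),
      f n a (V.act φ a x) = W.act φ a (f n' a x)) : V ⟶ W where
  app n a := ModuleCat.ofHom (f n.unop.n a)
  naturality n n' φ := by
    funext a
    ext x
    exact comm φ.unop a x

/-- The identification of components of equal degrees. -/
def degCast (V : SMod K) (n : ℕ) {a a' : ℤ} (h : a = a') : V.at' n a →ₗ[K] V.at' n a' :=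
  h ▸ LinearMap.id

lemma degCast_rfl (V : SMod K) (n : ℕ) {a : ℤ} (h : a = a) (x : V.at' n a) :
    V.degCast n h x = x := rfl

lemma degCast_act (V : SMod K) {n n' : ℕ} (φ : Fin n ≃ Fin n') {a a' : ℤ} (h : a = a')
    (x : V.at' n' a) : V.degCast n h (V.act φ a x) = V.act φ a' (V.degCast n' h x) := by
  subst h; rfl

end SMod

open SMod

/-- Degree `r` maps of graded `𝕊`-modules (natural with respect to the symmetric groups, not
required to preserve degrees). The component from degree `a` to degree `a'` is indexed by a proof
of `a + r = a'`. -/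
structure DegMap {K : Type u} [Field K] (r : ℤ) (V W : SMod K) where
  app (n : ℕ) (a a' : ℤ) (h : a + r = a') : V.at' n a →ₗ[K] W.at' n a'
  comm : ∀ {n n' : ℕ} (φ : Fin n ≃ Fin n') (a a' : ℤ) (h : a + r = a') (x : V.at' n' a),
    app n a a' h (V.act φ a x) = W.act φ a' (app n' a a' h x)

namespace DegMap

variable {K : Type u} [Field K]

/-- A morphism of graded `𝕊`-modules as a map of degree `0`. -/
def ofHom {V W : SMod K} (f : V ⟶ W) : DegMap 0 V W where
  app n a a' h := (W.degCast n (by omega)) ∘ₗ (appl f n a)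
  comm φ a a' h x := by
    simp only [LinearMap.comp_apply, appl_act, degCast_act]

end DegMap

open scoped Classical in
/-- The Koszul sign: letters indexed by `ι` with degrees `deg` are written in the order given by
`f : ι → A`, and are reordered into the order given by `g : ι → B`. Each pair of letters whose
order is reversed contributes `(-1) ^ (product of the degrees)`. -/
def koszulSign {ι A B : Type*} [Fintype ι] [LT A] [LT B] (deg : ι → ℤ) (f : ι → A) (g : ι → B) :
    ℤˣ :=
  ∏ p : ι × ι, if f p.1 < f p.2 ∧ g p.2 < g p.1 then (deg p.1 * deg p.2).negOnePow else 1

section KoszulSign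

lemma negOnePow_mul_self (n : ℤ) : n.negOnePow * n.negOnePow = 1 := by
  rw [← Int.negOnePow_add]; exact Int.negOnePow_even _ ⟨n, rfl⟩

lemma koszulSign_cocycle {ι A B C : Type*} [Fintype ι] [LinearOrder A] [LinearOrder B]
    [LinearOrder C] (deg : ι → ℤ) {f : ι → A} {g : ι → B} {h : ι → C} (hf : f.Injective)
    (hg : g.Injective) (hh : h.Injective) :
    koszulSign deg f g * koszulSign deg g h = koszulSign deg f h := by
  classical
  rw [← mul_inv_eq_one, Int.units_inv_eq_self]
  unfold koszulSign
  rw [← Finset.prod_mul_distrib, ← Finset.prod_mul_distrib]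
  refine Finset.prod_involution (fun p _ => p.swap) ?_ ?_ (fun _ _ => Finset.mem_univ _)
    (fun _ _ => Prod.swap_swap _)
  · rintro ⟨x, y⟩ -
    by_cases hxy : x = y
    · subst hxy; simp
    have h1 := hf.ne hxy
    have h2 := hg.ne hxy
    have h3 := hh.ne hxy
    have hs := negOnePow_mul_self (deg x * deg y)
    simp only [Prod.fst_swap, Prod.snd_swap, mul_comm (deg y) (deg x)]
    rcases lt_or_gt_of_ne h1 with h1 | h1 <;> rcases lt_or_gt_of_ne h2 with h2 | h2 <;>
      rcases lt_or_gt_of_ne h3 with h3 | h3 <;>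
      simp [h1, h2, h3, h1.not_gt, h2.not_gt, h3.not_gt, hs]
  · rintro ⟨x, y⟩ - hne heq
    have hxy : y = x := congrArg Prod.fst heq
    subst hxy
    simp at hne

lemma koszulSign_comp {ι ι' A B : Type*} [Fintype ι] [Fintype ι'] [LT A] [LT B] (σ : ι ≃ ι')
    (deg : ι' → ℤ) (f : ι' → A) (g : ι' → B) :
    koszulSign (fun i => deg (σ i)) (fun i => f (σ i)) (fun i => g (σ i)) = koszulSign deg f g := by
  classical
  unfold koszulSign
  exact Fintype.prod_equiv (σ.prodCongr σ) _ _ (fun _ => rfl)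

lemma koszulSign_congr {ι A B A' B' : Type*} [Fintype ι] [LT A] [LT B] [LT A'] [LT B']
    {deg : ι → ℤ} {f : ι → A} {g : ι → B} {f' : ι → A'} {g' : ι → B'}
    (hf : ∀ x y, f x < f y ↔ f' x < f' y) (hg : ∀ x y, g x < g y ↔ g' x < g' y) :
    koszulSign deg f g = koszulSign deg f' g' := by
  classical
  unfold koszulSign
  simp only [hf, hg]

lemma koszulSign_zero {ι A B : Type*} [Fintype ι] [LT A] [LT B]
    {deg : ι → ℤ} (h : ∀ i, deg i = 0) (f : ι → A) (g : ι → B) :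
    koszulSign deg f g = 1 := by
  classical
  unfold koszulSign
  simp [h]

lemma negOnePow_sum {ι : Type*} (s : Finset ι) (f : ι → ℤ) :
    (∑ i ∈ s, f i).negOnePow = ∏ i ∈ s, (f i).negOnePow := by
  classical
  induction s using Finset.induction_on with
  | empty => simp
  | insert a s ha ih => rw [Finset.sum_insert ha, Finset.prod_insert ha, Int.negOnePow_add, ih]

end KoszulSign

namespace SMod

/-- Index of a summand of the composite `𝕊`-module in arity `n` and degree `d`: a root of arity `k`
and degree `a`, whose `j`-th input carries an element of arity `m j` and degree `b j`, and a
labelling `e` of all the inputs of the upper elements by `{1, …, n}`. -/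
structure Shape (n : ℕ) (d : ℤ) where
  k : ℕ
  a : ℤ
  m : Fin k → ℕ
  b : Fin k → ℤ
  e : (Σ j, Fin (m j)) ≃ Fin n
  deg : a + ∑ j, b j = d

namespace Shape

variable {n : ℕ} {d : ℤ}

/-- Renumber the inputs of the root. -/
abbrev perm (s : Shape n d) {k : ℕ} (σ : Fin k ≃ Fin s.k) : Shape n d where
  k := k
  a := s.a
  m j := s.m (σ j)
  b j := s.b (σ j)
  e := (Equiv.sigmaCongrLeft (β := fun j => Fin (s.m j)) σ).trans s.e
  deg := (congrArg (s.a + ·) (Equiv.sum_comp σ s.b)).trans s.deg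

/-- Renumber the inputs of the upper elements. -/
abbrev relabel (s : Shape n d) {m : Fin s.k → ℕ} (φ : ∀ j, Fin (m j) ≃ Fin (s.m j)) : Shape n d where
  k := s.k
  a := s.a
  m := m
  b := s.b
  e := (Equiv.sigmaCongrRight φ).trans s.e
  deg := s.deg

/-- Transport the labelling along a bijection. -/
abbrev transport {n' : ℕ} (ψ : Fin n ≃ Fin n') (s : Shape n' d) : Shape n d where
  k := s.k
  a := s.a
  m := s.m
  b := s.b
  e := s.e.trans ψ.symm
  deg := s.deg

end Shape

variable {K : Type u} [Field K]

section Comp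

variable (V W : SMod K)

/-- The direct sum of all `V(k)_a ⊗ (W(m₁)_{b₁} ⊗ ⋯ ⊗ W(m_k)_{b_k})`, over all labellings. -/
abbrev CompPre (n : ℕ) (d : ℤ) : Type u :=
  ⨁ s : Shape n d, (V.at' s.k s.a ⊗[K] PiTensorProduct K fun j => W.at' (s.m j) (s.b j))

open scoped Classical in
/-- The elementary tensor `v ⊗ (w₁ ⊗ ⋯ ⊗ w_k)` in a given summand. -/
def tens {n : ℕ} {d : ℤ} (s : Shape n d) (v : V.at' s.k s.a)
    (w : ∀ j, W.at' (s.m j) (s.b j)) : CompPre V W n d :=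
  DirectSum.lof K _ (fun s : Shape n d => V.at' s.k s.a ⊗[K] PiTensorProduct K fun j => W.at' (s.m j) (s.b j)) s
    (v ⊗ₜ PiTensorProduct.tprod K w)

/-- The relations defining the composite: the tensor product over `𝕊_k` (with Koszul sign), and
the compatibility of relabelling with the action on the upper elements. -/
inductive CompRel {n : ℕ} {d : ℤ} : CompPre V W n d → CompPre V W n d → Prop
  | perm (s : Shape n d) {k : ℕ} (σ : Fin k ≃ Fin s.k) (v : V.at' s.k s.a)
      (w : ∀ j, W.at' (s.m j) (s.b j)) :
      CompRel (tens V W (s.perm σ) (V.act σ s.a v) (fun j => w (σ j)))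
        (koszulSign (fun j => s.b (σ j)) id σ • tens V W s v w)
  | relabel (s : Shape n d) {m : Fin s.k → ℕ} (φ : ∀ j, Fin (m j) ≃ Fin (s.m j))
      (v : V.at' s.k s.a) (w : ∀ j, W.at' (s.m j) (s.b j)) :
      CompRel (tens V W (s.relabel φ) v (fun j => W.act (φ j) (s.b j) (w j))) (tens V W s v w)

/-- The component of arity `n` and degree `d` of the composite `V ∘ W`. -/
abbrev CompObj (n : ℕ) (d : ℤ) : Type u :=
  CompPre V W n d ⧸ Submodule.span K {x | ∃ p q, CompRel V W p q ∧ x = p - q}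

variable {V W}

open scoped Classical in
/-- The class of the elementary tensor `v ⊗ (w₁ ⊗ ⋯ ⊗ w_k)` in the composite. -/
def cmk {n : ℕ} {d : ℤ} (s : Shape n d) :
    V.at' s.k s.a →ₗ[K] MultilinearMap K (fun j => W.at' (s.m j) (s.b j)) (CompObj V W n d) :=
  (PiTensorProduct.lift (R := K) (s := fun j => W.at' (s.m j) (s.b j))).symm.toLinearMap ∘ₗ
    TensorProduct.curry ((Submodule.mkQ _) ∘ₗ DirectSum.lof K _
      (fun s : Shape n d => V.at' s.k s.a ⊗[K] PiTensorProduct K fun j => W.at' (s.m j) (s.b j)) s)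

lemma cmk_eq {n : ℕ} {d : ℤ} (s : Shape n d) (v : V.at' s.k s.a)
    (w : ∀ j, W.at' (s.m j) (s.b j)) : cmk s v w = Submodule.Quotient.mk (tens V W s v w) := rfl

lemma zu_smul_eq {M : Type*} [AddCommGroup M] [Module K M] (ε : ℤˣ) (x : M) :
    ε • x = ((ε : ℤ) : K) • x := by
  rw [Units.smul_def, Int.cast_smul_eq_zsmul]

lemma map_zu {M N : Type*} [AddCommGroup M] [Module K M] [AddCommGroup N] [Module K N]
    (f : M →ₗ[K] N) (ε : ℤˣ) (x : M) : f (ε • x) = ε • f x := by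
  rw [Units.smul_def, Units.smul_def, map_zsmul]

lemma cmk_perm {n : ℕ} {d : ℤ} (s : Shape n d) {k : ℕ} (σ : Fin k ≃ Fin s.k) (v : V.at' s.k s.a)
    (w : ∀ j, W.at' (s.m j) (s.b j)) :
    cmk (s.perm σ) (V.act σ s.a v) (fun j => w (σ j)) =
      koszulSign (fun j => s.b (σ j)) id σ • cmk s v w := by
  rw [cmk_eq, cmk_eq]
  have h := (Submodule.Quotient.eq (Submodule.span K
    {x | ∃ p q, CompRel V W (n := n) (d := d) p q ∧ x = p - q})).2
    (Submodule.subset_span ⟨_, _, .perm s σ v w, rfl⟩)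
  exact h.trans (map_zu (Submodule.mkQ _) _ _)

lemma cmk_relabel {n : ℕ} {d : ℤ} (s : Shape n d) {m : Fin s.k → ℕ}
    (φ : ∀ j, Fin (m j) ≃ Fin (s.m j)) (v : V.at' s.k s.a) (w : ∀ j, W.at' (s.m j) (s.b j)) :
    cmk (s.relabel φ) v (fun j => W.act (φ j) (s.b j) (w j)) = cmk s v w := by
  rw [cmk_eq, cmk_eq]
  exact (Submodule.Quotient.eq _).2 (Submodule.subset_span ⟨_, _, .relabel s φ v w, rfl⟩)

section lift

variable {n : ℕ} {d : ℤ} {M : Type*} [AddCommGroup M] [Module K M]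
  (F : ∀ s : Shape n d,
    V.at' s.k s.a →ₗ[K] MultilinearMap K (fun j => W.at' (s.m j) (s.b j)) M)

open scoped Classical in
/-- The linear map on the direct sum determined by multilinear maps on the summands. -/
def preLift : CompPre V W n d →ₗ[K] M :=
  DirectSum.toModule K _ _ fun s =>
    TensorProduct.lift ((PiTensorProduct.lift (R := K)).toLinearMap ∘ₗ F s)

lemma preLift_tens (s : Shape n d) (v : V.at' s.k s.a) (w : ∀ j, W.at' (s.m j) (s.b j)) :
    preLift F (tens V W s v w) = F s v w := by
  simp [preLift, tens, DirectSum.toModule_lof]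

/-- The linear map on the composite determined by compatible multilinear maps. -/
def clift
    (h₁ : ∀ (s : Shape n d) {k : ℕ} (σ : Fin k ≃ Fin s.k) (v : V.at' s.k s.a)
      (w : ∀ j, W.at' (s.m j) (s.b j)), F (s.perm σ) (V.act σ s.a v) (fun j => w (σ j)) =
      koszulSign (fun j => s.b (σ j)) id σ • F s v w)
    (h₂ : ∀ (s : Shape n d) {m : Fin s.k → ℕ} (φ : ∀ j, Fin (m j) ≃ Fin (s.m j))
      (v : V.at' s.k s.a) (w : ∀ j, W.at' (s.m j) (s.b j)),
      F (s.relabel φ) v (fun j => W.act (φ j) (s.b j) (w j)) = F s v w) :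
    CompObj V W n d →ₗ[K] M :=
  Submodule.liftQ _ (preLift F) <| by
    rw [Submodule.span_le]
    rintro x ⟨p, q, hpq, rfl⟩
    rw [SetLike.mem_coe, LinearMap.mem_ker, map_sub, sub_eq_zero]
    cases hpq with
    | perm s σ v w =>
      rw [map_zu, preLift_tens, preLift_tens]
      exact h₁ s σ v w
    | relabel s φ v w =>
      rw [preLift_tens, preLift_tens]
      exact h₂ s φ v w

@[simp]
lemma clift_cmk (h₁) (h₂) (s : Shape n d) (v : V.at' s.k s.a) (w : ∀ j, W.at' (s.m j) (s.b j)) :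
    clift F h₁ h₂ (cmk s v w) = F s v w := by
  rw [cmk_eq]
  exact preLift_tens F s v w

lemma comp_ext {f g : CompObj V W n d →ₗ[K] M}
    (h : ∀ (s : Shape n d) (v : V.at' s.k s.a) (w : ∀ j, W.at' (s.m j) (s.b j)),
      f (cmk s v w) = g (cmk s v w)) : f = g := by
  classical
  refine Submodule.linearMap_qext _ (DirectSum.linearMap_ext _ fun s => ?_)
  refine TensorProduct.ext (LinearMap.ext fun v => ?_)
  refine PiTensorProduct.ext (MultilinearMap.ext fun w => ?_)
  exact h s v w

end lift

/-- The action of bijections on the composite. -/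
def compAct (V W : SMod K) {n n' : ℕ} (ψ : Fin n ≃ Fin n') (d : ℤ) :
    CompObj V W n' d →ₗ[K] CompObj V W n d :=
  clift (fun s => cmk (s.transport ψ)) (fun s _ σ v w => cmk_perm (s.transport ψ) σ v w)
    (fun s _ φ v w => cmk_relabel (s.transport ψ) φ v w)

lemma compAct_cmk {n n' : ℕ} (ψ : Fin n ≃ Fin n') {d : ℤ} (s : Shape n' d)
    (v : V.at' s.k s.a) (w : ∀ j, W.at' (s.m j) (s.b j)) :
    compAct V W ψ d (cmk s v w) = cmk (s.transport ψ) v w :=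
  clift_cmk _ _ _ _ _ _

end Comp

/-- The composite `V ∘ W` of graded `𝕊`-modules. -/
def comp (V W : SMod K) : SMod K :=
  SMod.of (fun n d => CompObj V W n d) (fun φ d => compAct V W φ d)
    (fun n d x => by
      have : compAct V W (Equiv.refl (Fin n)) d = LinearMap.id :=
        comp_ext fun s v w => by rw [compAct_cmk]; rfl
      exact LinearMap.congr_fun this x)
    (fun φ ψ d x => by
      have : compAct V W (φ.trans ψ) d = compAct V W φ d ∘ₗ compAct V W ψ d :=
        comp_ext fun s v w => by
          rw [LinearMap.comp_apply, compAct_cmk, compAct_cmk, compAct_cmk]; rfl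
      exact LinearMap.congr_fun this x)

/-- The elementary tensor `v ⊗ (w₁ ⊗ ⋯ ⊗ w_k)` as an element of `V ∘ W`. -/
def mk {V W : SMod K} {n : ℕ} {d : ℤ} (s : Shape n d) (v : V.at' s.k s.a)
    (w : ∀ j, W.at' (s.m j) (s.b j)) : (comp V W).at' n d :=
  cmk s v w

lemma mk_perm {V W : SMod K} {n : ℕ} {d : ℤ} (s : Shape n d) {k : ℕ} (σ : Fin k ≃ Fin s.k)
    (v : V.at' s.k s.a) (w : ∀ j, W.at' (s.m j) (s.b j)) :
    mk (s.perm σ) (V.act σ s.a v) (fun j => w (σ j)) =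
      koszulSign (fun j => s.b (σ j)) id σ • mk s v w :=
  cmk_perm s σ v w

lemma mk_relabel {V W : SMod K} {n : ℕ} {d : ℤ} (s : Shape n d) {m : Fin s.k → ℕ}
    (φ : ∀ j, Fin (m j) ≃ Fin (s.m j)) (v : V.at' s.k s.a) (w : ∀ j, W.at' (s.m j) (s.b j)) :
    mk (s.relabel φ) v (fun j => W.act (φ j) (s.b j) (w j)) = mk s v w :=
  cmk_relabel s φ v w

lemma act_mk {V W : SMod K} {n n' : ℕ} (ψ : Fin n ≃ Fin n') {d : ℤ} (s : Shape n' d)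
    (v : V.at' s.k s.a) (w : ∀ j, W.at' (s.m j) (s.b j)) :
    (comp V W).act ψ d (mk s v w) = mk (s.transport ψ) v w :=
  compAct_cmk ψ s v w

/-- The elementary tensors as a multilinear map with values in `V ∘ W`. -/
def mkₗ (V W : SMod K) {n : ℕ} {d : ℤ} (s : Shape n d) :
    V.at' s.k s.a →ₗ[K] MultilinearMap K (fun j => W.at' (s.m j) (s.b j)) ((comp V W).at' n d) :=
  cmk s

lemma mkₗ_apply {V W : SMod K} {n : ℕ} {d : ℤ} (s : Shape n d) (v : V.at' s.k s.a)
    (w : ∀ j, W.at' (s.m j) (s.b j)) : mkₗ V W s v w = mk s v w := rfl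

/-- The linear map on `(V ∘ W)(n)_d` determined by compatible multilinear maps. -/
def desc {V W : SMod K} {n : ℕ} {d : ℤ} {M : Type*} [AddCommGroup M] [Module K M]
    (F : ∀ s : Shape n d,
      V.at' s.k s.a →ₗ[K] MultilinearMap K (fun j => W.at' (s.m j) (s.b j)) M)
    (h₁ : ∀ (s : Shape n d) {k : ℕ} (σ : Fin k ≃ Fin s.k) (v : V.at' s.k s.a)
      (w : ∀ j, W.at' (s.m j) (s.b j)), F (s.perm σ) (V.act σ s.a v) (fun j => w (σ j)) =
      koszulSign (fun j => s.b (σ j)) id σ • F s v w)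
    (h₂ : ∀ (s : Shape n d) {m : Fin s.k → ℕ} (φ : ∀ j, Fin (m j) ≃ Fin (s.m j))
      (v : V.at' s.k s.a) (w : ∀ j, W.at' (s.m j) (s.b j)),
      F (s.relabel φ) v (fun j => W.act (φ j) (s.b j) (w j)) = F s v w) :
    (comp V W).at' n d →ₗ[K] M :=
  clift F h₁ h₂

@[simp]
lemma desc_mk {V W : SMod K} {n : ℕ} {d : ℤ} {M : Type*} [AddCommGroup M] [Module K M]
    (F : ∀ s : Shape n d,
      V.at' s.k s.a →ₗ[K] MultilinearMap K (fun j => W.at' (s.m j) (s.b j)) M) (h₁) (h₂)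
    (s : Shape n d) (v : V.at' s.k s.a) (w : ∀ j, W.at' (s.m j) (s.b j)) :
    desc F h₁ h₂ (mk s v w) = F s v w :=
  clift_cmk F h₁ h₂ s v w

lemma hom_ext_mk {V W : SMod K} {n : ℕ} {d : ℤ} {M : Type*} [AddCommGroup M] [Module K M]
    {f g : (comp V W).at' n d →ₗ[K] M}
    (h : ∀ (s : Shape n d) (v : V.at' s.k s.a) (w : ∀ j, W.at' (s.m j) (s.b j)),
      f (mk s v w) = g (mk s v w)) (x : (comp V W).at' n d) : f x = g x :=
  LinearMap.congr_fun (comp_ext (f := f) (g := g) h) x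

lemma desc_act {V W X : SMod K} {d d' : ℤ}
    (f : ∀ n, (comp V W).at' n d →ₗ[K] X.at' n d') {n n' : ℕ} (ψ : Fin n ≃ Fin n')
    (h : ∀ (s : Shape n' d) (v : V.at' s.k s.a) (w : ∀ j, W.at' (s.m j) (s.b j)),
      f n (mk (s.transport ψ) v w) = X.act ψ d' (f n' (mk s v w))) (x : (comp V W).at' n' d) :
    f n ((comp V W).act ψ d x) = X.act ψ d' (f n' x) :=
  hom_ext_mk (f := f n ∘ₗ (comp V W).act ψ d) (g := X.act ψ d' ∘ₗ f n')
    (fun s v w => by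
      rw [LinearMap.comp_apply, LinearMap.comp_apply, act_mk]
      exact h s v w) x

lemma appl_homMk {V W : SMod K} (f : ∀ n a, V.at' n a →ₗ[K] W.at' n a) (comm) (n : ℕ) (a : ℤ)
    (x : V.at' n a) : appl (homMk f comm) n a x = f n a x := rfl

/-- The components of `f ∘ g`. -/
def compMapAux {V V' W W' : SMod K} (f : V ⟶ V') (g : W ⟶ W') (n : ℕ) (d : ℤ) :
    (comp V W).at' n d →ₗ[K] (comp V' W').at' n d :=
  desc (fun s => (MultilinearMap.compLinearMapₗ fun j => appl g (s.m j) (s.b j)) ∘ₗ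
      mkₗ V' W' s ∘ₗ appl f s.k s.a)
    (fun s k σ v w => by
      have := mk_perm s σ (appl f _ _ v) (fun j => appl g _ _ (w j))
      rw [← appl_act] at this
      exact this)
    (fun s m φ v w => by
      have := mk_relabel s φ (appl f _ _ v) (fun j => appl g _ _ (w j))
      simp only [← appl_act] at this
      exact this)

lemma compMapAux_mk {V V' W W' : SMod K} (f : V ⟶ V') (g : W ⟶ W') {n : ℕ} {d : ℤ}
    (s : Shape n d) (v : V.at' s.k s.a) (w : ∀ j, W.at' (s.m j) (s.b j)) :
    compMapAux f g n d (mk s v w) =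
      mk s (appl f s.k s.a v) (fun j => appl g (s.m j) (s.b j) (w j)) :=
  desc_mk _ _ _ s v w

/-- `f ∘ g` for morphisms of graded `𝕊`-modules: `v ⊗ (w₁ ⊗ ⋯) ↦ f v ⊗ (g w₁ ⊗ ⋯)`. -/
def compMap {V V' W W' : SMod K} (f : V ⟶ V') (g : W ⟶ W') : comp V W ⟶ comp V' W' :=
  homMk (compMapAux f g) (fun φ d x => desc_act (fun n => compMapAux f g n d) φ (fun s v w => by
      rw [compMapAux_mk, compMapAux_mk, act_mk]) x)

lemma compMap_mk {V V' W W' : SMod K} (f : V ⟶ V') (g : W ⟶ W') {n : ℕ} {d : ℤ} (s : Shape n d)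
    (v : V.at' s.k s.a) (w : ∀ j, W.at' (s.m j) (s.b j)) :
    appl (compMap f g) n d (mk s v w) =
      mk s (appl f s.k s.a v) (fun j => appl g (s.m j) (s.b j) (w j)) :=
  compMapAux_mk f g s v w

/-- The shape in which the degree of the root is increased by `r`. -/
abbrev Shape.shiftRoot {n : ℕ} {d d' : ℤ} (s : Shape n d) (r : ℤ) (h : d + r = d') :
    Shape n d' where
  k := s.k
  a := s.a + r
  m := s.m
  b := s.b
  e := s.e
  deg := by have := s.deg; omega

/-- The components of `f ∘ Id`. -/
def compLeftAux {r : ℤ} {V V' : SMod K} (f : DegMap r V V') (W : SMod K) (n : ℕ) (d d' : ℤ)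
    (h : d + r = d') : (comp V W).at' n d →ₗ[K] (comp V' W).at' n d' :=
  desc (fun s => mkₗ V' W (s.shiftRoot r h) ∘ₗ f.app s.k s.a (s.a + r) rfl)
    (fun s k σ v w => by
      have := mk_perm (s.shiftRoot r h) σ (f.app _ _ _ rfl v) w
      rw [← f.comm] at this
      exact this)
    (fun s m φ v w => mk_relabel (s.shiftRoot r h) φ (f.app _ _ _ rfl v) w)

lemma compLeftAux_mk {r : ℤ} {V V' : SMod K} (f : DegMap r V V') (W : SMod K) {n : ℕ} {d d' : ℤ}
    (h : d + r = d') (s : Shape n d) (v : V.at' s.k s.a) (w : ∀ j, W.at' (s.m j) (s.b j)) :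
    compLeftAux f W n d d' h (mk s v w) = mk (s.shiftRoot r h) (f.app s.k s.a (s.a + r) rfl v) w :=
  desc_mk _ _ _ s v w

/-- `f ∘ Id` for a map `f` of degree `r`: `v ⊗ (w₁ ⊗ ⋯) ↦ f v ⊗ (w₁ ⊗ ⋯)`. -/
def compLeft {r : ℤ} {V V' : SMod K} (f : DegMap r V V') (W : SMod K) :
    DegMap r (comp V W) (comp V' W) where
  app := compLeftAux f W
  comm φ d d' h x := desc_act (fun n => compLeftAux f W n d d' h) φ (fun s v w => by
      rw [compLeftAux_mk, compLeftAux_mk, act_mk]) x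

/-- The shape in which the degree of the `i`-th upper element is increased by `r`. -/
abbrev Shape.shift {n : ℕ} {d d' : ℤ} (s : Shape n d) (r : ℤ) (h : d + r = d') (i : Fin s.k) :
    Shape n d' where
  k := s.k
  a := s.a
  m := s.m
  b j := s.b j + if j = i then r else 0
  e := s.e
  deg := by
    have := s.deg
    rw [Finset.sum_add_distrib, Finset.sum_ite_eq' Finset.univ i]
    simp only [Finset.mem_univ, if_true]
    omega

/-- The map `h` if `p` holds, and the map `g` otherwise. -/
def infAux {r : ℤ} {W W' : SMod K} (g : W ⟶ W') (h : DegMap r W W') (p : Prop) [Decidable p]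
    (n : ℕ) (b : ℤ) : W.at' n b →ₗ[K] W'.at' n (b + if p then r else 0) :=
  if hp : p then h.app n b _ (by simp [hp]) else (DegMap.ofHom g).app n b _ (by simp [hp])

lemma infAux_act {r : ℤ} {W W' : SMod K} (g : W ⟶ W') (h : DegMap r W W') (p : Prop) [Decidable p]
    {n n' : ℕ} (φ : Fin n ≃ Fin n') (b : ℤ) (w : W.at' n' b) :
    infAux g h p n b (W.act φ b w) = W'.act φ _ (infAux g h p n' b w) := by
  unfold infAux
  split_ifs with hp
  · exact h.comm ..
  · exact (DegMap.ofHom g).comm ..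

lemma koszulSign_shift {k : ℕ} {A : Type*} [LinearOrder A] (β : Fin k → ℤ) (r a : ℤ) (i : Fin k)
    {σ : Fin k → A} (hσ : σ.Injective) :
    (r * (a + ∑ j with j < i, β j)).negOnePow *
        koszulSign (fun j => β j + if j = i then r else 0) id σ =
      koszulSign β id σ * (r * (a + ∑ j with σ j < σ i, β j)).negOnePow := by
  classical
  have key : koszulSign (fun j => β j + if j = i then r else 0) id σ =
      koszulSign β id σ * (∏ j, (if i < j ∧ σ j < σ i then (r * β j).negOnePow else 1)) *
        (∏ j, (if j < i ∧ σ i < σ j then (r * β j).negOnePow else 1)) := by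
    have h1 : ∏ j, (if i < j ∧ σ j < σ i then (r * β j).negOnePow else 1) =
        ∏ p : Fin k × Fin k, (if p.1 < p.2 ∧ σ p.2 < σ p.1 then
          ((if p.1 = i then r else 0) * β p.2).negOnePow else 1) := by
      refine Eq.symm ((Fintype.prod_prod_type _).trans ((Finset.prod_eq_single i ?_ ?_).trans ?_))
      · intro x _ hx
        simp [hx]
      · simp
      · simp
    have h2 : ∏ j, (if j < i ∧ σ i < σ j then (r * β j).negOnePow else 1) =
        ∏ p : Fin k × Fin k, (if p.1 < p.2 ∧ σ p.2 < σ p.1 then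
          ((if p.2 = i then r else 0) * β p.1).negOnePow else 1) := by
      refine Eq.symm ((Fintype.prod_prod_type_right _).trans
        ((Finset.prod_eq_single i ?_ ?_).trans ?_))
      · intro x _ hx
        simp [hx]
      · simp
      · simp
    rw [h1, h2]
    unfold koszulSign
    rw [← Finset.prod_mul_distrib, ← Finset.prod_mul_distrib]
    refine Finset.prod_congr rfl ?_
    rintro ⟨x, y⟩ -
    simp only [id]
    split_ifs with h hx hy hy
    · exact absurd (hx.trans hy.symm) h.1.ne
    · rw [← Int.negOnePow_add, ← Int.negOnePow_add]
      congr 1; ring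
    · rw [← Int.negOnePow_add, ← Int.negOnePow_add]
      congr 1; ring
    · simp
    · simp
  rw [key, mul_add, mul_add, Int.negOnePow_add, Int.negOnePow_add, Finset.mul_sum, Finset.mul_sum,
    negOnePow_sum, negOnePow_sum, Finset.prod_filter, Finset.prod_filter]
  rw [mul_comm, mul_assoc (koszulSign β id σ), mul_assoc, mul_left_comm _ (r * a).negOnePow]
  congr 2
  rw [← Finset.prod_mul_distrib, ← Finset.prod_mul_distrib]
  refine Finset.prod_congr rfl fun j _ => ?_
  have hs := negOnePow_mul_self (r * β j)
  rcases lt_trichotomy i j with h1 | h1 | h1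
  · rcases lt_or_gt_of_ne (hσ.ne h1.ne) with h2 | h2 <;> simp [h1, h2, h1.not_gt, h2.not_gt]
  · subst h1; simp
  · rcases lt_or_gt_of_ne (hσ.ne h1.ne) with h2 | h2 <;>
      simp [h1, h2, h1.not_gt, h2.not_gt, hs]

lemma mk_infAux_congr {r : ℤ} {V W W' : SMod K} (g : W ⟶ W') (h : DegMap r W W') {n : ℕ} {d : ℤ}
    {k : ℕ} {a : ℤ} {m : Fin k → ℕ} {b : Fin k → ℤ} {e : (Σ j, Fin (m j)) ≃ Fin n}
    {p q : Fin k → Prop} [ip : DecidablePred p] [iq : DecidablePred q] (hpq : ∀ j, p j ↔ q j) (hp) (hq)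
    (v : V.at' k a) (w : ∀ j, W.at' (m j) (b j)) :
    mk (V := V) (W := W') (n := n) (d := d) ⟨k, a, m, fun j => b j + if p j then r else 0, e, hp⟩ v
      (fun j => infAux g h (p j) (m j) (b j) (w j)) =
    mk ⟨k, a, m, fun j => b j + if q j then r else 0, e, hq⟩ v
      (fun j => infAux g h (q j) (m j) (b j) (w j)) := by
  obtain rfl : p = q := funext fun j => propext (hpq j)
  obtain rfl : ip = iq := Subsingleton.elim _ _
  rfl

lemma sum_zu_apply {ι κ A N : Type*} [Fintype ι] {M : κ → Type*} [AddCommGroup A] [Module K A]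
    [AddCommGroup N] [Module K N] [∀ j, AddCommGroup (M j)] [∀ j, Module K (M j)]
    (ε : ι → ℤˣ) (F : ι → A →ₗ[K] MultilinearMap K M N) (v : A) (w : ∀ j, M j) :
    (∑ i, ε i • F i) v w = ∑ i, ε i • F i v w := by
  simp [LinearMap.sum_apply, Units.smul_def]

/-- The components of `Id ∘ (g; h)`. -/
def compInfAux (V : SMod K) {r : ℤ} {W W' : SMod K} (g : W ⟶ W') (h : DegMap r W W') (n : ℕ)
    (d d' : ℤ) (hd : d + r = d') : (comp V W).at' n d →ₗ[K] (comp V W').at' n d' :=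
  desc (fun s => ∑ i : Fin s.k, (r * (s.a + ∑ j with j < i, s.b j)).negOnePow •
      ((MultilinearMap.compLinearMapₗ fun j => infAux g h (j = i) (s.m j) (s.b j)) ∘ₗ
        mkₗ V W' (s.shift r hd i)))
    (fun s k σ v w => by
      refine (sum_zu_apply _ _ _ _).trans ?_
      refine Eq.trans ?_ (congrArg (_ • ·) (sum_zu_apply _ _ _ _)).symm
      rw [Finset.smul_sum]
      refine Fintype.sum_equiv σ _ _ fun i => ?_
      have h1 := mk_perm (s.shift r hd (σ i)) σ v
        (fun j => infAux g h (j = σ i) (s.m j) (s.b j) (w j))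
      have h2 := mk_infAux_congr (V := V) g h (n := n) (d := d') (k := k) (a := s.a)
        (m := fun j => s.m (σ j)) (b := fun j => s.b (σ j)) (e := (s.perm σ).e)
        (p := fun j => σ j = σ i) (q := fun j => j = i) (fun j => σ.injective.eq_iff)
        ((s.shift r hd (σ i)).perm σ).deg ((s.perm σ).shift r hd i).deg (V.act σ s.a v)
        (fun j => w (σ j))
      have h3 := koszulSign_shift (fun j => s.b (σ j)) r s.a i σ.injective
      have h4 : ∑ j with σ j < σ i, s.b (σ j) = ∑ j with j < σ i, s.b j := by
        rw [Finset.sum_filter, Finset.sum_filter]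
        exact Equiv.sum_comp σ (fun j => if j < σ i then s.b j else 0)
      have h5 := koszulSign_congr (deg := fun j => s.b (σ j) + if j = i then r else 0)
        (f := id) (g := σ) (f' := id) (g' := σ) (fun _ _ => Iff.rfl) (fun _ _ => Iff.rfl)
      rw [h4] at h3
      refine (congrArg ((r * (s.a + ∑ j with j < i, s.b (σ j))).negOnePow • ·)
        (h2.symm.trans h1)).trans ?_
      simp only [σ.injective.eq_iff]
      rw [smul_smul, h3, ← smul_smul]
      rfl)
    (fun s m φ v w => by
      refine (sum_zu_apply _ _ _ _).trans (Eq.trans ?_ (sum_zu_apply _ _ _ _).symm)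
      refine Finset.sum_congr rfl fun i _ => ?_
      have h1 := mk_relabel (s.shift r hd i) φ v
        (fun j => infAux g h (j = i) (s.m j) (s.b j) (w j))
      simp only [← infAux_act] at h1
      exact congrArg ((r * (s.a + ∑ j with j < i, s.b j)).negOnePow • ·) h1)

lemma compInfAux_mk (V : SMod K) {r : ℤ} {W W' : SMod K} (g : W ⟶ W') (h : DegMap r W W') {n : ℕ}
    {d d' : ℤ} (hd : d + r = d') (s : Shape n d) (v : V.at' s.k s.a)
    (w : ∀ j, W.at' (s.m j) (s.b j)) :
    compInfAux V g h n d d' hd (mk s v w) =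
      ∑ i : Fin s.k, (r * (s.a + ∑ j with j < i, s.b j)).negOnePow •
        mk (s.shift r hd i) v (fun j => infAux g h (j = i) (s.m j) (s.b j) (w j)) := by
  rw [compInfAux, desc_mk]
  exact sum_zu_apply _ _ _ _

/-- `Id ∘ (g; h)` for a morphism `g` and a map `h` of degree `r`: the element
`v ⊗ (w₁ ⊗ ⋯ ⊗ w_k)` is sent to the sum over `i` of
`± v ⊗ (g w₁ ⊗ ⋯ ⊗ g w_{i-1} ⊗ h w_i ⊗ g w_{i+1} ⊗ ⋯ ⊗ g w_k)`, where the sign is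
`(-1) ^ (r (|v| + |w₁| + ⋯ + |w_{i-1}|))`. -/
def compInf (V : SMod K) {r : ℤ} {W W' : SMod K} (g : W ⟶ W') (h : DegMap r W W') :
    DegMap r (comp V W) (comp V W') where
  app := compInfAux V g h
  comm φ d d' hd x := desc_act (fun n => compInfAux V g h n d d' hd) φ (fun s v w => by
      rw [compInfAux_mk, compInfAux_mk, map_sum]
      refine Finset.sum_congr rfl fun i _ => ?_
      rw [map_zu, act_mk]) x

/-- The unit `𝕊`-module `I`: it is `K` in arity `1` and degree `0`, and zero otherwise. -/
def unit (K : Type u) [Field K] : SMod K :=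
  SMod.of (fun n a => PLift (n = 1 ∧ a = 0) → K)
    (fun φ _ => LinearMap.funLeft K K
      fun h => ⟨(Fin.equiv_iff_eq.1 ⟨φ⟩).symm.trans h.down.1, h.down.2⟩)
    (fun _ _ _ => rfl) (fun _ _ _ _ => rfl)

/-- The value in `K` of an element of `I(1)₀`. -/
def unitVal {n : ℕ} {a : ℤ} (h : n = 1 ∧ a = 0) : (unit K).at' n a →ₗ[K] K :=
  LinearMap.proj (R := K) (φ := fun _ : PLift (n = 1 ∧ a = 0) => K) ⟨h⟩

lemma unitVal_act {n n' : ℕ} {a : ℤ} (φ : Fin n ≃ Fin n') (h : n = 1 ∧ a = 0)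
    (h' : n' = 1 ∧ a = 0) (x : (unit K).at' n' a) :
    unitVal h ((unit K).act φ a x) = unitVal h' x := rfl

section LeftUnitor

/-- If the root has exactly one input `j`, the inputs of the upper element are labelled by
`{1, …, n}`. -/
def Shape.soleEquiv {n : ℕ} {d : ℤ} (s : Shape n d) (h : s.k = 1) (j : Fin s.k) :
    Fin n ≃ Fin (s.m j) :=
  s.e.symm.trans (@Equiv.uniqueSigma (Fin s.k) (fun j => Fin (s.m j))
    ⟨⟨j⟩, fun x => Fin.ext (by omega)⟩)

lemma Shape.soleEquiv_symm_apply {n : ℕ} {d : ℤ} (s : Shape n d) (h : s.k = 1) (j : Fin s.k)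
    (x : Fin (s.m j)) : (s.soleEquiv h j).symm x = s.e ⟨j, x⟩ := rfl

lemma Shape.b_sole {n : ℕ} {d : ℤ} (s : Shape n d) (h : s.k = 1 ∧ s.a = 0) (j : Fin s.k) :
    s.b j = d := by
  have : Subsingleton (Fin s.k) := by rw [h.1]; infer_instance
  have := s.deg
  rw [Fintype.sum_subsingleton _ j, h.2] at this
  omega

/-- The value of the left unitor on elementary tensors with root in `I(1)₀`, without the
coefficient given by the root. -/
def leftUnitVal (W : SMod K) {n : ℕ} {d : ℤ} (s : Shape n d) (h : s.k = 1 ∧ s.a = 0)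
    (j : Fin s.k) : W.at' (s.m j) (s.b j) →ₗ[K] W.at' n d :=
  W.degCast n (s.b_sole h j) ∘ₗ W.act (s.soleEquiv h.1 j) (s.b j)

lemma leftUnitVal_congr (W : SMod K) {n : ℕ} {d : ℤ} (s : Shape n d) (h : s.k = 1 ∧ s.a = 0)
    (i j : Fin s.k) (w : ∀ j, W.at' (s.m j) (s.b j)) :
    leftUnitVal W s h i (w i) = leftUnitVal W s h j (w j) := by
  obtain rfl : i = j := Fin.ext (by omega)
  rfl

open scoped Classical in
/-- The left unitor on a summand: `c ⊗ w ↦ c w`. -/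
def leftUnitForm (W : SMod K) {n : ℕ} {d : ℤ} (s : Shape n d) :
    (unit K).at' s.k s.a →ₗ[K] MultilinearMap K (fun j => W.at' (s.m j) (s.b j)) (W.at' n d) :=
  if h : s.k = 1 ∧ s.a = 0 then
    (unitVal h).smulRight
      { toFun := fun w => leftUnitVal W s h ⟨0, by omega⟩ (w ⟨0, by omega⟩)
        map_update_add' := fun {_} w i x y => by
          obtain rfl : i = ⟨0, by omega⟩ := Fin.ext (by omega)
          simp
        map_update_smul' := fun {_} w i c x => by
          obtain rfl : i = ⟨0, by omega⟩ := Fin.ext (by omega)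
          simp }
  else 0

lemma leftUnitForm_pos (W : SMod K) {n : ℕ} {d : ℤ} (s : Shape n d) (h : s.k = 1 ∧ s.a = 0)
    (j : Fin s.k) (c : (unit K).at' s.k s.a) (w : ∀ j, W.at' (s.m j) (s.b j)) :
    leftUnitForm W s c w = unitVal h c • leftUnitVal W s h j (w j) := by
  rw [leftUnitForm, dif_pos h, leftUnitVal_congr W s h j ⟨0, by omega⟩]
  rfl

lemma leftUnitForm_neg (W : SMod K) {n : ℕ} {d : ℤ} (s : Shape n d) (h : ¬ (s.k = 1 ∧ s.a = 0)) :
    leftUnitForm W s = 0 := by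
  rw [leftUnitForm, dif_neg h]

/-- The components of the left unitor. -/
def leftUnitorAux (W : SMod K) (n : ℕ) (d : ℤ) : (comp (unit K) W).at' n d →ₗ[K] W.at' n d :=
  desc (leftUnitForm W)
    (fun s k σ c w => by
      by_cases h : s.k = 1 ∧ s.a = 0
      · obtain rfl : k = s.k := Fin.equiv_iff_eq.1 ⟨σ⟩
        have hs : koszulSign (fun j => s.b (σ j)) id σ = 1 := by
          classical
          unfold koszulSign
          refine Finset.prod_eq_one fun p _ => if_neg fun hp => ?_
          exact absurd hp.1 (by simp only [id, Fin.lt_def]; omega)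
        let j : Fin s.k := ⟨0, by omega⟩
        rw [hs, one_smul, leftUnitForm_pos W s h (σ j)]
        refine (leftUnitForm_pos W (s.perm σ) h j _ _).trans ?_
        congr 1
        have he : s.soleEquiv h.1 (σ j) = (s.perm σ).soleEquiv h.1 j := by
          apply Equiv.symm_bijective.injective
          ext x
          rw [Shape.soleEquiv_symm_apply, Shape.soleEquiv_symm_apply (s.perm σ)]
          rfl
        simp only [leftUnitVal, LinearMap.comp_apply]
        rw [he]
      · have h' : ¬ ((s.perm σ).k = 1 ∧ (s.perm σ).a = 0) := fun h' =>
          h ⟨(Fin.equiv_iff_eq.1 ⟨σ⟩).symm.trans h'.1, h'.2⟩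
        rw [leftUnitForm_neg W s h, leftUnitForm_neg W _ h']
        simp)
    (fun s m φ c w => by
      by_cases h : s.k = 1 ∧ s.a = 0
      · let j : Fin s.k := ⟨0, by omega⟩
        rw [leftUnitForm_pos W s h j]
        refine (leftUnitForm_pos W (s.relabel φ) h j _ _).trans ?_
        congr 1
        have he : (s.soleEquiv h.1 j) = ((s.relabel φ).soleEquiv h.1 j).trans (φ j) := by
          apply Equiv.symm_bijective.injective
          ext x
          rw [Equiv.symm_trans_apply, Shape.soleEquiv_symm_apply,
            Shape.soleEquiv_symm_apply (s.relabel φ)]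
          simp
        simp only [leftUnitVal, LinearMap.comp_apply]
        rw [he, act_trans]
      · rw [leftUnitForm_neg W s h, leftUnitForm_neg W (s.relabel φ) h]
        rfl)

/-- The left unitor `I ∘ W → W`. -/
def leftUnitor (W : SMod K) : comp (unit K) W ⟶ W :=
  homMk (leftUnitorAux W) (fun ψ d x => desc_act (fun n => leftUnitorAux W n d) ψ (fun s c w => by
    refine (desc_mk _ _ _ _ _ _).trans (Eq.trans ?_ (congrArg _ (desc_mk _ _ _ _ _ _).symm))
    by_cases h : s.k = 1 ∧ s.a = 0
    · let j : Fin s.k := ⟨0, by omega⟩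
      rw [leftUnitForm_pos W s h j, map_smul]
      refine (leftUnitForm_pos W (s.transport ψ) h j _ _).trans ?_
      congr 1
      have he : ((s.transport ψ).soleEquiv h.1 j) = ψ.trans (s.soleEquiv h.1 j) := by
        apply Equiv.symm_bijective.injective
        ext x
        rfl
      simp only [leftUnitVal, LinearMap.comp_apply]
      rw [he, act_trans, degCast_act]
    · rw [leftUnitForm_neg W s h, leftUnitForm_neg W (s.transport ψ) h]
      exact (map_zero _).symm) x)

end LeftUnitor

section RightUnitor

/-- If all the upper elements have arity `1`, the inputs of the root are labelled by
`{1, …, n}`. -/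
def Shape.rootEquiv {n : ℕ} {d : ℤ} (s : Shape n d) (h : ∀ j, s.m j = 1 ∧ s.b j = 0) :
    Fin n ≃ Fin s.k :=
  haveI : ∀ j, Unique (Fin (s.m j)) := fun j =>
    ⟨⟨⟨0, by have := h j; omega⟩⟩, fun x => Fin.ext (by have := h j; omega)⟩
  s.e.symm.trans (Equiv.sigmaUnique (Fin s.k) fun j => Fin (s.m j))

lemma Shape.rootEquiv_apply {n : ℕ} {d : ℤ} (s : Shape n d) (h : ∀ j, s.m j = 1 ∧ s.b j = 0)
    (x : Fin n) : s.rootEquiv h x = (s.e.symm x).1 := rfl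

lemma Shape.a_eq {n : ℕ} {d : ℤ} (s : Shape n d) (h : ∀ j, s.m j = 1 ∧ s.b j = 0) :
    s.a = d := by
  have := s.deg
  simpa [h] using this

open scoped Classical in
/-- The right unitor on a summand: `v ⊗ (c₁ ⊗ ⋯ ⊗ c_k) ↦ c₁ ⋯ c_k v`. -/
def rightUnitForm (V : SMod K) {n : ℕ} {d : ℤ} (s : Shape n d) :
    V.at' s.k s.a →ₗ[K] MultilinearMap K (fun j => (unit K).at' (s.m j) (s.b j)) (V.at' n d) :=
  if h : ∀ j, s.m j = 1 ∧ s.b j = 0 then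
    { toFun := fun v => ((MultilinearMap.mkPiAlgebra K (Fin s.k) K).compLinearMap
        fun j => unitVal (h j)).smulRight
          (V.degCast n (s.a_eq h) (V.act (s.rootEquiv h) s.a v))
      map_add' := fun x y => by
        refine MultilinearMap.ext fun w => ?_
        simp
      map_smul' := fun c x => by
        refine MultilinearMap.ext fun w => ?_
        simp [smul_comm c] }
  else 0

lemma rightUnitForm_pos (V : SMod K) {n : ℕ} {d : ℤ} (s : Shape n d)
    (h : ∀ j, s.m j = 1 ∧ s.b j = 0) (v : V.at' s.k s.a)
    (w : ∀ j, (unit K).at' (s.m j) (s.b j)) :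
    rightUnitForm V s v w = (∏ j, unitVal (h j) (w j)) •
      V.degCast n (s.a_eq h) (V.act (s.rootEquiv h) s.a v) := by
  rw [rightUnitForm, dif_pos h]
  simp

lemma rightUnitForm_neg (V : SMod K) {n : ℕ} {d : ℤ} (s : Shape n d)
    (h : ¬ ∀ j, s.m j = 1 ∧ s.b j = 0) : rightUnitForm V s = 0 := by
  rw [rightUnitForm, dif_neg h]

/-- The components of the right unitor. -/
def rightUnitorAux (V : SMod K) (n : ℕ) (d : ℤ) : (comp V (unit K)).at' n d →ₗ[K] V.at' n d :=
  desc (rightUnitForm V)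
    (fun s k σ v w => by
      by_cases h : ∀ j, s.m j = 1 ∧ s.b j = 0
      · rw [koszulSign_zero (fun j => (h (σ j)).2), one_smul, rightUnitForm_pos V s h]
        refine (rightUnitForm_pos V (s.perm σ) (fun j => h (σ j)) _ _).trans ?_
        congr 1
        · exact Equiv.prod_comp σ fun j => unitVal (h j) (w j)
        · have he : s.rootEquiv h = ((s.perm σ).rootEquiv fun j => h (σ j)).trans σ := by
            ext x
            rw [Equiv.trans_apply, Shape.rootEquiv_apply, Shape.rootEquiv_apply]
            obtain ⟨y, rfl⟩ := (s.perm σ).e.surjective x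
            obtain ⟨j, t⟩ := y
            rw [Equiv.symm_apply_apply]
            have : (s.perm σ).e ⟨j, t⟩ = s.e ⟨σ j, t⟩ := rfl
            rw [this, Equiv.symm_apply_apply]
          rw [he, act_trans]
      · have h' : ¬ ∀ j, (s.perm σ).m j = 1 ∧ (s.perm σ).b j = 0 := fun h' => h fun j => by
          have := h' (σ.symm j)
          simpa using this
        rw [rightUnitForm_neg V s h, rightUnitForm_neg V _ h']
        simp)
    (fun s m φ v w => by
      have hm : ∀ j, m j = s.m j := fun j => Fin.equiv_iff_eq.1 ⟨φ j⟩
      by_cases h : ∀ j, s.m j = 1 ∧ s.b j = 0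
      · have h' : ∀ j, (s.relabel φ).m j = 1 ∧ (s.relabel φ).b j = 0 := fun j =>
          ⟨(hm j).trans (h j).1, (h j).2⟩
        rw [rightUnitForm_pos V s h]
        refine (rightUnitForm_pos V (s.relabel φ) h' _ _).trans ?_
        congr 1
        have he : (s.relabel φ).rootEquiv h' = s.rootEquiv h := by
          ext x
          rw [Shape.rootEquiv_apply, Shape.rootEquiv_apply]
          obtain ⟨y, rfl⟩ := (s.relabel φ).e.surjective x
          obtain ⟨j, t⟩ := y
          rw [Equiv.symm_apply_apply]
          have : (s.relabel φ).e ⟨j, t⟩ = s.e ⟨j, φ j t⟩ := rfl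
          rw [this, Equiv.symm_apply_apply]
        rw [he]
      · have h' : ¬ ∀ j, (s.relabel φ).m j = 1 ∧ (s.relabel φ).b j = 0 := fun h' => h fun j =>
          ⟨(hm j).symm.trans (h' j).1, (h' j).2⟩
        rw [rightUnitForm_neg V s h, rightUnitForm_neg V _ h']
        rfl)

/-- The right unitor `V ∘ I → V`. -/
def rightUnitor (V : SMod K) : comp V (unit K) ⟶ V :=
  homMk (rightUnitorAux V) (fun ψ d x => desc_act (fun n => rightUnitorAux V n d) ψ (fun s v w => by
    refine (desc_mk _ _ _ _ _ _).trans (Eq.trans ?_ (congrArg _ (desc_mk _ _ _ _ _ _).symm))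
    by_cases h : ∀ j, s.m j = 1 ∧ s.b j = 0
    · rw [rightUnitForm_pos V s h, map_smul]
      refine (rightUnitForm_pos V (s.transport ψ) h _ _).trans ?_
      congr 1
      have he : (s.transport ψ).rootEquiv h = ψ.trans (s.rootEquiv h) := by
        ext x
        rfl
      rw [he, act_trans, degCast_act]
    · rw [rightUnitForm_neg V s h, rightUnitForm_neg V (s.transport ψ) h]
      exact (map_zero _).symm) x)

end RightUnitor

section AssocSign

lemma koszulSign_self {ι A : Type*} [Fintype ι] [Preorder A] (deg : ι → ℤ) (f : ι → A) :
    koszulSign deg f f = 1 := by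
  classical
  unfold koszulSign
  exact Finset.prod_eq_one fun p _ => if_neg fun h => lt_asymm h.1 h.2

lemma koszulSign_sum {ι ι' A A' B B' : Type*} [Fintype ι] [Fintype ι'] [Preorder A] [Preorder A']
    [Preorder B] [Preorder B'] (deg : ι ⊕ ι' → ℤ) (f : ι → A) (f' : ι' → A') (g : ι → B)
    (g' : ι' → B') :
    koszulSign deg (fun x => (toLex (Sum.map f f' x) : A ⊕ₗ A'))
        (fun x => (toLex (Sum.map g g' x) : B ⊕ₗ B')) =
      koszulSign (fun x => deg (.inl x)) f g * koszulSign (fun x => deg (.inr x)) f' g' := by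
  classical
  unfold koszulSign
  rw [Fintype.prod_prod_type, Fintype.prod_sum_type]
  simp only [Fintype.prod_sum_type, Sum.map_inl, Sum.map_inr, Sum.Lex.toLex_lt_toLex,
    Sum.lex_inl_inl, Sum.lex_inr_inr, Sum.lex_inr_inl, Sum.Lex.sep, and_false, false_and, if_false,
    Finset.prod_const_one, mul_one, one_mul]
  rw [Fintype.prod_prod_type, Fintype.prod_prod_type]

lemma koszulSign_eq {ι A B : Type*} [Fintype ι] [LT A] [LT B] (deg : ι → ℤ) (f : ι → A) (g : ι → B)
    [∀ p : ι × ι, Decidable (f p.1 < f p.2 ∧ g p.2 < g p.1)] :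
    koszulSign deg f g = ∏ p : ι × ι,
      if f p.1 < f p.2 ∧ g p.2 < g p.1 then (deg p.1 * deg p.2).negOnePow else 1 := by
  unfold koszulSign
  refine Finset.prod_congr rfl fun p _ => ?_
  split_ifs <;> rfl

/-- Signs of block permutations. -/
lemma koszulSign_block {ι : Type*} [Fintype ι] {l : ℕ} {A : Type*} [LinearOrder A]
    (deg : ι → ℤ) (π : ι → Fin l) (σ : Fin l → A) :
    koszulSign (fun i => ∑ x, if π x = i then deg x else 0) id σ =
      koszulSign deg π (fun x => σ (π x)) := by
  classical
  rw [koszulSign_eq, koszulSign_eq]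
  have h : ∀ p : Fin l × Fin l, (if id p.1 < id p.2 ∧ σ p.2 < σ p.1 then
      ((∑ x, if π x = p.1 then deg x else 0) * ∑ x, if π x = p.2 then deg x else 0).negOnePow
      else 1) = ∏ q : ι × ι, if p = (π q.1, π q.2) then
        (if π q.1 < π q.2 ∧ σ (π q.2) < σ (π q.1) then (deg q.1 * deg q.2).negOnePow else 1)
        else 1 := by
    rintro ⟨i, j⟩
    simp only [id]
    split_ifs with hij
    · rw [Finset.sum_mul_sum, ← Fintype.sum_prod_type', negOnePow_sum]
      refine Finset.prod_congr rfl ?_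
      rintro ⟨x, y⟩ -
      by_cases hx : π x = i <;> by_cases hy : π y = j
      · subst hx; subst hy; simp [hij]
      · have : ¬ ((i, j) = (π x, π y)) := fun h => hy (congrArg Prod.snd h).symm
        simp only [hy, if_false, mul_zero, Int.negOnePow_zero, this]
      · have : ¬ ((i, j) = (π x, π y)) := fun h => hx (congrArg Prod.fst h).symm
        simp only [hx, if_false, zero_mul, Int.negOnePow_zero, this]
      · have : ¬ ((i, j) = (π x, π y)) := fun h => hx (congrArg Prod.fst h).symm
        simp only [hx, if_false, zero_mul, Int.negOnePow_zero, this]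
    · refine (Finset.prod_eq_one ?_).symm
      rintro ⟨x, y⟩ -
      split_ifs with h1 h2
      · obtain ⟨rfl, rfl⟩ := Prod.mk.inj h1
        exact absurd h2 hij
      · rfl
      · rfl
  refine (Finset.prod_congr rfl fun p _ => h p).trans ?_
  rw [Finset.prod_comm]
  refine Finset.prod_congr rfl fun q _ => ?_
  rw [Finset.prod_ite_eq' Finset.univ]
  simp

variable {l : ℕ} {p : Fin l → ℕ}

/-- The Koszul sign for rearranging letters `v₁, …, v_l` (of degrees `c`) followed by letters
`w_{j,t}` (of degrees `β`, in the order given by `f`) into the order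
`v₁, w_{1,1}, w_{1,2}, …, v₂, w_{2,1}, …`. -/
def assocSign {B : Type*} [LinearOrder B] (c : Fin l → ℤ) (β : (Σ j, Fin (p j)) → ℤ)
    (f : (Σ j, Fin (p j)) → B) : ℤˣ :=
  koszulSign (Sum.elim c β)
    (fun x => (toLex (Sum.map id f x) : Fin l ⊕ₗ B))
    (Sum.elim (fun j => (toLex (j, 0) : Fin l ×ₗ ℕ)) (fun x => toLex (x.1, (x.2 : ℕ) + 1)))

lemma sumLex_injective {ι ι' A B : Type*} {f : ι → A} {g : ι' → B} (hf : f.Injective)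
    (hg : g.Injective) :
    Function.Injective (fun x => (toLex (Sum.map f g x) : A ⊕ₗ B)) :=
  fun _ _ h => (hf.sumMap hg) (toLex.injective h)

lemma target_injective {A : Type*} (g : Fin l → A) (hg : g.Injective)
    (h : ∀ j, Fin (p j) → ℕ) (hh : ∀ j, (h j).Injective) :
    Function.Injective (Sum.elim (fun j => (toLex (g j, 0) : A ×ₗ ℕ))
      (fun x : Σ j, Fin (p j) => toLex (g x.1, h x.1 x.2 + 1))) := by
  rintro (i | ⟨i, x⟩) (j | ⟨j, y⟩) hij
  · have := congrArg (fun z => (ofLex z).1) hij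
    exact congrArg Sum.inl (hg this)
  · have := congrArg (fun z => (ofLex z).2) hij
    simp at this
  · have := congrArg (fun z => (ofLex z).2) hij
    simp at this
  · have h1 := congrArg (fun z => (ofLex z).1) hij
    have h2 := congrArg (fun z => (ofLex z).2) hij
    obtain rfl : i = j := hg h1
    have h3 : h i x + 1 = h i y + 1 := h2
    rw [hh i (Nat.succ.inj h3)]

lemma assocSign_outer {B B' : Type*} [LinearOrder B] [LinearOrder B'] (c : Fin l → ℤ)
    (β : (Σ j, Fin (p j)) → ℤ) (f : (Σ j, Fin (p j)) → B) (f' : (Σ j, Fin (p j)) → B')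
    (hf : f.Injective) (hf' : f'.Injective) :
    assocSign c β f = koszulSign β f f' * assocSign c β f' := by
  have h := koszulSign_sum (Sum.elim c β) (id : Fin l → Fin l) f id f'
  have h1 : koszulSign (fun x => Sum.elim c β (.inl x)) (id : Fin l → Fin l) id = 1 :=
    koszulSign_self _ _
  rw [h1, one_mul] at h
  have h2 : koszulSign (fun x => Sum.elim c β (.inr x)) f f' = koszulSign β f f' := rfl
  rw [h2] at h
  rw [← h]
  exact (koszulSign_cocycle _ (sumLex_injective Function.injective_id hf)
    (sumLex_injective Function.injective_id hf')
    (target_injective id Function.injective_id (fun _ x => (x : ℕ)) fun _ => Fin.val_injective)).symm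

lemma assocSign_perm {B : Type*} [LinearOrder B] {l' : ℕ} (σ : Fin l' ≃ Fin l) (c : Fin l → ℤ)
    (β : (Σ j, Fin (p j)) → ℤ) (f : (Σ j, Fin (p j)) → B) (hf : f.Injective) :
    assocSign (p := fun j => p (σ j)) (fun j => c (σ j)) (fun x => β ⟨σ x.1, x.2⟩)
        (fun x => f ⟨σ x.1, x.2⟩) *
      koszulSign (fun j => c (σ j) + ∑ t, β ⟨σ j, t⟩) id σ =
    koszulSign (fun j => c (σ j)) id σ * assocSign c β f := by
  let ι := Fin l' ⊕ Σ j, Fin (p (σ j))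
  let deg : ι → ℤ := Sum.elim (fun j => c (σ j)) (fun x => β ⟨σ x.1, x.2⟩)
  let σ' : (Σ j, Fin (p (σ j))) ≃ Σ j, Fin (p j) := Equiv.sigmaCongrLeft (β := fun j => Fin (p j)) σ
  have hfσ : Function.Injective (fun x : Σ j, Fin (p (σ j)) => f ⟨σ x.1, x.2⟩) :=
    hf.comp σ'.injective
  let oA : ι → Fin l' ⊕ₗ B := fun x => toLex (Sum.map id (fun x => f ⟨σ x.1, x.2⟩) x)
  let oA' : ι → Fin l ⊕ₗ B := fun x => toLex (Sum.map σ (fun x => f ⟨σ x.1, x.2⟩) x)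
  let oB : ι → Fin l' ×ₗ ℕ :=
    Sum.elim (fun j => toLex (j, 0)) (fun x => toLex (x.1, (x.2 : ℕ) + 1))
  let oB' : ι → Fin l ×ₗ ℕ :=
    Sum.elim (fun j => toLex (σ j, 0)) (fun x => toLex (σ x.1, (x.2 : ℕ) + 1))
  have iA : oA.Injective := sumLex_injective Function.injective_id hfσ
  have iA' : oA'.Injective := sumLex_injective σ.injective hfσ
  have iB : oB.Injective :=
    target_injective id Function.injective_id (fun _ x => (x : ℕ)) fun _ => Fin.val_injective
  have iB' : oB'.Injective :=
    target_injective σ σ.injective (fun _ x => (x : ℕ)) fun _ => Fin.val_injective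
  have e1 : koszulSign deg oA oA' = koszulSign (fun j => c (σ j)) id σ := by
    refine (koszulSign_sum deg id _ σ _).trans ?_
    rw [koszulSign_self, mul_one]
    rfl
  have e2 : koszulSign deg oA' oB' = assocSign c β f := by
    refine Eq.trans ?_ (koszulSign_comp (σ.sumCongr σ') _ _ _)
    congr 1
    · funext x; rcases x with j | x <;> rfl
    · funext x; rcases x with j | x <;> rfl
    · funext x; rcases x with j | x <;> rfl
  have e3 : koszulSign deg oB oB' = koszulSign (fun j => c (σ j) + ∑ t, β ⟨σ j, t⟩) id σ := by
    let π : ι → Fin l' := Sum.elim id Sigma.fst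
    have h1 : (fun j => c (σ j) + ∑ t, β ⟨σ j, t⟩) =
        fun i => ∑ x, if π x = i then deg x else 0 := by
      funext i
      rw [Fintype.sum_sum_type, Fintype.sum_sigma]
      have hA : (∑ a, if π (.inl a) = i then deg (.inl a) else 0) = c (σ i) :=
        (Finset.sum_eq_single i (fun j _ hj => if_neg hj) (by simp)).trans (if_pos rfl)
      have hB : (∑ a, ∑ t, if π (.inr ⟨a, t⟩) = i then deg (.inr ⟨a, t⟩) else 0) =
          ∑ t, β ⟨σ i, t⟩ :=
        (Finset.sum_eq_single i (fun j _ hj => Finset.sum_eq_zero fun _ _ => if_neg hj)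
          (by simp)).trans (Finset.sum_congr rfl fun _ _ => if_pos rfl)
      rw [hA, hB]
    rw [h1, koszulSign_block]
    classical
    unfold koszulSign
    refine Finset.prod_congr rfl ?_
    rintro ⟨x, y⟩ -
    have key : ∀ x y : ι, π x ≠ π y →
        ((oB x < oB y ↔ π x < π y) ∧ (oB' x < oB' y ↔ σ (π x) < σ (π y))) := by
      rintro (i | i) (j | j) hij <;>
      · have hij' : σ _ ≠ σ _ := σ.injective.ne hij
        simp only [oB, oB', π, Sum.elim_inl, Sum.elim_inr, id, Prod.Lex.toLex_lt_toLex] at hij hij' ⊢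
        simp [hij, hij']
    have key2 : ∀ x y : ι, π x = π y → ((oB x < oB y ↔ oB' x < oB' y)) := by
      rintro (i | i) (j | j) hij <;>
      · simp only [oB, oB', π, Sum.elim_inl, Sum.elim_inr, id, Prod.Lex.toLex_lt_toLex] at hij ⊢
        simp [hij]
    have hiff : (oB x < oB y ∧ oB' y < oB' x) ↔ (π x < π y ∧ σ (π y) < σ (π x)) := by
      by_cases hxy : π x = π y
      · rw [key2 x y hxy, hxy]
        constructor
        · rintro ⟨h1, h2⟩; exact absurd h2 h1.not_gt
        · rintro ⟨h1, h2⟩; exact absurd h1 (lt_irrefl _)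
      · rw [(key x y hxy).1, (key y x (Ne.symm hxy)).2]
    by_cases hc : oB x < oB y ∧ oB' y < oB' x
    · exact (if_pos hc).trans (if_pos (hiff.1 hc)).symm
    · exact (if_neg hc).trans (if_neg fun h => hc (hiff.2 h)).symm
  have h := (koszulSign_cocycle deg iA iB iB').trans (koszulSign_cocycle deg iA iA' iB').symm
  rw [e1, e2, e3] at h
  exact h

lemma assocSign_relabel {B : Type*} [LinearOrder B] {p' : Fin l → ℕ}
    (φ : ∀ j, Fin (p' j) ≃ Fin (p j)) (c : Fin l → ℤ)
    (β : (Σ j, Fin (p j)) → ℤ) (f : (Σ j, Fin (p j)) → B) (hf : f.Injective) :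
    assocSign (p := p') c (fun x => β ⟨x.1, φ x.1 x.2⟩) (fun x => f ⟨x.1, φ x.1 x.2⟩) *
      ∏ j, koszulSign (fun t => β ⟨j, φ j t⟩) id (φ j) = assocSign c β f := by
  let ι := Fin l ⊕ Σ j, Fin (p' j)
  let deg : ι → ℤ := Sum.elim c (fun x => β ⟨x.1, φ x.1 x.2⟩)
  let φ' : (Σ j, Fin (p' j)) ≃ Σ j, Fin (p j) := Equiv.sigmaCongrRight φ
  have hfφ : Function.Injective (fun x : Σ j, Fin (p' j) => f ⟨x.1, φ x.1 x.2⟩) :=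
    hf.comp φ'.injective
  let oA : ι → Fin l ⊕ₗ B := fun x => toLex (Sum.map id (fun x => f ⟨x.1, φ x.1 x.2⟩) x)
  let oB : ι → Fin l ×ₗ ℕ :=
    Sum.elim (fun j => toLex (j, 0)) (fun x => toLex (x.1, (x.2 : ℕ) + 1))
  let oB' : ι → Fin l ×ₗ ℕ :=
    Sum.elim (fun j => toLex (j, 0)) (fun x => toLex (x.1, (φ x.1 x.2 : ℕ) + 1))
  have iA : oA.Injective := sumLex_injective Function.injective_id hfφ
  have iB : oB.Injective :=
    target_injective id Function.injective_id (fun _ x => (x : ℕ)) fun _ => Fin.val_injective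
  have iB' : oB'.Injective :=
    target_injective id Function.injective_id (fun j x => (φ j x : ℕ))
      fun j => Fin.val_injective.comp (φ j).injective
  have e2 : koszulSign deg oA oB' = assocSign c β f := by
    refine Eq.trans ?_ (koszulSign_comp ((Equiv.refl (Fin l)).sumCongr φ') _ _ _)
    congr 1
    · funext x; rcases x with j | x <;> rfl
    · funext x; rcases x with j | x <;> rfl
    · funext x; rcases x with j | x <;> rfl
  have e3 : koszulSign deg oB oB' = ∏ j, koszulSign (fun t => β ⟨j, φ j t⟩) id (φ j) := by
    classical
    unfold koszulSign
    rw [Fintype.prod_prod_type, Fintype.prod_sum_type]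
    have h1 : ∀ (i : Fin l) (y : ι), ¬ (oB (.inl i) < oB y ∧ oB' y < oB' (.inl i)) := by
      rintro i (j | j)
      · rintro ⟨h1, h2⟩
        exact absurd h2 h1.not_gt
      · simp only [oB, oB', Sum.elim_inl, Sum.elim_inr, Prod.Lex.toLex_lt_toLex]
        rintro ⟨h1, h2⟩
        rcases h2 with h2 | h2
        · rcases h1 with h1 | h1
          · exact absurd h2 h1.not_gt
          · exact absurd h1.1 h2.ne'
        · omega
    have h2 : ∀ (x : Σ j, Fin (p' j)) (j : Fin l),
        ¬ (oB (.inr x) < oB (.inl j) ∧ oB' (.inl j) < oB' (.inr x)) := by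
      rintro x j
      simp only [oB, oB', Sum.elim_inl, Sum.elim_inr, Prod.Lex.toLex_lt_toLex]
      rintro ⟨h1, h2⟩
      rcases h1 with h1 | h1
      · rcases h2 with h2 | h2
        · exact absurd h2 h1.not_gt
        · exact absurd h2.1 h1.ne'
      · omega
    simp only [h1, if_false, Finset.prod_const_one, one_mul]
    rw [Fintype.prod_sigma]
    refine Finset.prod_congr rfl fun j _ => ?_
    rw [Fintype.prod_prod_type]
    refine Finset.prod_congr rfl fun t _ => ?_
    rw [Fintype.prod_sum_type, Finset.prod_eq_one fun i _ => if_neg (h2 ⟨j, t⟩ i), one_mul,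
      Fintype.prod_sigma, Finset.prod_eq_single j]
    · refine Finset.prod_congr rfl fun u _ => ?_
      simp only [oB, oB', deg, Sum.elim_inr, Prod.Lex.toLex_lt_toLex, lt_irrefl, false_or, true_and,
        id, Fin.lt_def, add_lt_add_iff_right]
    · intro i _ hi
      refine Finset.prod_eq_one fun u _ => if_neg ?_
      simp only [oB, oB', Sum.elim_inr, Prod.Lex.toLex_lt_toLex, hi, hi.symm, false_and, or_false]
      rintro ⟨h3, h4⟩
      exact absurd h4 h3.not_gt
    · simp
  have h := koszulSign_cocycle deg iA iB iB'
  rw [e2, e3] at h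
  exact h

end AssocSign

section Associator

variable {U V W : SMod K} {n : ℕ} {d : ℤ}

/-- Regrouping the inputs of a two-level tree along the lower level. -/
def assocEquiv {k l : ℕ} {m : Fin k → ℕ} {p : Fin l → ℕ} (e : (Σ i, Fin (m i)) ≃ Fin n)
    (e' : (Σ j, Fin (p j)) ≃ Fin k) : (Σ j, Fin (∑ t, m (e' ⟨j, t⟩))) ≃ Fin n :=
  (Equiv.sigmaCongrRight fun j =>
      (finSigmaFinEquiv (n := fun t : Fin (p j) => m (e' ⟨j, t⟩))).symm).trans <|
    (Equiv.sigmaAssoc fun j (t : Fin (p j)) => Fin (m (e' ⟨j, t⟩))).symm.trans <|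
    (Equiv.sigmaCongrLeft (β := fun i => Fin (m i)) e').trans e

lemma assocEquiv_apply {k l : ℕ} {m : Fin k → ℕ} {p : Fin l → ℕ} (e : (Σ i, Fin (m i)) ≃ Fin n)
    (e' : (Σ j, Fin (p j)) ≃ Fin k) (j : Fin l) (t : Fin (p j)) (x : Fin (m (e' ⟨j, t⟩))) :
    assocEquiv e e' ⟨j, finSigmaFinEquiv (n := fun t : Fin (p j) => m (e' ⟨j, t⟩)) ⟨t, x⟩⟩ =
      e ⟨e' ⟨j, t⟩, x⟩ := by
  simp only [assocEquiv, Equiv.trans_apply, Equiv.sigmaCongrRight_apply,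
    Equiv.symm_apply_apply]
  rfl

/-- The lower level of the shape of the tree obtained by regrouping. -/
abbrev assocShape (s : Shape n d) (s' : Shape s.k s.a) : Shape n d where
  k := s'.k
  a := s'.a
  m j := ∑ t, s.m (s'.e ⟨j, t⟩)
  b j := s'.b j + ∑ t, s.b (s'.e ⟨j, t⟩)
  e := assocEquiv s.e s'.e
  deg := by
    have h1 := s.deg
    have h2 := s'.deg
    have h3 : ∑ j, ∑ t, s.b (s'.e ⟨j, t⟩) = ∑ i, s.b i := by
      rw [← Equiv.sum_comp s'.e s.b, Fintype.sum_sigma]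
    rw [Finset.sum_add_distrib, h3]
    omega

/-- The shape of the `j`-th upper tree obtained by regrouping. -/
abbrev assocIn (s : Shape n d) (s' : Shape s.k s.a) (j : Fin s'.k) :
    Shape (∑ t, s.m (s'.e ⟨j, t⟩)) (s'.b j + ∑ t, s.b (s'.e ⟨j, t⟩)) where
  k := s'.m j
  a := s'.b j
  m t := s.m (s'.e ⟨j, t⟩)
  b t := s.b (s'.e ⟨j, t⟩)
  e := finSigmaFinEquiv
  deg := rfl

/-- The Koszul sign of the associator. -/
abbrev assocSgn (s : Shape n d) (s' : Shape s.k s.a) : ℤˣ :=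
  assocSign s'.b (fun x => s.b (s'.e x)) s'.e

/-- The associator on elementary tensors: `(u ⊗ (v_j)_j) ⊗ (w_i)_i` is sent to
`± u ⊗ (v_j ⊗ (w_{e'(j, t)})_t)_j`. -/
def assocVal (s : Shape n d) (s' : Shape s.k s.a) (u : U.at' s'.k s'.a)
    (v : ∀ j, V.at' (s'.m j) (s'.b j)) (w : ∀ i, W.at' (s.m i) (s.b i)) :
    (comp U (comp V W)).at' n d :=
  assocSgn s s' • mk (V := U) (W := comp V W) (assocShape s s') u
    (fun j => mk (assocIn s s' j) (v j) (fun t => w (s'.e ⟨j, t⟩)))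

lemma mk_update {V W : SMod K} (s : Shape n d) (v : V.at' s.k s.a)
    (w : ∀ j, W.at' (s.m j) (s.b j)) [DecidableEq (Fin s.k)] (j : Fin s.k) :
    (∀ x y, mk s v (Function.update w j (x + y)) =
      mk s v (Function.update w j x) + mk s v (Function.update w j y)) ∧
    (∀ (c : K) x, mk s v (Function.update w j (c • x)) = c • mk s v (Function.update w j x)) :=
  ⟨(mkₗ V W s v).map_update_add w j, (mkₗ V W s v).map_update_smul w j⟩

lemma assoc_update_w (s : Shape n d) (s' : Shape s.k s.a)
    (v : ∀ j, V.at' (s'.m j) (s'.b j)) (w : ∀ i, W.at' (s.m i) (s.b i)) [DecidableEq (Fin s.k)]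
    (j : Fin s'.k) (t : Fin (s'.m j)) (x : W.at' (s.m (s'.e ⟨j, t⟩)) (s.b (s'.e ⟨j, t⟩))) :
    (fun j' => mk (assocIn s s' j') (v j')
      (fun t' => Function.update w (s'.e ⟨j, t⟩) x (s'.e ⟨j', t'⟩))) =
    Function.update (fun j' => mk (assocIn s s' j') (v j') (fun t' => w (s'.e ⟨j', t'⟩))) j
      (mk (assocIn s s' j) (v j) (Function.update (fun t' => w (s'.e ⟨j, t'⟩)) t x)) := by
  funext j'
  by_cases hj : j' = j
  · subst hj
    rw [Function.update_self]
    congr 1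
    funext t'
    by_cases ht : t' = t
    · subst ht
      rw [Function.update_self, Function.update_self]
    · rw [Function.update_of_ne ht, Function.update_of_ne]
      intro h
      have := s'.e.injective h
      simp only [Sigma.mk.injEq, heq_eq_eq, true_and] at this
      exact ht this
  · rw [Function.update_of_ne hj]
    congr 1
    funext t'
    rw [Function.update_of_ne]
    intro h
    exact hj (congrArg Sigma.fst (s'.e.injective h))

lemma mk_add {V W : SMod K} (s : Shape n d) (v v' : V.at' s.k s.a)
    (w : ∀ j, W.at' (s.m j) (s.b j)) : mk s (v + v') w = mk s v w + mk s v' w := by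
  have h : mkₗ V W s (v + v') = mkₗ V W s v + mkₗ V W s v' := map_add _ _ _
  have h2 := congrArg (fun f => f w) h
  exact h2

lemma mk_smul {V W : SMod K} (s : Shape n d) (c : K) (v : V.at' s.k s.a)
    (w : ∀ j, W.at' (s.m j) (s.b j)) : mk s (c • v) w = c • mk s v w := by
  have h : mkₗ V W s (c • v) = c • mkₗ V W s v := map_smul _ _ _
  have h2 := congrArg (fun f => f w) h
  exact h2

lemma assoc_update_v (s : Shape n d) (s' : Shape s.k s.a)
    (v : ∀ j, V.at' (s'.m j) (s'.b j)) (w : ∀ i, W.at' (s.m i) (s.b i)) [DecidableEq (Fin s'.k)]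
    (j : Fin s'.k) (x : V.at' (s'.m j) (s'.b j)) :
    (fun j' => mk (assocIn s s' j') (Function.update v j x j') (fun t' => w (s'.e ⟨j', t'⟩))) =
    Function.update (fun j' => mk (assocIn s s' j') (v j') (fun t' => w (s'.e ⟨j', t'⟩))) j
      (mk (assocIn s s' j) x (fun t' => w (s'.e ⟨j, t'⟩))) := by
  funext j'
  by_cases hj : j' = j
  · subst hj
    rw [Function.update_self, Function.update_self]
  · rw [Function.update_of_ne hj, Function.update_of_ne hj]

lemma assocVal_w (s : Shape n d) (s' : Shape s.k s.a) (u : U.at' s'.k s'.a)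
    (v : ∀ j, V.at' (s'.m j) (s'.b j)) (w : ∀ i, W.at' (s.m i) (s.b i)) [DecidableEq (Fin s.k)]
    (i : Fin s.k) :
    (∀ x y, assocVal s s' u v (Function.update w i (x + y)) =
      assocVal s s' u v (Function.update w i x) + assocVal s s' u v (Function.update w i y)) ∧
    (∀ (c : K) x, assocVal s s' u v (Function.update w i (c • x)) =
      c • assocVal s s' u v (Function.update w i x)) := by
  obtain ⟨⟨j, t⟩, rfl⟩ := s'.e.surjective i
  constructor
  · intro x y
    simp only [assocVal, assoc_update_w]
    rw [(mk_update (assocIn s s' j) (v j) _ t).1, (mk_update (assocShape s s') u _ j).1, smul_add]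
  · intro c x
    simp only [assocVal, assoc_update_w]
    rw [(mk_update (assocIn s s' j) (v j) _ t).2, (mk_update (assocShape s s') u _ j).2, smul_comm]

lemma assocVal_v (s : Shape n d) (s' : Shape s.k s.a) (u : U.at' s'.k s'.a)
    (v : ∀ j, V.at' (s'.m j) (s'.b j)) (w : ∀ i, W.at' (s.m i) (s.b i)) [DecidableEq (Fin s'.k)]
    (j : Fin s'.k) :
    (∀ x y, assocVal s s' u (Function.update v j (x + y)) w =
      assocVal s s' u (Function.update v j x) w + assocVal s s' u (Function.update v j y) w) ∧
    (∀ (c : K) x, assocVal s s' u (Function.update v j (c • x)) w =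
      c • assocVal s s' u (Function.update v j x) w) := by
  constructor
  · intro x y
    simp only [assocVal, assoc_update_v]
    rw [mk_add (assocIn s s' j), (mk_update (assocShape s s') u _ j).1, smul_add]
  · intro c x
    simp only [assocVal, assoc_update_v]
    rw [mk_smul (assocIn s s' j), (mk_update (assocShape s s') u _ j).2, smul_comm]

/-- The associator on a pair of summands, as a multilinear map. -/
def assocForm (U V W : SMod K) (s : Shape n d) (s' : Shape s.k s.a) :
    U.at' s'.k s'.a →ₗ[K] MultilinearMap K (fun j => V.at' (s'.m j) (s'.b j))
      (MultilinearMap K (fun i => W.at' (s.m i) (s.b i)) ((comp U (comp V W)).at' n d)) where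
  toFun u :=
    { toFun := fun v =>
        { toFun := fun w => assocVal s s' u v w
          map_update_add' := fun {_} w i x y => (assocVal_w s s' u v w i).1 x y
          map_update_smul' := fun {_} w i c x => (assocVal_w s s' u v w i).2 c x }
      map_update_add' := fun {_} v j x y =>
        MultilinearMap.ext fun w => (assocVal_v s s' u v w j).1 x y
      map_update_smul' := fun {_} v j c x =>
        MultilinearMap.ext fun w => (assocVal_v s s' u v w j).2 c x }
  map_add' x y := by
    refine MultilinearMap.ext fun v => MultilinearMap.ext fun w => ?_
    exact (congrArg _ (mk_add (assocShape s s') x y _)).trans (smul_add _ _ _)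
  map_smul' c x := by
    refine MultilinearMap.ext fun v => MultilinearMap.ext fun w => ?_
    exact (congrArg _ (mk_smul (assocShape s s') c x _)).trans (smul_comm _ _ _)

lemma assocForm_apply (s : Shape n d) (s' : Shape s.k s.a) (u : U.at' s'.k s'.a)
    (v : ∀ j, V.at' (s'.m j) (s'.b j)) (w : ∀ i, W.at' (s.m i) (s.b i)) :
    assocForm U V W s s' u v w = assocVal s s' u v w := rfl

lemma mk_congr {V W : SMod K} {k : ℕ} {a : ℤ} {m : Fin k → ℕ} {b b' : Fin k → ℤ}
    {e e' : (Σ j, Fin (m j)) ≃ Fin n} (h h') (hb : ∀ j, b j = b' j) (he : e = e')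
    (v : V.at' k a) (w : ∀ j, W.at' (m j) (b j)) :
    mk (V := V) (W := W) (n := n) (d := d) ⟨k, a, m, b, e, h⟩ v w =
      mk ⟨k, a, m, b', e', h'⟩ v (fun j => W.degCast (m j) (hb j) (w j)) := by
  obtain rfl : b = b' := funext hb
  subst he
  rfl

lemma mk_congr_e {V W : SMod K} {k : ℕ} {a : ℤ} {m : Fin k → ℕ} {b : Fin k → ℤ}
    {e e' : (Σ j, Fin (m j)) ≃ Fin n} (h h') (he : e = e')
    (v : V.at' k a) (w : ∀ j, W.at' (m j) (b j)) :
    mk (V := V) (W := W) (n := n) (d := d) ⟨k, a, m, b, e, h⟩ v w = mk ⟨k, a, m, b, e', h'⟩ v w := by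
  subst he
  rfl

lemma degCast_mk {V W : SMod K} {k : ℕ} {a : ℤ} {m : Fin k → ℕ} {b : Fin k → ℤ}
    {e : (Σ j, Fin (m j)) ≃ Fin n} {d' : ℤ} (hd : d = d') (h) (h')
    (v : V.at' k a) (w : ∀ j, W.at' (m j) (b j)) :
    (comp V W).degCast n hd (mk (V := V) (W := W) (n := n) (d := d) ⟨k, a, m, b, e, h⟩ v w) =
      mk (n := n) (d := d') ⟨k, a, m, b, e, h'⟩ v w := by
  subst hd
  rfl

lemma mk_smul_univ {V W : SMod K} (s : Shape n d) (v : V.at' s.k s.a)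
    (w : ∀ j, W.at' (s.m j) (s.b j)) (ε : Fin s.k → ℤˣ) :
    mk s v (fun j => ε j • w j) = (∏ j, ε j) • mk s v w := by
  have h := (mkₗ V W s v).map_smul_univ (fun j => ((ε j : ℤ) : K)) w
  simp only [← zu_smul_eq] at h
  refine h.trans ?_
  rw [zu_smul_eq (K := K)]
  congr 1
  push_cast
  rfl

/-- The associator is compatible with renumbering the inputs of the lowest element. -/
lemma assocVal_perm (s : Shape n d) (s' : Shape s.k s.a) {l : ℕ} (σ : Fin l ≃ Fin s'.k)
    (u : U.at' s'.k s'.a) (v : ∀ j, V.at' (s'.m j) (s'.b j)) (w : ∀ i, W.at' (s.m i) (s.b i)) :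
    assocVal s (s'.perm σ) (U.act σ s'.a u) (fun j => v (σ j)) w =
      koszulSign (fun j => s'.b (σ j)) id σ • assocVal s s' u v w := by
  have h1 := mk_perm (assocShape s s') σ u
    (fun j => mk (assocIn s s' j) (v j) (fun t => w (s'.e ⟨j, t⟩)))
  have he : (assocShape s (s'.perm σ)).e = ((assocShape s s').perm σ).e := by
    ext ⟨j, x⟩
    obtain ⟨⟨t, x⟩, rfl⟩ := (finSigmaFinEquiv
      (n := fun t : Fin (s'.m (σ j)) => s.m (s'.e ⟨σ j, t⟩))).surjective x
    exact (congrArg Fin.val (assocEquiv_apply s.e (s'.perm σ).e j t x)).trans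
      (congrArg Fin.val (assocEquiv_apply s.e s'.e (σ j) t x)).symm
  have h2 := mk_congr_e (V := U) (W := comp V W) (n := n) (d := d)
    (assocShape s (s'.perm σ)).deg ((assocShape s s').perm σ).deg he
    (U.act σ s'.a u) (fun j => mk (assocIn s s' (σ j)) (v (σ j)) (fun t => w (s'.e ⟨σ j, t⟩)))
  have hs := assocSign_perm σ s'.b (fun x => s.b (s'.e x)) s'.e s'.e.injective
  calc assocVal s (s'.perm σ) (U.act σ s'.a u) (fun j => v (σ j)) w
      = assocSgn s (s'.perm σ) • (koszulSign (fun j => (assocShape s s').b (σ j)) id σ •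
          mk (assocShape s s') u
            (fun j => mk (assocIn s s' j) (v j) (fun t => w (s'.e ⟨j, t⟩)))) :=
        congrArg (assocSgn s (s'.perm σ) • ·) (h2.trans h1)
    _ = _ := by
        rw [smul_smul, assocVal, smul_smul]
        exact congrArg (· • _) hs

/-- The associator is compatible with renumbering the inputs of the middle elements. -/
lemma assocVal_relabel (s : Shape n d) (s' : Shape s.k s.a) {p : Fin s'.k → ℕ}
    (φ : ∀ j, Fin (p j) ≃ Fin (s'.m j)) (u : U.at' s'.k s'.a)
    (v : ∀ j, V.at' (s'.m j) (s'.b j)) (w : ∀ i, W.at' (s.m i) (s.b i)) :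
    assocVal s (s'.relabel φ) u (fun j => V.act (φ j) (s'.b j) (v j)) w =
      assocVal s s' u v w := by
  let ψ : ∀ j, Fin (∑ t, s.m (s'.e ⟨j, φ j t⟩)) ≃ Fin (∑ t, s.m (s'.e ⟨j, t⟩)) := fun j =>
    (finSigmaFinEquiv (n := fun t => s.m (s'.e ⟨j, φ j t⟩))).symm.trans
      ((Equiv.sigmaCongrLeft (β := fun t => Fin (s.m (s'.e ⟨j, t⟩))) (φ j)).trans
        (finSigmaFinEquiv (n := fun t => s.m (s'.e ⟨j, t⟩))))
  have hψ : ∀ j t x, ψ j (finSigmaFinEquiv (n := fun t => s.m (s'.e ⟨j, φ j t⟩)) ⟨t, x⟩) =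
      finSigmaFinEquiv (n := fun t => s.m (s'.e ⟨j, t⟩)) ⟨φ j t, x⟩ := by
    intro j t x
    simp only [ψ, Equiv.trans_apply, Equiv.symm_apply_apply]
    rfl
  have hb : ∀ j, (assocShape s (s'.relabel φ)).b j = (assocShape s s').b j := fun j =>
    congrArg (s'.b j + ·) (Equiv.sum_comp (φ j) fun t => s.b (s'.e ⟨j, t⟩))
  have he : (assocShape s (s'.relabel φ)).e = ((assocShape s s').relabel ψ).e := by
    ext ⟨j, x⟩
    obtain ⟨⟨t, x⟩, rfl⟩ := (finSigmaFinEquiv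
      (n := fun t => s.m (s'.e ⟨j, φ j t⟩))).surjective x
    refine (congrArg Fin.val (assocEquiv_apply s.e (s'.relabel φ).e j t x)).trans ?_
    have h2 : ((assocShape s s').relabel ψ).e
        ⟨j, finSigmaFinEquiv (n := fun t => s.m (s'.e ⟨j, φ j t⟩)) ⟨t, x⟩⟩ =
        (assocShape s s').e ⟨j, finSigmaFinEquiv (n := fun t => s.m (s'.e ⟨j, t⟩)) ⟨φ j t, x⟩⟩ := by
      rw [← hψ]
      rfl
    exact (congrArg Fin.val (h2.trans (assocEquiv_apply s.e s'.e j (φ j t) x))).symm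
  have hy : ∀ j, (comp V W).degCast _ (hb j) (mk (assocIn s (s'.relabel φ) j)
        (V.act (φ j) (s'.b j) (v j)) (fun t => w (s'.e ⟨j, φ j t⟩))) =
      koszulSign (fun t => s.b (s'.e ⟨j, φ j t⟩)) id (φ j) • (comp V W).act (ψ j) _
        (mk (assocIn s s' j) (v j) (fun t => w (s'.e ⟨j, t⟩))) := by
    intro j
    rw [act_mk]
    refine Eq.trans ?_ (mk_perm ((assocIn s s' j).transport (ψ j)) (φ j) (v j)
      (fun t => w (s'.e ⟨j, t⟩)))
    refine (degCast_mk (hb j) _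
      (((assocIn s s' j).transport (ψ j)).perm (φ j)).deg _ _).trans (mk_congr_e _ _ ?_ _ _)
    ext ⟨t, x⟩
    refine congrArg Fin.val ?_
    exact ((Equiv.symm_apply_eq (ψ j)).2 (hψ j t x).symm).symm
  have h1 := mk_relabel (assocShape s s') ψ u
    (fun j => mk (assocIn s s' j) (v j) (fun t => w (s'.e ⟨j, t⟩)))
  have h2 := mk_congr (V := U) (W := comp V W) (n := n) (d := d)
    (assocShape s (s'.relabel φ)).deg ((assocShape s s').relabel ψ).deg hb he u
    (fun j => mk (assocIn s (s'.relabel φ) j) (V.act (φ j) (s'.b j) (v j))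
      (fun t => w (s'.e ⟨j, φ j t⟩)))
  have h3 := mk_smul_univ ((assocShape s s').relabel ψ) u
    (fun j => (comp V W).act (ψ j) _ (mk (assocIn s s' j) (v j) (fun t => w (s'.e ⟨j, t⟩))))
    (fun j => koszulSign (fun t => s.b (s'.e ⟨j, φ j t⟩)) id (φ j))
  have hs := assocSign_relabel φ s'.b (fun x => s.b (s'.e x)) s'.e s'.e.injective
  have h4 : mk ((assocShape s s').relabel ψ) u (fun j => (comp V W).degCast _ (hb j)
      (mk (assocIn s (s'.relabel φ) j)
        (V.act (φ j) (s'.b j) (v j)) (fun t => w (s'.e ⟨j, φ j t⟩)))) =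
      mk ((assocShape s s').relabel ψ) u (fun j =>
        koszulSign (fun t => s.b (s'.e ⟨j, φ j t⟩)) id (φ j) • (comp V W).act (ψ j) _
        (mk (assocIn s s' j) (v j) (fun t => w (s'.e ⟨j, t⟩)))) :=
    congrArg (mk ((assocShape s s').relabel ψ) u) (funext hy)
  calc assocVal s (s'.relabel φ) u (fun j => V.act (φ j) (s'.b j) (v j)) w
      = assocSgn s (s'.relabel φ) •
          ((∏ j, koszulSign (fun t => s.b (s'.e ⟨j, φ j t⟩)) id (φ j)) •
            mk (assocShape s s') u
              (fun j => mk (assocIn s s' j) (v j) (fun t => w (s'.e ⟨j, t⟩)))) :=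
        congrArg (assocSgn s (s'.relabel φ) • ·)
          (h2.trans (h4.trans (h3.trans (congrArg (_ • ·) h1))))
    _ = _ := by
        rw [smul_smul, assocVal]
        exact congrArg (· • _) hs

/-- The associator for a fixed summand of `(U ∘ V) ∘ W`. -/
def assocInner (U V W : SMod K) (s : Shape n d) :
    (comp U V).at' s.k s.a →ₗ[K]
      MultilinearMap K (fun i => W.at' (s.m i) (s.b i)) ((comp U (comp V W)).at' n d) :=
  desc (assocForm U V W s)
    (fun s' _ σ u v => MultilinearMap.ext fun w => assocVal_perm s s' σ u v w)
    (fun s' _ φ u v => MultilinearMap.ext fun w => assocVal_relabel s s' φ u v w)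

lemma assocInner_mk (s : Shape n d) (s' : Shape s.k s.a) (u : U.at' s'.k s'.a)
    (v : ∀ j, V.at' (s'.m j) (s'.b j)) (w : ∀ i, W.at' (s.m i) (s.b i)) :
    assocInner U V W s (mk s' u v) w = assocVal s s' u v w := by
  rw [assocInner, desc_mk]
  rfl

lemma assocVal_congr (s : Shape n d) {l : ℕ} {a₀ : ℤ} {p : Fin l → ℕ} {c : Fin l → ℤ}
    {e₁ e₂ : (Σ j, Fin (p j)) ≃ Fin s.k} (h₁ h₂) (he : e₁ = e₂) (u : U.at' l a₀)
    (v : ∀ j, V.at' (p j) (c j)) (w : ∀ i, W.at' (s.m i) (s.b i)) :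
    assocVal (U := U) (V := V) s ⟨l, a₀, p, c, e₁, h₁⟩ u v w =
      assocVal s ⟨l, a₀, p, c, e₂, h₂⟩ u v w := by
  subst he
  rfl

/-- The associator is compatible with renumbering the upper elements. -/
lemma assocVal_outer_perm (s : Shape n d) {k : ℕ} (σ : Fin k ≃ Fin s.k) {l : ℕ} {a₀ : ℤ}
    {p : Fin l → ℕ} {c : Fin l → ℤ} (e : (Σ j, Fin (p j)) ≃ Fin k) (h) (u : U.at' l a₀)
    (v : ∀ j, V.at' (p j) (c j)) (w : ∀ i, W.at' (s.m i) (s.b i)) :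
    assocVal (U := U) (V := V) (s.perm σ) ⟨l, a₀, p, c, e, h⟩ u v (fun i => w (σ i)) =
      koszulSign (fun j => s.b (σ j)) id σ •
        assocVal s ⟨l, a₀, p, c, e.trans σ, h⟩ u v w := by
  let s₁ : Shape (s.perm σ).k (s.perm σ).a := ⟨l, a₀, p, c, e, h⟩
  let s₂ : Shape s.k s.a := ⟨l, a₀, p, c, e.trans σ, h⟩
  have he : (assocShape (s.perm σ) s₁).e = (assocShape s s₂).e := by
    ext ⟨j, x⟩
    obtain ⟨⟨t, x⟩, rfl⟩ := (finSigmaFinEquiv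
      (n := fun t => s.m (σ (e ⟨j, t⟩)))).surjective x
    exact (congrArg Fin.val (assocEquiv_apply (s.perm σ).e e j t x)).trans
      (congrArg Fin.val (assocEquiv_apply s.e (e.trans σ) j t x)).symm
  have h2 := mk_congr_e (V := U) (W := comp V W) (n := n) (d := d)
    (assocShape (s.perm σ) s₁).deg (assocShape s s₂).deg he u
    (fun j => mk (assocIn s s₂ j) (v j) (fun t => w (σ (e ⟨j, t⟩))))
  have hs := assocSign_outer c (fun x => s.b (σ (e x))) e (fun x => σ (e x)) e.injective
    (σ.injective.comp e.injective)
  have hk := koszulSign_comp e (fun j => s.b (σ j)) id σ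
  have hs' : assocSgn (s.perm σ) s₁ = koszulSign (fun j => s.b (σ j)) id σ * assocSgn s s₂ := by
    rw [← hk]
    exact hs
  calc assocVal (U := U) (V := V) (s.perm σ) s₁ u v (fun i => w (σ i))
      = assocSgn (s.perm σ) s₁ • mk (assocShape s s₂) u
          (fun j => mk (assocIn s s₂ j) (v j) (fun t => w (s₂.e ⟨j, t⟩))) :=
        congrArg (assocSgn (s.perm σ) s₁ • ·) h2
    _ = _ := by
        rw [hs', ← smul_smul]
        rfl

/-- The associator is compatible with renumbering the inputs of the upper elements. -/
lemma assocVal_outer_relabel (s : Shape n d) {m : Fin s.k → ℕ} (φ : ∀ j, Fin (m j) ≃ Fin (s.m j))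
    (s' : Shape s.k s.a) (u : U.at' s'.k s'.a)
    (v : ∀ j, V.at' (s'.m j) (s'.b j)) (w : ∀ i, W.at' (s.m i) (s.b i)) :
    assocVal (s.relabel φ) s' u v (fun i => W.act (φ i) (s.b i) (w i)) =
      assocVal s s' u v w := by
  let ψ : ∀ j, Fin (∑ t, m (s'.e ⟨j, t⟩)) ≃ Fin (∑ t, s.m (s'.e ⟨j, t⟩)) := fun j =>
    (finSigmaFinEquiv (n := fun t => m (s'.e ⟨j, t⟩))).symm.trans
      ((Equiv.sigmaCongrRight fun t => φ (s'.e ⟨j, t⟩)).trans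
        (finSigmaFinEquiv (n := fun t => s.m (s'.e ⟨j, t⟩))))
  have hψ : ∀ j t x, ψ j (finSigmaFinEquiv (n := fun t => m (s'.e ⟨j, t⟩)) ⟨t, x⟩) =
      finSigmaFinEquiv (n := fun t => s.m (s'.e ⟨j, t⟩)) ⟨t, φ (s'.e ⟨j, t⟩) x⟩ := by
    intro j t x
    simp only [ψ, Equiv.trans_apply, Equiv.symm_apply_apply]
    rfl
  have he : (assocShape (s.relabel φ) s').e = ((assocShape s s').relabel ψ).e := by
    ext ⟨j, x⟩
    obtain ⟨⟨t, x⟩, rfl⟩ := (finSigmaFinEquiv (n := fun t => m (s'.e ⟨j, t⟩))).surjective x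
    refine (congrArg Fin.val (assocEquiv_apply (s.relabel φ).e s'.e j t x)).trans ?_
    have h2 : ((assocShape s s').relabel ψ).e
        ⟨j, finSigmaFinEquiv (n := fun t => m (s'.e ⟨j, t⟩)) ⟨t, x⟩⟩ =
        (assocShape s s').e ⟨j, finSigmaFinEquiv (n := fun t => s.m (s'.e ⟨j, t⟩))
          ⟨t, φ (s'.e ⟨j, t⟩) x⟩⟩ := by
      rw [← hψ]
      rfl
    exact (congrArg Fin.val
      (h2.trans (assocEquiv_apply s.e s'.e j t (φ (s'.e ⟨j, t⟩) x)))).symm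
  have hy : ∀ j, mk (assocIn (s.relabel φ) s' j) (v j)
        (fun t => W.act (φ (s'.e ⟨j, t⟩)) _ (w (s'.e ⟨j, t⟩))) =
      (comp V W).act (ψ j) _ (mk (assocIn s s' j) (v j) (fun t => w (s'.e ⟨j, t⟩))) := by
    intro j
    rw [act_mk]
    refine Eq.trans ?_ (mk_relabel ((assocIn s s' j).transport (ψ j))
      (fun t => φ (s'.e ⟨j, t⟩)) (v j) (fun t => w (s'.e ⟨j, t⟩)))
    refine mk_congr_e _ _ ?_ _ _
    ext ⟨t, x⟩
    refine congrArg Fin.val ?_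
    exact ((Equiv.symm_apply_eq (ψ j)).2 (hψ j t x).symm).symm
  have h1 := mk_relabel (assocShape s s') ψ u
    (fun j => mk (assocIn s s' j) (v j) (fun t => w (s'.e ⟨j, t⟩)))
  have h2 := mk_congr_e (V := U) (W := comp V W) (n := n) (d := d)
    (assocShape (s.relabel φ) s').deg ((assocShape s s').relabel ψ).deg he u
    (fun j => mk (assocIn (s.relabel φ) s' j) (v j)
      (fun t => W.act (φ (s'.e ⟨j, t⟩)) _ (w (s'.e ⟨j, t⟩))))
  have h4 : mk ((assocShape s s').relabel ψ) u (fun j => mk (assocIn (s.relabel φ) s' j) (v j)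
        (fun t => W.act (φ (s'.e ⟨j, t⟩)) _ (w (s'.e ⟨j, t⟩)))) =
      mk ((assocShape s s').relabel ψ) u (fun j =>
        (comp V W).act (ψ j) _ (mk (assocIn s s' j) (v j) (fun t => w (s'.e ⟨j, t⟩)))) :=
    congrArg (mk ((assocShape s s').relabel ψ) u) (funext hy)
  exact congrArg (assocSgn s s' • ·) (h2.trans (h4.trans h1))

lemma mk_induction {V W : SMod K} {n : ℕ} {d : ℤ} {P : (comp V W).at' n d → Prop}
    (zero : P 0) (add : ∀ x y, P x → P y → P (x + y)) (smul : ∀ (c : K) x, P x → P (c • x))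
    (mk : ∀ (s : Shape n d) (v : V.at' s.k s.a) (w : ∀ j, W.at' (s.m j) (s.b j)), P (mk s v w))
    (x : (comp V W).at' n d) : P x := by
  let S : Submodule K ((comp V W).at' n d) :=
    { carrier := {x | P x}
      zero_mem' := zero
      add_mem' := fun {x y} hx hy => add x y hx hy
      smul_mem' := fun c x hx => smul c x hx }
  have h := hom_ext_mk (f := S.mkQ) (g := 0)
    (fun s v w => (Submodule.Quotient.mk_eq_zero S).2 (mk s v w)) x
  exact (Submodule.Quotient.mk_eq_zero S).1 h

lemma assocInner_perm (s : Shape n d) {k : ℕ} (σ : Fin k ≃ Fin s.k)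
    (x : (comp U V).at' s.k s.a) (w : ∀ i, W.at' (s.m i) (s.b i)) :
    assocInner U V W (s.perm σ) ((comp U V).act σ s.a x) (fun i => w (σ i)) =
      koszulSign (fun j => s.b (σ j)) id σ • assocInner U V W s x w := by
  refine mk_induction (P := fun x => assocInner U V W (s.perm σ) ((comp U V).act σ s.a x)
    (fun i => w (σ i)) = koszulSign (fun j => s.b (σ j)) id σ • assocInner U V W s x w)
    ?_ ?_ ?_ ?_ x
  · simp
  · intro x y hx hy
    have h1 := congrArg₂ (· + ·) hx hy
    simp only [map_add, add_apply, smul_add]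
    exact h1
  · intro c x hx
    have h1 := congrArg (c • ·) hx
    simp only [map_smul, smul_apply]
    exact h1.trans (smul_comm _ _ _)
  · intro s' u v
    rw [act_mk]
    refine (assocInner_mk (s.perm σ) _ _ _ _).trans ?_
    rw [assocInner_mk]
    refine (assocVal_outer_perm s σ (s'.e.trans σ.symm) s'.deg u v w).trans ?_
    congr 1
    refine assocVal_congr s _ _ ?_ u v w
    ext x
    simp

lemma assocInner_relabel (s : Shape n d) {m : Fin s.k → ℕ} (φ : ∀ j, Fin (m j) ≃ Fin (s.m j))
    (x : (comp U V).at' s.k s.a) (w : ∀ i, W.at' (s.m i) (s.b i)) :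
    assocInner U V W (s.relabel φ) x (fun i => W.act (φ i) (s.b i) (w i)) =
      assocInner U V W s x w := by
  refine mk_induction (P := fun x => assocInner U V W (s.relabel φ) x
    (fun i => W.act (φ i) (s.b i) (w i)) = assocInner U V W s x w) ?_ ?_ ?_ ?_ x
  · simp
  · intro x y hx hy
    have h1 := congrArg₂ (· + ·) hx hy
    simp only [map_add, add_apply]
    exact h1
  · intro c x hx
    have h1 := congrArg (c • ·) hx
    simp only [map_smul, smul_apply]
    exact h1
  · intro s' u v
    exact ((assocInner_mk (s.relabel φ) s' u v _).trans
      (assocVal_outer_relabel s φ s' u v w)).trans (assocInner_mk s s' u v w).symm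

/-- The components of the associator. -/
def associatorAux (U V W : SMod K) (n : ℕ) (d : ℤ) :
    (comp (comp U V) W).at' n d →ₗ[K] (comp U (comp V W)).at' n d :=
  desc (assocInner U V W) (fun s _ σ x w => assocInner_perm s σ x w)
    (fun s _ φ x w => assocInner_relabel s φ x w)

lemma associatorAux_mk (s : Shape n d) (x : (comp U V).at' s.k s.a)
    (w : ∀ i, W.at' (s.m i) (s.b i)) :
    associatorAux U V W n d (mk s x w) = assocInner U V W s x w :=
  desc_mk _ _ _ s x w

lemma assocInner_transport {n' : ℕ} (ψ : Fin n' ≃ Fin n) (s : Shape n d)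
    (x : (comp U V).at' s.k s.a) (w : ∀ i, W.at' (s.m i) (s.b i)) :
    assocInner U V W (s.transport ψ) x w =
      (comp U (comp V W)).act ψ d (assocInner U V W s x w) := by
  refine mk_induction (P := fun x => assocInner U V W (s.transport ψ) x w =
      (comp U (comp V W)).act ψ d (assocInner U V W s x w)) ?_ ?_ ?_ ?_ x
  · simp
  · intro x y hx hy
    have h1 := congrArg₂ (· + ·) hx hy
    simp only [map_add, add_apply]
    exact h1
  · intro c x hx
    have h1 := congrArg (c • ·) hx
    simp only [map_smul, smul_apply]
    exact h1
  · intro s' u v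
    refine (assocInner_mk (s.transport ψ) s' u v w).trans ?_
    refine Eq.trans ?_ (congrArg ((comp U (comp V W)).act ψ d) (assocInner_mk s s' u v w)).symm
    refine Eq.trans ?_ (map_zu ((comp U (comp V W)).act ψ d) (assocSgn s s') _).symm
    exact congrArg (assocSgn s s' • ·) (act_mk (V := U) (W := comp V W) ψ (assocShape s s') u
      (fun j => mk (assocIn s s' j) (v j) (fun t => w (s'.e ⟨j, t⟩)))).symm

lemma associatorAux_act {n' : ℕ} (ψ : Fin n' ≃ Fin n) (x : (comp (comp U V) W).at' n d) :
    associatorAux U V W n' d ((comp (comp U V) W).act ψ d x) =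
      (comp U (comp V W)).act ψ d (associatorAux U V W n d x) :=
  desc_act (fun n => associatorAux U V W n d) ψ (fun s x w =>
    (associatorAux_mk (s.transport ψ) x w).trans ((assocInner_transport ψ s x w).trans
      (congrArg ((comp U (comp V W)).act ψ d) (associatorAux_mk s x w).symm))) x

/-- The associator `(U ∘ V) ∘ W → U ∘ (V ∘ W)`. -/
def associator (U V W : SMod K) : comp (comp U V) W ⟶ comp U (comp V W) :=
  homMk (associatorAux U V W) (fun ψ _ x => associatorAux_act ψ x)

/-- The formula for the associator on elementary tensors. -/
lemma associator_mk (s : Shape n d) (s' : Shape s.k s.a) (u : U.at' s'.k s'.a)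
    (v : ∀ j, V.at' (s'.m j) (s'.b j)) (w : ∀ i, W.at' (s.m i) (s.b i)) :
    appl (associator U V W) n d (mk (V := comp U V) (W := W) s (mk (V := U) (W := V) s' u v) w) =
      assocVal s s' u v w := by
  rw [associator, appl_homMk, associatorAux_mk, assocInner_mk]

end Associator

section KerProd

variable {V W : SMod K}

/-- The kernel of a morphism of graded `𝕊`-modules. -/
def ker (f : V ⟶ W) : SMod K :=
  SMod.of (fun n a => LinearMap.ker (appl f n a))
    (fun φ a => (V.act φ a).restrict fun x hx => by
      rw [LinearMap.mem_ker] at hx ⊢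
      rw [appl_act, hx, map_zero])
    (fun n a x => Subtype.ext (V.act_refl n a x.1))
    (fun φ ψ a x => Subtype.ext (V.act_trans φ ψ a x.1))

/-- The inclusion of the kernel. -/
def kerIncl (f : V ⟶ W) : ker f ⟶ V :=
  homMk (fun n a => (LinearMap.ker (appl f n a)).subtype) (fun _ _ _ => rfl)

/-- A morphism with values in the kernel. -/
def kerLift {U : SMod K} (f : V ⟶ W) (g : U ⟶ V)
    (h : ∀ n a x, appl f n a (appl g n a x) = 0) : U ⟶ ker f :=
  homMk (fun n a => (appl g n a).codRestrict (LinearMap.ker (appl f n a)) (h n a))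
    (fun φ a x => Subtype.ext (appl_act g φ a x))

/-- The direct sum of two graded `𝕊`-modules. -/
def prod (V W : SMod K) : SMod K :=
  SMod.of (fun n a => V.at' n a × W.at' n a) (fun φ a => (V.act φ a).prodMap (W.act φ a))
    (fun n a x => Prod.ext (V.act_refl n a x.1) (W.act_refl n a x.2))
    (fun φ ψ a x => Prod.ext (V.act_trans φ ψ a x.1) (W.act_trans φ ψ a x.2))

/-- The morphism `x ↦ (f x, g x)`. -/
def prodLift {U : SMod K} (f : U ⟶ V) (g : U ⟶ W) : U ⟶ prod V W :=
  homMk (fun n a => (appl f n a).prod (appl g n a))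
    (fun φ a x => Prod.ext (appl_act f φ a x) (appl_act g φ a x))

/-- The morphism `(x, y) ↦ (x, g y)`. -/
def prodMapRight (V : SMod K) {W W' : SMod K} (g : W ⟶ W') : prod V W ⟶ prod V W' :=
  homMk (fun n a => LinearMap.prodMap LinearMap.id (appl g n a))
    (fun φ a x => Prod.ext rfl (appl_act g φ a x.2))

/-- The inclusion `x ↦ (x, 0)`. -/
def prodInl (V W : SMod K) : V ⟶ prod V W :=
  homMk (fun n a => LinearMap.inl K (V.at' n a) (W.at' n a))
    (fun φ a _ => Prod.ext rfl (map_zero (W.act φ a)).symm)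

end KerProd

section Functoriality

lemma hom_ext {V W : SMod K} {f g : V ⟶ W} (h : ∀ n a x, appl f n a x = appl g n a x) :
    f = g := by
  apply NatTrans.ext
  funext n
  funext a
  ext x
  exact h n.unop.n a x

lemma appl_id (V : SMod K) (n : ℕ) (a : ℤ) (x : V.at' n a) : appl (𝟙 V) n a x = x := rfl

lemma appl_comp {U V W : SMod K} (f : U ⟶ V) (g : V ⟶ W) (n : ℕ) (a : ℤ) (x : U.at' n a) :
    appl (f ≫ g) n a x = appl g n a (appl f n a x) := rfl

lemma compMap_id (V W : SMod K) : compMap (𝟙 V) (𝟙 W) = 𝟙 (comp V W) :=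
  hom_ext fun n a x => hom_ext_mk (f := appl (compMap (𝟙 V) (𝟙 W)) n a) (g := LinearMap.id)
    (fun s v w => compMap_mk (𝟙 V) (𝟙 W) s v w) x

lemma compMap_comp {V V' V'' W W' W'' : SMod K} (f : V ⟶ V') (f' : V' ⟶ V'') (g : W ⟶ W')
    (g' : W' ⟶ W'') : compMap (f ≫ f') (g ≫ g') = compMap f g ≫ compMap f' g' :=
  hom_ext fun n a x => hom_ext_mk (f := appl (compMap (f ≫ f') (g ≫ g')) n a)
    (g := appl (compMap f' g') n a ∘ₗ appl (compMap f g) n a)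
    (fun s v w => by
      rw [LinearMap.comp_apply, compMap_mk, compMap_mk, compMap_mk]
      rfl) x

end Functoriality

end SMod

/-- Cooperads: comonoids in graded `𝕊`-modules for the composition product `∘`. -/
structure Cooperad (K : Type u) [Field K] where
  /-- the underlying graded `𝕊`-module -/
  X : SMod K
  /-- the decomposition map -/
  Δ : X ⟶ comp X X
  /-- the counit -/
  ε : X ⟶ unit K
  coassoc : Δ ≫ compMap Δ (𝟙 X) ≫ associator X X X = Δ ≫ compMap (𝟙 X) Δ
  counit_left : Δ ≫ compMap ε (𝟙 X) ≫ leftUnitor X = 𝟙 X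
  counit_right : Δ ≫ compMap (𝟙 X) ε ≫ rightUnitor X = 𝟙 X

/-- Coaugmented cooperads: cooperads with a morphism of cooperads `η` from the unit `I`. -/
structure CoaugCooperad (K : Type u) [Field K] extends Cooperad K where
  /-- the coaugmentation -/
  η : unit K ⟶ X
  η_counit : η ≫ ε = 𝟙 (unit K)
  /-- compatibility with the decomposition; the decomposition of `I` is the inverse of the
  isomorphism `I ∘ I → I` -/
  η_comul : leftUnitor (unit K) ≫ η ≫ Δ = compMap η η

namespace CoaugCooperad

variable {K : Type u} [Field K] (C : CoaugCooperad K)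

/-- The kernel of the counit. -/
def bar : SMod K := SMod.ker C.ε

/-- The endomorphism `Id - η ε`. -/
def proj : C.X ⟶ C.X :=
  homMk (fun n a => LinearMap.id - appl (C.ε ≫ C.η) n a) (fun φ a x => by
    rw [LinearMap.sub_apply, LinearMap.sub_apply, appl_act, map_sub]
    rfl)

/-- The projection onto the kernel of the counit, along the image of the coaugmentation. -/
def toBar : C.X ⟶ C.bar :=
  kerLift C.ε C.proj fun n a x => by
    have h : appl C.ε n a (appl C.η n a (appl C.ε n a x)) = appl C.ε n a x :=
      congrArg (fun f => appl f n a (appl C.ε n a x)) C.η_counit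
    exact (map_sub (appl C.ε n a) _ _).trans (sub_eq_zero.2 h.symm)

/-- Trees with at most `n` levels of vertices in the kernel of the counit:
`T₀ = I` and `T_{n+1} = I ⊕ (C̄ ∘ T_n)`. -/
def tower : ℕ → SMod K
  | 0 => unit K
  | n + 1 => SMod.prod (unit K) (comp C.bar (tower n))

/-- The `n`-th successive decomposition `t_n : C → T_n`: `t₀ = ε` and `t_{n+1}` has the components
`ε` and `(π ∘ t_n) Δ`, where `π` is the projection onto the kernel of the counit. -/
def decomp : ∀ n : ℕ, C.X ⟶ C.tower n
  | 0 => C.ε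
  | n + 1 => prodLift C.ε (C.Δ ≫ compMap C.toBar (decomp n))

/-- The inclusions `T_n → T_{n+1}`. -/
def towerIncl : ∀ n : ℕ, C.tower n ⟶ C.tower (n + 1)
  | 0 => prodInl (unit K) (comp C.bar (unit K))
  | n + 1 => prodMapRight (unit K) (compMap (𝟙 C.bar) (towerIncl n))

/-- A coaugmented cooperad is conilpotent if the process of successive decomposition stabilizes in
finite time for any element. -/
def IsConilpotent : Prop :=
  ∀ (m : ℕ) (a : ℤ) (x : C.X.at' m a), ∃ N : ℕ, ∀ n ≥ N,
    appl (C.towerIncl n) m a (appl (C.decomp n) m a x) = appl (C.decomp (n + 1)) m a x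

end CoaugCooperad

/-- Curved cooperads: coaugmented graded cooperads with a degree `-2` map `θ` from the component of
arity `1` to `K`, and a degree `-1` coderivation `d`, such that `d² = (θ ⊗ Id - Id ⊗ θ) Δ₂` and
`θ d = 0`. -/
structure CurvedCooperad (K : Type u) [Field K] extends CoaugCooperad K where
  /-- the coderivation -/
  d : DegMap (-1) X X
  /-- the curvature -/
  θ : DegMap (-2) X (unit K)
  /-- `Δ d = (d ∘ Id + Id ∘' d) Δ` -/
  coder : ∀ (n : ℕ) (a a' : ℤ) (h : a + (-1) = a') (x : X.at' n a),
    appl Δ n a' (d.app n a a' h x) =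
      (compLeft d X).app n a a' h (appl Δ n a x) + (compInf X (𝟙 X) d).app n a a' h (appl Δ n a x)
  /-- `d 1 = 0` -/
  d_one : ∀ (n : ℕ) (a a' : ℤ) (h : a + (-1) = a') (c : (unit K).at' n a),
    d.app n a a' h (appl η n a c) = 0
  /-- In the first term the curvature is applied to the lower vertex, in the second one to the
  upper vertex; the other vertex is projected onto the kernel of the counit. -/
  d_sq : ∀ (n : ℕ) (a a' a'' : ℤ) (h : a + (-1) = a') (h' : a' + (-1) = a'')
    (h'' : a + (-2) = a'') (x : X.at' n a),
    d.app n a' a'' h' (d.app n a a' h x) =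
      appl (leftUnitor X) n a'' ((compLeft θ X).app n a a'' h''
        (appl (compMap (𝟙 X) toCoaugCooperad.proj) n a (appl Δ n a x))) -
      appl (rightUnitor X) n a'' ((compInf X ε θ).app n a a'' h''
        (appl (compMap toCoaugCooperad.proj (𝟙 X)) n a (appl Δ n a x)))
  /-- `θ d = 0` -/
  θ_d : ∀ (n : ℕ) (a a' a'' : ℤ) (h : a + (-1) = a') (h' : a' + (-2) = a'') (x : X.at' n a),
    θ.app n a' a'' h' (d.app n a a' h x) = 0

/-- Coalgebras over a curved cooperad `C`: left `C`-comodules concentrated in arity `0`, with a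
coderivation `d` such that `d² = (θ ∘ Id) Δ`. -/
structure Coalg {K : Type u} [Field K] (C : CurvedCooperad K) where
  /-- the underlying graded module, as a graded `𝕊`-module concentrated in arity `0` -/
  X : SMod K
  arity_zero : ∀ n ≠ 0, ∀ a, Subsingleton (X.at' n a)
  /-- the decomposition map -/
  Δ : X ⟶ comp C.X X
  coassoc : Δ ≫ compMap C.Δ (𝟙 X) ≫ associator C.X C.X X = Δ ≫ compMap (𝟙 C.X) Δ
  counit : Δ ≫ compMap C.ε (𝟙 X) ≫ leftUnitor X = 𝟙 X
  /-- the coderivation -/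
  d : DegMap (-1) X X
  /-- `Δ d = (d ∘ Id + Id ∘' d) Δ` -/
  coder : ∀ (n : ℕ) (a a' : ℤ) (h : a + (-1) = a') (x : X.at' n a),
    appl Δ n a' (d.app n a a' h x) =
      (compLeft C.d X).app n a a' h (appl Δ n a x) +
        (compInf C.X (𝟙 X) d).app n a a' h (appl Δ n a x)
  d_sq : ∀ (n : ℕ) (a a' a'' : ℤ) (h : a + (-1) = a') (h' : a' + (-1) = a'')
    (h'' : a + (-2) = a'') (x : X.at' n a),
    d.app n a' a'' h' (d.app n a a' h x) =
      appl (leftUnitor X) n a'' ((compLeft C.θ X).app n a a'' h'' (appl Δ n a x))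

namespace Coalg

variable {K : Type u} [Field K] {C : CurvedCooperad K}

/-- Morphisms of coalgebras over a curved cooperad: morphisms of graded modules which commute with
the decomposition maps and with the coderivations. -/
@[ext]
structure Hom (D E : Coalg C) where
  f : D.X ⟶ E.X
  comul : D.Δ ≫ compMap (𝟙 C.X) f = f ≫ E.Δ
  comm_d : ∀ (n : ℕ) (a a' : ℤ) (h : a + (-1) = a') (x : D.X.at' n a),
    appl f n a' (D.d.app n a a' h x) = E.d.app n a a' h (appl f n a x)

instance : Category.{u} (Coalg C) where
  Hom := Hom
  id D :=
    { f := 𝟙 D.X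
      comul := by rw [compMap_id, Category.comp_id, Category.id_comp]
      comm_d := fun _ _ _ _ _ => rfl }
  comp {D E F} φ ψ :=
    { f := φ.f ≫ ψ.f
      comul := by
        have h := compMap_comp (𝟙 C.X) (𝟙 C.X) φ.f ψ.f
        rw [Category.comp_id] at h
        rw [h, ← Category.assoc, φ.comul, Category.assoc, ψ.comul, Category.assoc]
      comm_d := fun n a a' h x => by
        rw [appl_comp, φ.comm_d, ψ.comm_d, appl_comp] }
  id_comp φ := Hom.ext (Category.id_comp φ.f)
  comp_id φ := Hom.ext (Category.comp_id φ.f)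
  assoc φ ψ χ := Hom.ext (Category.assoc φ.f ψ.f χ.f)

/-- A coalgebra is finite-dimensional if its total underlying vector space is. -/
def IsFiniteDimensional (D : Coalg C) : Prop :=
  Module.Finite K (⨁ a : ℤ, D.X.at' 0 a)

/-- The sub-coalgebras of `D` (given by their injective inclusion morphisms) which are
finite-dimensional. -/
def finSubProp (D : Coalg C) : ObjectProperty (Over D) := fun E =>
  (∀ n a, Function.Injective (appl (Hom.f E.hom) n a)) ∧ IsFiniteDimensional E.left

/-- The category of finite-dimensional sub-coalgebras of `D` and inclusions between them. -/
abbrev FinSub (D : Coalg C) := D.finSubProp.FullSubcategory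

/-- The diagram of the finite-dimensional sub-coalgebras of `D`. -/
abbrev FinSub.diagram (D : Coalg C) : FinSub D ⥤ Coalg C := D.finSubProp.ι ⋙ Over.forget D

/-- The cocone over the diagram of finite-dimensional sub-coalgebras of `D` which is given by their
inclusions into `D`. -/
abbrev FinSub.cocone (D : Coalg C) : Cocone (FinSub.diagram D) :=
  (Over.forgetCocone D).whisker D.finSubProp.ι

end Coalg

end

/-!
A coalgebra over a conilpotent curved cooperad is the union of its finite-dimensional
sub-coalgebras, finite-dimensional coalgebras are compact, and colimits of coalgebras are computed
in graded vector spaces; the theorem is a formal consequence of these three facts.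

*Local finiteness* (`Coalg.exists_isSubCoalg`). Conilpotence filters a coalgebra `D` by the subspaces
`Coalg.coradical` of the elements whose successive decomposition stabilizes after a given number of
steps. By coassociativity the reduced decomposition `D → C̄ ∘ D` lowers this filtration
(`Coalg.coact_toBar_mem_of_mem_coradical_succ`). Here one has to know that an element of `C̄ ∘ D` on
which two maps `C̄ ∘ f` and `C̄ ∘ g` agree comes from `C̄ ∘ E`, where `E` is the equalizer of `f` and
`g`. The functor `C̄ ∘ -` does not preserve all equalizers, but over a field it preserves those of
pairs with a common retraction, since they are split (`SMod.mem_compSub_eqFam`), and the counit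
provides such a retraction. As an element of `C̄ ∘ D` involves only finitely many elements of `D`,
it follows by induction along the filtration that each element lies in a finite-dimensional
subspace `V` stable under the decomposition. Then `V + d V` is a finite-dimensional sub-coalgebra:
`d² = (θ ∘ Id) Δ` maps `V` to itself (`Coalg.isSubCoalg_sup_dFam`).

*Sub-coalgebras.* An injection of graded vector spaces has a retraction, so that `C ∘ -` preserves
injections. Hence a stable subspace carries a unique structure of a coalgebra (`Coalg.restrict`), and
a morphism whose image lies in a sub-coalgebra factors through it
(`Coalg.exists_lift_of_range_le`). The finite-dimensional sub-coalgebras of `D` thus form a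
filtered preorder with union `D`, and `D` is their colimit (`Coalg.FinSub.nonempty_isColimit`).

*Compactness* (`Coalg.IsFiniteDimensional.isFinitelyPresentable`). Colimits of coalgebras are created
in graded vector spaces (`Coalg.exists_isColimit`). Let `L` be the colimit of a filtered diagram
`X`. A linear map from a finite-dimensional `E` to `L` factors through some `X j`, and the
compatibility with the structure maps holds at a later stage. For the decomposition this uses that
elements of `C ∘ X i` which are equal in `C ∘ L` become equal in some `C ∘ X j`
(`SMod.IsColimitFamily.exists_compMap_eq_zero`), which is again proved by splitting `X i → L`.

*Presentability.* Finite-dimensional coalgebras form an essentially small class, as up to isomorphism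
the underlying space is a sum of copies of `K`; they generate by local finiteness.
-/

noncomputable section

open SMod

namespace SMod

variable {K : Type u} [Field K]

/-! ### Naturality of the structure maps of the composition product -/

section Naturality

lemma appl_compMap_id {X : SMod K} (V : SMod K) {n : ℕ} {a : ℤ} (z : (comp V X).at' n a) :
    appl (compMap (𝟙 V) (𝟙 X)) n a z = z := by
  rw [compMap_id, appl_id]

lemma compMap_comp_left {V V' V'' : SMod K} (f : V ⟶ V') (f' : V' ⟶ V'') (W : SMod K) :
    compMap (f ≫ f') (𝟙 W) = compMap f (𝟙 W) ≫ compMap f' (𝟙 W) := by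
  rw [← compMap_comp, Category.comp_id]

lemma compMap_comp_right {W W' W'' : SMod K} (V : SMod K) (g : W ⟶ W') (g' : W' ⟶ W'') :
    compMap (𝟙 V) (g ≫ g') = compMap (𝟙 V) g ≫ compMap (𝟙 V) g' := by
  rw [← compMap_comp, Category.comp_id]

lemma compMap_comm {V V' W W' : SMod K} (f : V ⟶ V') (g : W ⟶ W') :
    compMap f (𝟙 W) ≫ compMap (𝟙 V') g = compMap (𝟙 V) g ≫ compMap f (𝟙 W') := by
  rw [← compMap_comp, ← compMap_comp, Category.comp_id, Category.comp_id, Category.id_comp,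
    Category.id_comp]

/-- Linear maps out of `(U ∘ V) ∘ W` agree if they agree on two-level elementary tensors. -/
lemma hom_ext_mk₂ {U V W : SMod K} {n : ℕ} {d : ℤ} {M : Type*} [AddCommGroup M] [Module K M]
    {f g : (comp (comp U V) W).at' n d →ₗ[K] M}
    (h : ∀ (s : Shape n d) (s' : Shape s.k s.a) (u : U.at' s'.k s'.a)
      (v : ∀ j, V.at' (s'.m j) (s'.b j)) (w : ∀ i, W.at' (s.m i) (s.b i)),
      f (mk (V := comp U V) s (mk s' u v) w) = g (mk (V := comp U V) s (mk s' u v) w))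
    (x : (comp (comp U V) W).at' n d) : f x = g x :=
  hom_ext_mk (fun s y w => by
    let L (f : (comp (comp U V) W).at' n d →ₗ[K] M) : (comp U V).at' s.k s.a →ₗ[K] M :=
      { toFun := fun y => f (mk s y w)
        map_add' := fun y y' => by rw [mk_add, map_add]
        map_smul' := fun c y => by rw [mk_smul, map_smul]; rfl }
    exact hom_ext_mk (f := L f) (g := L g) (fun s' u v => h s s' u v w) y) x

lemma associator_naturality {U U' V V' W W' : SMod K} (f : U ⟶ U') (g : V ⟶ V') (h : W ⟶ W') :
    compMap (compMap f g) h ≫ associator U' V' W' =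
      associator U V W ≫ compMap f (compMap g h) :=
  hom_ext fun n a x => hom_ext_mk₂
    (f := appl (compMap (compMap f g) h ≫ associator U' V' W') n a)
    (g := appl (associator U V W ≫ compMap f (compMap g h)) n a)
    (fun s s' u v w => by
      rw [appl_comp, appl_comp, compMap_mk, associator_mk, compMap_mk, associator_mk, assocVal,
        assocVal, map_zu, compMap_mk]
      simp only [compMap_mk]) x

lemma leftUnitor_mk {W : SMod K} {n : ℕ} {d : ℤ} (s : Shape n d) (c : (unit K).at' s.k s.a)
    (w : ∀ j, W.at' (s.m j) (s.b j)) :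
    appl (leftUnitor W) n d (mk s c w) = leftUnitForm W s c w := by
  unfold leftUnitor
  rw [appl_homMk]
  unfold leftUnitorAux
  rw [desc_mk]

lemma appl_degCast {V W : SMod K} (f : V ⟶ W) {n : ℕ} {a a' : ℤ} (h : a = a')
    (x : V.at' n a) : appl f n a' (V.degCast n h x) = W.degCast n h (appl f n a x) := by
  subst h; rfl

lemma leftUnitor_naturality {W W' : SMod K} (f : W ⟶ W') :
    compMap (𝟙 (unit K)) f ≫ leftUnitor W' = leftUnitor W ≫ f :=
  hom_ext fun n a x => hom_ext_mk
    (f := appl (compMap (𝟙 (unit K)) f ≫ leftUnitor W') n a)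
    (g := appl (leftUnitor W ≫ f) n a)
    (fun s c w => by
      rw [appl_comp, appl_comp, compMap_mk, leftUnitor_mk, leftUnitor_mk, appl_id]
      by_cases h : s.k = 1 ∧ s.a = 0
      · let j : Fin s.k := ⟨0, by omega⟩
        rw [leftUnitForm_pos W s h j, leftUnitForm_pos W' s h j, map_smul, leftUnitVal,
          leftUnitVal, LinearMap.comp_apply, LinearMap.comp_apply, appl_degCast, appl_act]
      · rw [leftUnitForm_neg W s h, leftUnitForm_neg W' s h]
        simp) x

lemma compLeft_app_mk {r : ℤ} {V V' : SMod K} (f : DegMap r V V') (W : SMod K) {n : ℕ} {d d' : ℤ}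
    (h : d + r = d') (s : Shape n d) (v : V.at' s.k s.a) (w : ∀ j, W.at' (s.m j) (s.b j)) :
    (compLeft f W).app n d d' h (mk s v w) =
      mk (s.shiftRoot r h) (f.app s.k s.a (s.a + r) rfl v) w :=
  compLeftAux_mk f W h s v w

lemma compInf_app_mk (V : SMod K) {r : ℤ} {W W' : SMod K} (g : W ⟶ W') (h : DegMap r W W')
    {n : ℕ} {d d' : ℤ} (hd : d + r = d') (s : Shape n d) (v : V.at' s.k s.a)
    (w : ∀ j, W.at' (s.m j) (s.b j)) :
    (compInf V g h).app n d d' hd (mk s v w) =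
      ∑ i : Fin s.k, (r * (s.a + ∑ j with j < i, s.b j)).negOnePow •
        mk (s.shift r hd i) v (fun j => infAux g h (j = i) (s.m j) (s.b j) (w j)) :=
  compInfAux_mk V g h hd s v w

lemma compLeft_naturality {r : ℤ} {V V' W W' : SMod K} (f : DegMap r V V') (g : W ⟶ W') {n : ℕ}
    {d d' : ℤ} (h : d + r = d') (z : (comp V W).at' n d) :
    appl (compMap (𝟙 V') g) n d' ((compLeft f W).app n d d' h z) =
      (compLeft f W').app n d d' h (appl (compMap (𝟙 V) g) n d z) :=
  hom_ext_mk (f := appl (compMap (𝟙 V') g) n d' ∘ₗ (compLeft f W).app n d d' h)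
    (g := (compLeft f W').app n d d' h ∘ₗ appl (compMap (𝟙 V) g) n d)
    (fun s v w => by
      rw [LinearMap.comp_apply, LinearMap.comp_apply, compMap_mk, compLeft_app_mk, compLeft_app_mk,
        compMap_mk]
      rfl) z

lemma infAux_naturality {r : ℤ} {W W' : SMod K} (g : W ⟶ W') (e : DegMap r W W)
    (e' : DegMap r W' W')
    (hg : ∀ (n : ℕ) (a a' : ℤ) (h : a + r = a') (x : W.at' n a),
      appl g n a' (e.app n a a' h x) = e'.app n a a' h (appl g n a x))
    (p : Prop) [Decidable p] (n : ℕ) (b : ℤ) (w : W.at' n b) :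
    appl g n _ (infAux (𝟙 W) e p n b w) = infAux (𝟙 W') e' p n b (appl g n b w) := by
  unfold infAux
  split_ifs with hp
  · exact hg ..
  · exact appl_degCast g _ _

lemma compInf_naturality (V : SMod K) {r : ℤ} {W W' : SMod K} (g : W ⟶ W') (e : DegMap r W W)
    (e' : DegMap r W' W')
    (hg : ∀ (n : ℕ) (a a' : ℤ) (h : a + r = a') (x : W.at' n a),
      appl g n a' (e.app n a a' h x) = e'.app n a a' h (appl g n a x))
    {n : ℕ} {d d' : ℤ} (h : d + r = d') (z : (comp V W).at' n d) :
    appl (compMap (𝟙 V) g) n d' ((compInf V (𝟙 W) e).app n d d' h z) =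
      (compInf V (𝟙 W') e').app n d d' h (appl (compMap (𝟙 V) g) n d z) :=
  hom_ext_mk (f := appl (compMap (𝟙 V) g) n d' ∘ₗ (compInf V (𝟙 W) e).app n d d' h)
    (g := (compInf V (𝟙 W') e').app n d d' h ∘ₗ appl (compMap (𝟙 V) g) n d)
    (fun s v w => by
      rw [LinearMap.comp_apply, LinearMap.comp_apply, compMap_mk, compInf_app_mk, compInf_app_mk,
        map_sum]
      refine Finset.sum_congr rfl fun i _ => ?_
      rw [map_zu, compMap_mk]
      simp only [appl_id, infAux_naturality g e e' hg]) z

end Naturality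

/-! ### Graded modules concentrated in arity zero -/

section ArityZero

/-- A graded `𝕊`-module is concentrated in arity `0`. -/
def ArityZero (X : SMod K) : Prop := ∀ n ≠ 0, ∀ a, Subsingleton (X.at' n a)

/-- Families of linear maps into a graded `𝕊`-module concentrated in arity `0` are equivariant,
because the only bijection of the empty set is the identity. -/
lemma ArityZero.map_act {V W : SMod K} (hW : ArityZero W) {a a' : ℤ}
    (f : ∀ n, V.at' n a →ₗ[K] W.at' n a') {n n' : ℕ} (φ : Fin n ≃ Fin n') (x : V.at' n' a) :
    f n (V.act φ a x) = W.act φ a' (f n' x) := by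
  by_cases hn : n = 0
  · subst hn
    obtain rfl : 0 = n' := Fin.equiv_iff_eq.1 ⟨φ⟩
    obtain rfl : φ = Equiv.refl _ := Subsingleton.elim _ _
    rw [act_refl, act_refl]
  · have := hW n hn a'
    exact Subsingleton.elim _ _

/-- The morphism with given components into a graded `𝕊`-module concentrated in arity `0`. -/
def homOfArityZero {V W : SMod K} (hW : ArityZero W) (f : ∀ n a, V.at' n a →ₗ[K] W.at' n a) :
    V ⟶ W :=
  homMk f (fun φ a x => hW.map_act (fun n => f n a) φ x)

end ArityZero

/-! ### Graded subspaces -/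

section Subspaces

/-- Families of subspaces of the components of a graded `𝕊`-module, without equivariance. -/
abbrev Sub (X : SMod K) := ∀ n a, Submodule K (X.at' n a)

/-- Homogeneous elements. -/
abbrev El (X : SMod K) := Σ (n : ℕ) (a : ℤ), X.at' n a

/-- The family of subspaces spanned by a set of homogeneous elements. -/
def spanFam {X : SMod K} (S : Set (El X)) : Sub X :=
  fun n a => Submodule.span K {x | (⟨n, a, x⟩ : El X) ∈ S}

lemma spanFam_le {X : SMod K} {S : Set (El X)} {V : Sub X} :
    spanFam S ≤ V ↔ ∀ x ∈ S, x.2.2 ∈ V x.1 x.2.1 := by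
  constructor
  · rintro h ⟨n, a, x⟩ hx
    exact h n a (Submodule.subset_span hx)
  · intro h n a
    exact Submodule.span_le.2 fun x hx => h _ hx

lemma mem_spanFam {X : SMod K} {S : Set (El X)} {n : ℕ} {a : ℤ} {x : X.at' n a}
    (h : (⟨n, a, x⟩ : El X) ∈ S) : x ∈ spanFam S n a :=
  Submodule.subset_span h

lemma spanFam_union {X : SMod K} (S T : Set (El X)) :
    spanFam (S ∪ T) = spanFam S ⊔ spanFam T := by
  funext n a
  exact Submodule.span_union _ _

/-- A family of subspaces is finitely generated if it is spanned by finitely many homogeneous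
elements; thus its total dimension is finite. -/
def FinGen {X : SMod K} (V : Sub X) : Prop := ∃ S : Set (El X), S.Finite ∧ spanFam S = V

lemma FinGen.sup {X : SMod K} {V W : Sub X} (hV : FinGen V) (hW : FinGen W) :
    FinGen (V ⊔ W) := by
  obtain ⟨S, hS, rfl⟩ := hV
  obtain ⟨T, hT, rfl⟩ := hW
  exact ⟨S ∪ T, hS.union hT, spanFam_union S T⟩

/-- The image of a family of subspaces under a map of degree `0`. -/
lemma FinGen.map {X Y : SMod K} (f : X ⟶ Y) {V : Sub X} (hV : FinGen V) :
    FinGen (X := Y) (fun n a => (V n a).map (appl f n a)) := by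
  obtain ⟨S, hS, rfl⟩ := hV
  refine ⟨(fun x : El X => (⟨x.1, x.2.1, appl f _ _ x.2.2⟩ : El Y)) '' S, hS.image _, ?_⟩
  funext n a
  refine le_antisymm (spanFam_le (V := fun n a => (spanFam S n a).map (appl f n a)).2 ?_ n a) ?_
  · rintro _ ⟨⟨n, a, x⟩, hx, rfl⟩
    exact Submodule.mem_map_of_mem (mem_spanFam hx)
  · rw [spanFam, Submodule.map_span_le]
    intro x hx
    exact mem_spanFam ⟨_, hx, rfl⟩

lemma Sub.degCast_mem {X : SMod K} (V : Sub X) {n : ℕ} {a a' : ℤ} (h : a = a') {x : X.at' n a}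
    (hx : x ∈ V n a) : X.degCast n h x ∈ V n a' := by
  subst h; exact hx

lemma ArityZero.act_mem {X : SMod K} (hX : ArityZero X) (V : Sub X) {n n' : ℕ}
    (φ : Fin n ≃ Fin n') {a : ℤ} {x : X.at' n' a} (hx : x ∈ V n' a) : X.act φ a x ∈ V n a := by
  by_cases hn : n = 0
  · subst hn
    obtain rfl : 0 = n' := Fin.equiv_iff_eq.1 ⟨φ⟩
    obtain rfl : φ = Equiv.refl _ := Subsingleton.elim _ _
    rwa [act_refl]
  · have := hX n hn a
    rw [Subsingleton.elim (X.act φ a x) 0]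
    exact zero_mem _

/-- The image of `C ∘ V` in `C ∘ X`, for a family `V` of subspaces of `X`. -/
def compSub (C : SMod K) {X : SMod K} (V : Sub X) : Sub (comp C X) := fun n a =>
  Submodule.span K {z | ∃ (s : Shape n a) (c : C.at' s.k s.a) (w : ∀ j, X.at' (s.m j) (s.b j)),
    (∀ j, w j ∈ V (s.m j) (s.b j)) ∧ mk s c w = z}

lemma mk_mem_compSub {C X : SMod K} {V : Sub X} {n : ℕ} {a : ℤ} (s : Shape n a)
    (c : C.at' s.k s.a) (w : ∀ j, X.at' (s.m j) (s.b j)) (hw : ∀ j, w j ∈ V (s.m j) (s.b j)) :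
    mk s c w ∈ compSub C V n a :=
  Submodule.subset_span ⟨s, c, w, hw, rfl⟩

lemma map_mem_of_mem_compSub {C X : SMod K} {V : Sub X} {n : ℕ} {a : ℤ} {M : Type*}
    [AddCommGroup M] [Module K M] (f : (comp C X).at' n a →ₗ[K] M) (P : Submodule K M)
    (h : ∀ (s : Shape n a) (c : C.at' s.k s.a) (w : ∀ j, X.at' (s.m j) (s.b j)),
      (∀ j, w j ∈ V (s.m j) (s.b j)) → f (mk s c w) ∈ P)
    {z : (comp C X).at' n a} (hz : z ∈ compSub C V n a) : f z ∈ P := by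
  have : compSub C V n a ≤ P.comap f := Submodule.span_le.2 (by
    rintro _ ⟨s, c, w, hw, rfl⟩
    exact h s c w hw)
  exact this hz

lemma compSub_mono (C : SMod K) {X : SMod K} {V W : Sub X} (h : V ≤ W) :
    compSub C V ≤ compSub C W := fun n a _ hz =>
  map_mem_of_mem_compSub LinearMap.id (compSub C W n a)
    (fun s c w hw => mk_mem_compSub s c w fun j => h _ _ (hw j)) hz

lemma compMap_mem_compSub {C C' X Y : SMod K} {V : Sub X} {W : Sub Y} (f : C ⟶ C') (g : X ⟶ Y)
    (h : ∀ n a, ∀ x ∈ V n a, appl g n a x ∈ W n a) {n : ℕ} {a : ℤ} {z : (comp C X).at' n a}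
    (hz : z ∈ compSub C V n a) : appl (compMap f g) n a z ∈ compSub C' W n a :=
  map_mem_of_mem_compSub _ _ (fun s c w hw => by
    rw [compMap_mk]
    exact mk_mem_compSub _ _ _ fun j => h _ _ _ (hw j)) hz

lemma mem_compSub_top {C X : SMod K} {n : ℕ} {a : ℤ} (z : (comp C X).at' n a) :
    z ∈ compSub C (⊤ : Sub X) n a :=
  mk_induction (P := fun z => z ∈ compSub C (⊤ : Sub X) n a) (zero_mem _)
    (fun _ _ => add_mem) (fun c _ => Submodule.smul_mem _ c)
    (fun s c w => mk_mem_compSub s c w fun _ => trivial) z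

lemma compMap_congr_of_mem_compSub {C X Y : SMod K} {V : Sub X} {f g : X ⟶ Y}
    (h : ∀ n a, ∀ x ∈ V n a, appl f n a x = appl g n a x) {n : ℕ} {a : ℤ}
    {z : (comp C X).at' n a} (hz : z ∈ compSub C V n a) :
    appl (compMap (𝟙 C) f) n a z = appl (compMap (𝟙 C) g) n a z := by
  rw [← sub_eq_zero, ← LinearMap.sub_apply, ← Submodule.mem_bot K]
  refine map_mem_of_mem_compSub _ ⊥ (fun s c w hw => ?_) hz
  rw [Submodule.mem_bot, LinearMap.sub_apply, compMap_mk, compMap_mk, sub_eq_zero]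
  congr 1
  funext j
  exact h _ _ _ (hw j)

/-- An element of `C ∘ V` involves only finitely many elements of `V`. -/
lemma exists_finite_mem_compSub {C X : SMod K} {V : Sub X} {n : ℕ} {a : ℤ}
    {z : (comp C X).at' n a} (hz : z ∈ compSub C V n a) :
    ∃ S : Set (El X), S.Finite ∧ (∀ x ∈ S, x.2.2 ∈ V x.1 x.2.1) ∧
      z ∈ compSub C (spanFam S) n a := by
  induction hz using Submodule.span_induction with
  | mem z hz =>
    obtain ⟨s, c, w, hw, rfl⟩ := hz
    refine ⟨Set.range fun j => (⟨s.m j, s.b j, w j⟩ : El X), Set.finite_range _, ?_, ?_⟩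
    · rintro _ ⟨j, rfl⟩
      exact hw j
    · exact mk_mem_compSub s c w fun j => mem_spanFam ⟨j, rfl⟩
  | zero => exact ⟨∅, Set.finite_empty, by simp, zero_mem _⟩
  | add x y _ _ hx hy =>
    obtain ⟨S, hS, hSV, hxS⟩ := hx
    obtain ⟨T, hT, hTV, hyT⟩ := hy
    refine ⟨S ∪ T, hS.union hT, fun x hx => hx.elim (hSV x) (hTV x), add_mem ?_ ?_⟩
    · exact compSub_mono C (by rw [spanFam_union]; exact le_sup_left) n a hxS
    · exact compSub_mono C (by rw [spanFam_union]; exact le_sup_right) n a hyT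
  | smul c x _ hx =>
    obtain ⟨S, hS, hSV, hxS⟩ := hx
    exact ⟨S, hS, hSV, Submodule.smul_mem _ c hxS⟩

lemma compLeft_mem_compSub {r : ℤ} {C C' X : SMod K} (f : DegMap r C C') {V : Sub X} {n : ℕ}
    {a a' : ℤ} (h : a + r = a') {z : (comp C X).at' n a} (hz : z ∈ compSub C V n a) :
    (compLeft f X).app n a a' h z ∈ compSub C' V n a' :=
  map_mem_of_mem_compSub _ _ (fun s c w hw => by
    rw [compLeft_app_mk]
    exact mk_mem_compSub _ _ _ hw) hz

lemma zu_smul_mem {M : Type*} [AddCommGroup M] [Module K M] (P : Submodule K M) (ε : ℤˣ) {x : M}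
    (hx : x ∈ P) : ε • x ∈ P := by
  rw [zu_smul_eq (K := K)]
  exact P.smul_mem _ hx

lemma compInf_mem_compSub {r : ℤ} {C X : SMod K} (e : DegMap r X X) {V W : Sub X} (hVW : V ≤ W)
    (he : ∀ n a a' h, ∀ x ∈ V n a, e.app n a a' h x ∈ W n a') {n : ℕ}
    {a a' : ℤ} (h : a + r = a') {z : (comp C X).at' n a} (hz : z ∈ compSub C V n a) :
    (compInf C (𝟙 X) e).app n a a' h z ∈ compSub C W n a' :=
  map_mem_of_mem_compSub _ _ (fun s c w hw => by
    rw [compInf_app_mk]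
    refine sum_mem fun i _ => zu_smul_mem _ _ (mk_mem_compSub _ _ _ fun j => ?_)
    unfold infAux
    split_ifs with hp
    · exact he _ _ _ _ _ (hw j)
    · exact W.degCast_mem _ (hVW _ _ (hw j))) hz

lemma ArityZero.leftUnitor_mem {X : SMod K} (hX : ArityZero X) {V : Sub X} {n : ℕ} {a : ℤ}
    {z : (comp (unit K) X).at' n a} (hz : z ∈ compSub (unit K) V n a) :
    appl (leftUnitor X) n a z ∈ V n a :=
  map_mem_of_mem_compSub _ _ (fun s c w hw => by
    rw [leftUnitor_mk]
    by_cases h : s.k = 1 ∧ s.a = 0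
    · let j : Fin s.k := ⟨0, by omega⟩
      rw [leftUnitForm_pos X s h j]
      exact Submodule.smul_mem _ _ (V.degCast_mem _ (hX.act_mem V _ (hw j)))
    · rw [leftUnitForm_neg X s h]
      exact zero_mem _) hz

/-- An element of `I ∘ X` lies in `I ∘ V` as soon as its image under the left unitor lies
in `V`. -/
lemma mem_compSub_unit {X : SMod K} {V : Sub X} {n : ℕ} {a : ℤ} (z : (comp (unit K) X).at' n a)
    (hz : appl (leftUnitor X) n a z ∈ V n a) : z ∈ compSub (unit K) V n a := by
  -- the inverse of the left unitor is `x ↦ 1 ⊗ x`, in the summand with a single upper element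
  let s₀ : Shape n a := ⟨1, 0, fun _ => n, fun _ => a, Equiv.uniqueSigma fun _ : Fin 1 => Fin n,
    by simp⟩
  let L : X.at' n a →ₗ[K] (comp (unit K) X).at' n a :=
    { toFun := fun x => mk (V := unit K) (W := X) s₀ (fun _ => (1 : K)) (fun _ => x)
      map_add' := fun x y => by
        have h := (mk_update (V := unit K) (W := X) s₀ (fun _ => (1 : K)) (fun _ => x) 0).1 x y
        have e : ∀ x' : X.at' n a, Function.update
            (fun _ => x : ∀ j, X.at' (s₀.m j) (s₀.b j)) 0 x' = fun _ => x' := fun x' => by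
          funext j
          obtain rfl : j = 0 := Subsingleton.elim _ _
          simp
        simpa only [e] using h
      map_smul' := fun c x => by
        have h := (mk_update (V := unit K) (W := X) s₀ (fun _ => (1 : K)) (fun _ => x) 0).2 c x
        have e : ∀ x' : X.at' n a, Function.update
            (fun _ => x : ∀ j, X.at' (s₀.m j) (s₀.b j)) 0 x' = fun _ => x' := fun x' => by
          funext j
          obtain rfl : j = 0 := Subsingleton.elim _ _
          simp
        simpa only [e, RingHom.id_apply] using h }
  have key : z = L (appl (leftUnitor X) n a z) :=
    hom_ext_mk (f := LinearMap.id) (g := L ∘ₗ appl (leftUnitor X) n a) (fun s c w => by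
      rw [LinearMap.comp_apply, LinearMap.id_apply, leftUnitor_mk]
      by_cases h : s.k = 1 ∧ s.a = 0
      · let j : Fin s.k := ⟨0, by omega⟩
        rw [leftUnitForm_pos X s h j, map_smul]
        obtain ⟨k, b₀, m, b, e, hd⟩ := s
        obtain ⟨rfl, rfl⟩ : k = 1 ∧ b₀ = 0 := h
        have h : 1 = 1 ∧ (0 : ℤ) = 0 := ⟨rfl, rfl⟩
        let s : Shape n a := ⟨1, 0, m, b, e, hd⟩
        have hb : ∀ j, b j = a := fun j => Shape.b_sole s h j
        have h1 := mk_relabel (V := unit K) (W := X) s (fun j => s.soleEquiv h.1 j) c w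
        have hc : c = unitVal h c • (fun _ => (1 : K) : (unit K).at' 1 0) := by
          funext i
          exact (mul_one _).symm
        have he : (s.relabel fun j => s.soleEquiv h.1 j).e = s₀.e := by
          ext ⟨i, x⟩
          obtain rfl : i = 0 := Subsingleton.elim _ _
          refine congrArg Fin.val ?_
          change s.e ⟨0, s.soleEquiv h.1 0 x⟩ = x
          rw [← Shape.soleEquiv_symm_apply s h.1, Equiv.symm_apply_apply]
        have h2 := mk_congr (V := unit K) (W := X) (d := a)
          (s.relabel fun j => s.soleEquiv h.1 j).deg s₀.deg hb he c
          (fun j => X.act (s.soleEquiv h.1 j) (b j) (w j))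
        refine h1.symm.trans (h2.trans ?_)
        conv_lhs => rw [hc]
        refine (mk_smul (V := unit K) (W := X) s₀ _ _ _).trans ?_
        refine congrArg (unitVal h c • ·) ?_
        refine congrArg (mk (V := unit K) (W := X) s₀ (fun _ => (1 : K))) ?_
        funext i
        obtain rfl : i = j := Subsingleton.elim _ _
        rfl
      · rw [leftUnitForm_neg X s h]
        have hc : c = 0 := by
          funext i
          exact absurd i.down h
        rw [hc]
        have := mk_smul (V := unit K) (W := X) s 0 0 w
        simpa using this) z
  rw [key]
  exact mk_mem_compSub _ _ _ fun _ => hz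

end Subspaces

/-! ### Splittings over a field -/

section Splitting

lemma exists_weakInverse {M N : Type*} [AddCommGroup M] [Module K M] [AddCommGroup N] [Module K N]
    (h : M →ₗ[K] N) : ∃ k : N →ₗ[K] M, ∀ x, h (k (h x)) = h x := by
  obtain ⟨s, hs⟩ := h.rangeRestrict.exists_rightInverse_of_surjective h.range_rangeRestrict
  obtain ⟨k, hk⟩ := LinearMap.exists_extend s
  refine ⟨k, fun x => ?_⟩
  have h1 := LinearMap.congr_fun hk (h.rangeRestrict x)
  have h2 := congrArg Subtype.val (LinearMap.congr_fun hs (h.rangeRestrict x))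
  have h3 : k (h x) = s (h.rangeRestrict x) := h1
  rw [h3]
  exact h2

lemma exists_weakInverse_hom {X Y : SMod K} (hX : ArityZero X) (p : X ⟶ Y) :
    ∃ k : Y ⟶ X, ∀ n a x, appl p n a (appl k n a (appl p n a x)) = appl p n a x := by
  choose k hk using fun n a => exists_weakInverse (appl p n a)
  exact ⟨homOfArityZero hX k, hk⟩

lemma exists_retraction {X Y : SMod K} (hX : ArityZero X) (i : X ⟶ Y)
    (hi : ∀ n a, Function.Injective (appl i n a)) : ∃ r : Y ⟶ X, i ≫ r = 𝟙 X := by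
  obtain ⟨r, hr⟩ := exists_weakInverse_hom hX i
  exact ⟨r, hom_ext fun n a x => hi n a (hr n a x)⟩

/-- The family of subspaces on which two morphisms agree. -/
def eqFam {X Y : SMod K} (f g : X ⟶ Y) : Sub X := fun n a =>
  LinearMap.eqLocus (appl f n a) (appl g n a)

lemma mem_eqFam {X Y : SMod K} {f g : X ⟶ Y} {n : ℕ} {a : ℤ} {x : X.at' n a} :
    x ∈ eqFam f g n a ↔ appl f n a x = appl g n a x := Iff.rfl

/-- The functor `C ∘ -` preserves coreflexive equalizers of graded vector spaces, because these
are split: if `ρ` is a common retraction of `f` and `g`, there is a retraction `r` of `f` such that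
`r g` takes its values in the equalizer. -/
lemma mem_compSub_eqFam {X Y : SMod K} (hX : ArityZero X) (f g : X ⟶ Y) (ρ : Y ⟶ X)
    (hf : f ≫ ρ = 𝟙 X) (hg : g ≫ ρ = 𝟙 X) {C : SMod K} {n : ℕ} {a : ℤ}
    (z : (comp C X).at' n a)
    (hz : appl (compMap (𝟙 C) f) n a z = appl (compMap (𝟙 C) g) n a z) :
    z ∈ compSub C (eqFam f g) n a := by
  have hf' : ∀ n a x, appl ρ n a (appl f n a x) = x := fun n a x =>
    congrArg (fun φ => appl φ n a x) hf
  have hg' : ∀ n a x, appl ρ n a (appl g n a x) = x := fun n a x =>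
    congrArg (fun φ => appl φ n a x) hg
  choose k hk using fun n a => exists_weakInverse (appl f n a - appl g n a)
  let r : Y ⟶ X := homOfArityZero hX fun n a =>
    appl ρ n a + k n a ∘ₗ (LinearMap.id - appl f n a ∘ₗ appl ρ n a)
  have hr : ∀ n a y, appl r n a y =
      appl ρ n a y + k n a (y - appl f n a (appl ρ n a y)) := fun n a y => rfl
  have hrf : f ≫ r = 𝟙 X := hom_ext fun n a x => by
    rw [appl_comp, hr, hf', sub_self, map_zero, add_zero, appl_id]
  have hrg : ∀ n a x, appl (g ≫ r) n a x ∈ eqFam f g n a := fun n a x => by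
    have h1 := hk n a x
    rw [mem_eqFam, ← sub_eq_zero, ← LinearMap.sub_apply, appl_comp, hr, hg', map_add,
      ← neg_sub (appl f n a x), ← LinearMap.sub_apply, map_neg, map_neg, h1, add_neg_cancel]
  have h1 : z = appl (compMap (𝟙 C) (g ≫ r)) n a z := by
    conv_lhs => rw [← appl_compMap_id C z, ← hrf]
    rw [compMap_comp_right, compMap_comp_right, appl_comp, appl_comp, hz]
  rw [h1]
  exact compMap_mem_compSub (V := ⊤) _ _ (fun n a x _ => hrg n a x) (mem_compSub_top z)

/-- The graded `𝕊`-module given by a family of subspaces, in the case of modules concentrated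
in arity `0`. -/
def subMod {X : SMod K} (hX : ArityZero X) (V : Sub X) : SMod K :=
  SMod.of (fun n a => V n a) (fun φ a => (X.act φ a).restrict fun _ hx => hX.act_mem V φ hx)
    (fun n a x => Subtype.ext (X.act_refl n a x.1))
    (fun φ ψ a x => Subtype.ext (X.act_trans φ ψ a x.1))

/-- The inclusion of a family of subspaces. -/
def subIncl {X : SMod K} (hX : ArityZero X) (V : Sub X) : subMod hX V ⟶ X :=
  homMk (fun n a => (V n a).subtype) (fun _ _ _ => rfl)

lemma subIncl_injective {X : SMod K} (hX : ArityZero X) (V : Sub X) (n : ℕ) (a : ℤ) :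
    Function.Injective (appl (subIncl hX V) n a) := Subtype.val_injective

lemma subIncl_mem {X : SMod K} (hX : ArityZero X) (V : Sub X) (n : ℕ) (a : ℤ)
    (x : (subMod hX V).at' n a) : appl (subIncl hX V) n a x ∈ V n a := x.2

lemma ArityZero.of_injective {X Y : SMod K} (hX : ArityZero X) (i : Y ⟶ X)
    (hi : ∀ n a, Function.Injective (appl i n a)) : ArityZero Y := fun n hn a =>
  have := hX n hn a
  (hi n a).subsingleton

end Splitting

end SMod

namespace Coalg

variable {K : Type u} [Field K] {C : CurvedCooperad K}

lemma arityZero (D : Coalg C) : ArityZero D.X := D.arity_zero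

/-! ### Coalgebra structures on subspaces -/

section Restrict

lemma compMap_mono_of_retract {V X Y : SMod K} {i : Y ⟶ X} {r : X ⟶ Y} (hir : i ≫ r = 𝟙 Y)
    {Z : SMod K} {f g : Z ⟶ comp V Y} (h : f ≫ compMap (𝟙 V) i = g ≫ compMap (𝟙 V) i) :
    f = g := by
  have h1 := congrArg (· ≫ compMap (𝟙 V) r) h
  simpa only [Category.assoc, ← compMap_comp_right, hir, compMap_id, Category.comp_id] using h1

lemma compMap_injective_of_retract {V X Y : SMod K} {i : Y ⟶ X} {r : X ⟶ Y} (hir : i ≫ r = 𝟙 Y)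
    (n : ℕ) (a : ℤ) : Function.Injective (appl (compMap (𝟙 V) i) n a) := by
  refine Function.LeftInverse.injective (g := appl (compMap (𝟙 V) r) n a) fun z => ?_
  rw [← appl_comp, ← compMap_comp_right, hir, appl_compMap_id]

section Naturality

variable {X Y : SMod K} {ΔX : X ⟶ comp C.X X} {ΔY : Y ⟶ comp C.X Y} {i : Y ⟶ X}
  (h : ΔY ≫ compMap (𝟙 C.X) i = i ≫ ΔX)

include h

lemma coassoc_left_naturality :
    (ΔY ≫ compMap C.Δ (𝟙 Y) ≫ associator C.X C.X Y) ≫ compMap (𝟙 C.X) (compMap (𝟙 C.X) i) =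
      i ≫ ΔX ≫ compMap C.Δ (𝟙 X) ≫ associator C.X C.X X := by
  have h1 := associator_naturality (𝟙 C.X) (𝟙 C.X) i
  rw [compMap_id] at h1
  rw [Category.assoc, Category.assoc, ← h1, reassoc_of% (compMap_comm C.Δ i), reassoc_of% h]

lemma coassoc_right_naturality :
    (ΔY ≫ compMap (𝟙 C.X) ΔY) ≫ compMap (𝟙 C.X) (compMap (𝟙 C.X) i) =
      i ≫ ΔX ≫ compMap (𝟙 C.X) ΔX := by
  rw [Category.assoc, ← compMap_comp_right, h, compMap_comp_right, reassoc_of% h]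

lemma counit_naturality :
    (ΔY ≫ compMap C.ε (𝟙 Y) ≫ leftUnitor Y) ≫ i =
      i ≫ ΔX ≫ compMap C.ε (𝟙 X) ≫ leftUnitor X := by
  rw [Category.assoc, Category.assoc, ← leftUnitor_naturality,
    reassoc_of% (compMap_comm C.ε i), reassoc_of% h]

end Naturality

variable (D : Coalg C) {Y : SMod K} (i : Y ⟶ D.X) (r : D.X ⟶ Y) (hir : i ≫ r = 𝟙 Y)
  (hΔ : i ≫ D.Δ ≫ compMap (𝟙 C.X) (r ≫ i) = i ≫ D.Δ)
  (hd : ∀ (n : ℕ) (a a' : ℤ) (h : a + (-1) = a') (y : Y.at' n a),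
    appl (r ≫ i) n a' (D.d.app n a a' h (appl i n a y)) = D.d.app n a a' h (appl i n a y))

/-- The map `r d i`. -/
def conjDeg {X Y : SMod K} {k : ℤ} (d : DegMap k X X) (i : Y ⟶ X) (r : X ⟶ Y) : DegMap k Y Y where
  app n a a' h := appl r n a' ∘ₗ d.app n a a' h ∘ₗ appl i n a
  comm φ a a' h y := by
    rw [LinearMap.comp_apply, LinearMap.comp_apply, LinearMap.comp_apply, LinearMap.comp_apply,
      appl_act, d.comm, appl_act]

include hΔ in
lemma restrict_comul : (i ≫ D.Δ ≫ compMap (𝟙 C.X) r) ≫ compMap (𝟙 C.X) i = i ≫ D.Δ := by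
  rw [Category.assoc, Category.assoc, ← compMap_comp_right, hΔ]

/-- The coalgebra structure on a graded module `Y` which is a retract, as a graded module, of a
coalgebra `D`, provided that `Y` is stable under the decomposition map and the coderivation. -/
def restrict : Coalg C where
  X := Y
  arity_zero := D.arityZero.of_injective i fun n a =>
    Function.LeftInverse.injective (g := appl r n a) fun y =>
      congrArg (fun φ => appl φ n a y) hir
  Δ := i ≫ D.Δ ≫ compMap (𝟙 C.X) r
  coassoc := by
    have h := restrict_comul D i r hΔ
    refine compMap_mono_of_retract (i := compMap (𝟙 C.X) i) (r := compMap (𝟙 C.X) r)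
      (by rw [← compMap_comp_right, hir, compMap_id]) ?_
    rw [coassoc_left_naturality h, coassoc_right_naturality h, D.coassoc]
  counit := by
    have h := restrict_comul D i r hΔ
    have h1 := congrArg (· ≫ r) (counit_naturality h)
    simpa only [Category.assoc, hir, Category.comp_id, reassoc_of% D.counit] using h1
  d := conjDeg D.d i r
  coder n a a' h y := by
    have hi := restrict_comul D i r hΔ
    have hi' : ∀ n a y, appl (compMap (𝟙 C.X) i) n a
        (appl (i ≫ D.Δ ≫ compMap (𝟙 C.X) r) n a y) = appl D.Δ n a (appl i n a y) :=
      fun n a y => congrArg (fun φ => appl φ n a y) hi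
    apply compMap_injective_of_retract (V := C.X) hir
    rw [map_add, compInf_naturality C.X i (conjDeg D.d i r) D.d hd, compLeft_naturality, hi', hi',
      ← D.coder]
    exact congrArg (appl D.Δ n a') (hd n a a' h y)
  d_sq n a a' a'' h h' h'' y := by
    have hi := restrict_comul D i r hΔ
    have hi' : ∀ n a y, appl (compMap (𝟙 C.X) i) n a
        (appl (i ≫ D.Δ ≫ compMap (𝟙 C.X) r) n a y) = appl D.Δ n a (appl i n a y) :=
      fun n a y => congrArg (fun φ => appl φ n a y) hi
    have hinj : Function.Injective (appl i n a'') :=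
      Function.LeftInverse.injective (g := appl r n a'') fun y =>
        congrArg (fun φ => appl φ n a'' y) hir
    apply hinj
    rw [← appl_comp, ← leftUnitor_naturality, appl_comp, compLeft_naturality, hi',
      ← D.d_sq n a a' a'' h h' h'']
    refine (hd n a' a'' h' _).trans ?_
    exact congrArg (D.d.app n a' a'' h') (hd n a a' h y)

/-- The inclusion of a coalgebra structure on a subspace. -/
def restrictHom : D.restrict i r hir hΔ hd ⟶ D where
  f := i
  comul := restrict_comul D i r hΔ
  comm_d n a a' h y := hd n a a' h y

end Restrict

/-- A family of subspaces of a coalgebra is a sub-coalgebra if it is stable under the decomposition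
map and the coderivation. -/
structure IsSubCoalg {D : Coalg C} (V : Sub D.X) : Prop where
  Δ_mem : ∀ n a, ∀ x ∈ V n a, appl D.Δ n a x ∈ compSub C.X V n a
  d_mem : ∀ n a a' h, ∀ x ∈ V n a, D.d.app n a a' h x ∈ V n a'

/-- A stable family of subspaces is the image of an injective morphism of coalgebras. -/
lemma IsSubCoalg.exists_hom {D : Coalg C} {V : Sub D.X} (hV : IsSubCoalg V) :
    ∃ (E : Coalg C) (φ : E ⟶ D), (∀ n a, Function.Injective (appl φ.f n a)) ∧
      ∀ n a, LinearMap.range (appl φ.f n a) = V n a := by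
  have hinj := subIncl_injective D.arityZero V
  obtain ⟨r, hr⟩ := exists_retraction (D.arityZero.of_injective _ hinj) (subIncl D.arityZero V) hinj
  have hfix : ∀ n a, ∀ x ∈ V n a, appl (r ≫ subIncl D.arityZero V) n a x = x := fun n a x hx =>
    congrArg (fun φ => appl (φ ≫ subIncl D.arityZero V) n a (⟨x, hx⟩ : V n a)) hr
  refine ⟨_, D.restrictHom (subIncl D.arityZero V) r hr ?_ ?_, hinj, fun n a => ?_⟩
  · refine hom_ext fun n a x => ?_
    rw [appl_comp, appl_comp, appl_comp]
    refine (compMap_congr_of_mem_compSub (g := 𝟙 D.X) hfix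
      (hV.Δ_mem n a _ (subIncl_mem D.arityZero V n a x))).trans ?_
    exact appl_compMap_id _ _
  · intro n a a' h x
    exact hfix n a' _ (hV.d_mem n a a' h _ (subIncl_mem D.arityZero V n a x))
  · exact Submodule.range_subtype _

end Coalg

namespace SMod

variable {K : Type u} [Field K]

/-! ### Successive decompositions in the cooperad -/

/-- The first projection of a direct sum. -/
def prodFst (V W : SMod K) : prod V W ⟶ V :=
  homMk (fun n a => LinearMap.fst K (V.at' n a) (W.at' n a)) (fun _ _ _ => rfl)

/-- The second projection of a direct sum. -/
def prodSnd (V W : SMod K) : prod V W ⟶ W :=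
  homMk (fun n a => LinearMap.snd K (V.at' n a) (W.at' n a)) (fun _ _ _ => rfl)

lemma prodMapRight_prodSnd (V : SMod K) {W W' : SMod K} (g : W ⟶ W') :
    prodMapRight V g ≫ prodSnd V W' = prodSnd V W ≫ g :=
  hom_ext fun _ _ _ => rfl

end SMod

namespace CoaugCooperad

variable {K : Type u} [Field K] (C : CoaugCooperad K)

/-- The component in `I` of an element of `T_{n+1}`. -/
def towerFst (n : ℕ) : C.tower (n + 1) ⟶ unit K := prodFst (unit K) (comp C.bar (C.tower n))

/-- The component in `C̄ ∘ T_n` of an element of `T_{n+1}`. -/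
def towerSnd (n : ℕ) : C.tower (n + 1) ⟶ comp C.bar (C.tower n) :=
  prodSnd (unit K) (comp C.bar (C.tower n))

/-- The inclusion of the kernel of the counit. -/
def barIncl : C.bar ⟶ C.X := SMod.kerIncl C.ε

lemma decomp_towerFst (n : ℕ) : C.decomp (n + 1) ≫ C.towerFst n = C.ε := rfl

lemma decomp_towerSnd (n : ℕ) :
    C.decomp (n + 1) ≫ C.towerSnd n = C.Δ ≫ compMap C.toBar (C.decomp n) := rfl

lemma decomp_towerIncl_towerFst (n : ℕ) :
    (C.decomp n ≫ C.towerIncl n) ≫ C.towerFst n = C.ε := by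
  cases n <;> rfl

lemma decomp_towerIncl_towerSnd_zero (m : ℕ) (a : ℤ) (x : C.X.at' m a) :
    appl ((C.decomp 0 ≫ C.towerIncl 0) ≫ C.towerSnd 0) m a x = 0 :=
  rfl

lemma towerIncl_towerSnd (n : ℕ) : C.towerIncl (n + 1) ≫ C.towerSnd (n + 1) =
    C.towerSnd n ≫ compMap (𝟙 C.bar) (C.towerIncl n) :=
  prodMapRight_prodSnd (unit K) (compMap (𝟙 C.bar) (C.towerIncl n))

lemma decomp_towerIncl_towerSnd_succ (n : ℕ) :
    (C.decomp (n + 1) ≫ C.towerIncl (n + 1)) ≫ C.towerSnd (n + 1) =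
      C.Δ ≫ compMap C.toBar (C.decomp n ≫ C.towerIncl n) := by
  have h2 := compMap_comp C.toBar (𝟙 C.bar) (C.decomp n) (C.towerIncl n)
  rw [Category.comp_id] at h2
  rw [h2, Category.assoc, towerIncl_towerSnd, ← Category.assoc, decomp_towerSnd, Category.assoc]

lemma proj_decomposition {n : ℕ} {a : ℤ} (v : C.X.at' n a) :
    v = appl (C.ε ≫ C.η) n a v + appl C.barIncl n a (appl C.toBar n a v) :=
  (add_sub_cancel (appl (C.ε ≫ C.η) n a v) v).symm

end CoaugCooperad

namespace Coalg

variable {K : Type u} [Field K] {C : CurvedCooperad K} (D : Coalg C)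

/-! ### The coradical filtration -/

section Filtration

/-- The map `(h ∘ Id) Δ` induced by a morphism `h` from the cooperad. -/
def coact {T : SMod K} (h : C.X ⟶ T) : D.X ⟶ comp T D.X := D.Δ ≫ compMap h (𝟙 D.X)

lemma coact_comp {T T' : SMod K} (h : C.X ⟶ T) (g : T ⟶ T') :
    D.coact (h ≫ g) = D.coact h ≫ compMap g (𝟙 D.X) := by
  rw [coact, coact, compMap_comp_left, Category.assoc]

lemma coact_ε : D.coact C.ε ≫ leftUnitor D.X = 𝟙 D.X := by
  rw [coact, Category.assoc, D.counit]

/-- Coassociativity, after applying morphisms to the two levels of trees. -/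
lemma coact_comul {B T : SMod K} (p : C.X ⟶ B) (h : C.X ⟶ T) :
    D.coact (C.Δ ≫ compMap p h) ≫ associator B T D.X =
      D.coact p ≫ compMap (𝟙 B) (D.coact h) := by
  rw [coact, compMap_comp_left, Category.assoc, Category.assoc, associator_naturality,
    reassoc_of% D.coassoc, ← compMap_comp, Category.id_comp, coact, coact, Category.assoc,
    ← compMap_comp, Category.comp_id, Category.id_comp]

/-- The `n`-th step of the coradical filtration: the elements whose successive decomposition
stabilizes after `n` steps. -/
def coradical (n : ℕ) : Sub D.X :=
  eqFam (D.coact (C.decomp (n + 1))) (D.coact (C.decomp n ≫ C.towerIncl n))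

lemma exists_mem_coradical (hC : C.IsConilpotent) (n : ℕ) (a : ℤ) (x : D.X.at' n a) :
    ∃ N, x ∈ D.coradical N n a := by
  suffices H : ∀ z : (comp C.X D.X).at' n a, ∃ N, ∀ m ≥ N,
      appl (compMap (C.decomp (m + 1)) (𝟙 D.X)) n a z =
        appl (compMap (C.decomp m ≫ C.towerIncl m) (𝟙 D.X)) n a z by
    obtain ⟨N, hN⟩ := H (appl D.Δ n a x)
    exact ⟨N, hN N le_rfl⟩
  intro z
  induction z using mk_induction with
  | zero => exact ⟨0, fun m _ => by rw [map_zero, map_zero]⟩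
  | add x y hx hy =>
    obtain ⟨N, hN⟩ := hx
    obtain ⟨N', hN'⟩ := hy
    refine ⟨max N N', fun m hm => ?_⟩
    rw [map_add, map_add, hN m (le_of_max_le_left hm), hN' m (le_of_max_le_right hm)]
  | smul c x hx =>
    obtain ⟨N, hN⟩ := hx
    exact ⟨N, fun m hm => by rw [map_smul, map_smul, hN m hm]⟩
  | mk s v w =>
    obtain ⟨N, hN⟩ := hC s.k s.a v
    refine ⟨N, fun m hm => ?_⟩
    rw [compMap_mk, compMap_mk, ← hN m hm]
    rfl

lemma coact_snd_eq {N n : ℕ} {a : ℤ} {x : D.X.at' n a} (hx : x ∈ D.coradical N n a) :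
    appl (D.coact (C.decomp (N + 1) ≫ C.towerSnd N)) n a x =
      appl (D.coact ((C.decomp N ≫ C.towerIncl N) ≫ C.towerSnd N)) n a x := by
  rw [coact_comp, coact_comp _ (C.decomp N ≫ C.towerIncl N), appl_comp, appl_comp]
  exact congrArg _ hx

lemma compMap_eq_zero {V V' W W' : SMod K} (f : V ⟶ V') (g : W ⟶ W')
    (hf : ∀ n a x, appl f n a x = 0) {n : ℕ} {a : ℤ} (z : (comp V W).at' n a) :
    appl (compMap f g) n a z = 0 :=
  hom_ext_mk (f := appl (compMap f g) n a) (g := 0) (fun s v w => by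
    rw [compMap_mk, hf, LinearMap.zero_apply]
    have := mk_smul (V := V') (W := W') s 0 0 (fun j => appl g _ _ (w j))
    simpa using this) z

/-- On the bottom step of the coradical filtration, the reduced decomposition vanishes. -/
lemma coact_toBar_of_mem_coradical_zero {n : ℕ} {a : ℤ} {x : D.X.at' n a}
    (hx : x ∈ D.coradical 0 n a) : appl (D.coact C.toBar) n a x = 0 := by
  have h1 := D.coact_snd_eq hx
  rw [C.decomp_towerSnd] at h1
  have h2 : appl (D.coact ((C.decomp 0 ≫ C.towerIncl 0) ≫ C.towerSnd 0)) n a x = 0 :=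
    compMap_eq_zero _ _ (C.decomp_towerIncl_towerSnd_zero) _
  rw [h2] at h1
  have h3 : appl (D.coact (C.Δ ≫ compMap C.toBar (C.decomp 0)) ≫
      associator C.bar (C.tower 0) D.X) n a x = 0 := by
    rw [appl_comp, h1, map_zero]
  rw [coact_comul] at h3
  have h4 : D.coact C.toBar ≫ compMap (𝟙 C.bar) (D.coact C.ε) ≫ compMap (𝟙 C.bar) (leftUnitor D.X)
      = D.coact C.toBar := by
    rw [← compMap_comp_right, coact_ε, compMap_id, Category.comp_id]
  rw [← h4, ← Category.assoc, appl_comp]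
  exact (congrArg _ h3).trans (map_zero _)

/-- The reduced decomposition lowers the coradical filtration: by coassociativity, the morphisms
defining `D.coradical N` agree on the factors of the reduced decomposition of an element of
`D.coradical (N + 1)`, and the counit provides a common retraction of these morphisms. -/
lemma coact_toBar_mem_of_mem_coradical_succ {N n : ℕ} {a : ℤ} {x : D.X.at' n a}
    (hx : x ∈ D.coradical (N + 1) n a) :
    appl (D.coact C.toBar) n a x ∈ compSub C.bar (D.coradical N) n a := by
  have h1 := D.coact_snd_eq hx
  rw [C.decomp_towerSnd, C.decomp_towerIncl_towerSnd_succ] at h1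
  have h2 := congrArg (appl (associator C.bar (C.tower (N + 1)) D.X) n a) h1
  rw [← appl_comp, ← appl_comp, coact_comul, coact_comul, appl_comp, appl_comp] at h2
  refine mem_compSub_eqFam D.arityZero _ _
    (compMap (C.towerFst N) (𝟙 D.X) ≫ leftUnitor D.X) ?_ ?_ _ h2
  · rw [← Category.assoc, ← coact_comp, C.decomp_towerFst, coact_ε]
  · rw [← Category.assoc, ← coact_comp, C.decomp_towerIncl_towerFst, coact_ε]

end Filtration

/-! ### Finite-dimensional sub-coalgebras -/

section FiniteDimensional

lemma eq_add_toBar {n : ℕ} {a : ℤ} (z : (comp C.X D.X).at' n a) :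
    z = appl (compMap (C.ε ≫ C.η) (𝟙 D.X)) n a z +
      appl (compMap C.barIncl (𝟙 D.X)) n a (appl (compMap C.toBar (𝟙 D.X)) n a z) :=
  hom_ext_mk (f := LinearMap.id) (g := appl (compMap (C.ε ≫ C.η) (𝟙 D.X)) n a +
      appl (compMap C.barIncl (𝟙 D.X)) n a ∘ₗ appl (compMap C.toBar (𝟙 D.X)) n a)
    (fun s v w => by
      rw [LinearMap.add_apply, LinearMap.comp_apply, compMap_mk, compMap_mk]
      rw [compMap_mk]
      simp only [appl_id]
      rw [← mk_add, ← C.proj_decomposition, LinearMap.id_apply]) z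

/-- A family containing `x` and the factors of its reduced decomposition contains the factors of
its full decomposition. -/
lemma Δ_mem_compSub {V : Sub D.X} {n : ℕ} {a : ℤ} {x : D.X.at' n a} (hx : x ∈ V n a)
    (h : appl (D.coact C.toBar) n a x ∈ compSub C.bar V n a) :
    appl D.Δ n a x ∈ compSub C.X V n a := by
  rw [D.eq_add_toBar (appl D.Δ n a x)]
  refine add_mem ?_ (compMap_mem_compSub _ _ (fun _ _ _ => id) h)
  rw [compMap_comp_left, appl_comp]
  refine compMap_mem_compSub _ _ (fun _ _ _ => id) (mem_compSub_unit _ ?_)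
  have h1 : appl (leftUnitor D.X) n a (appl (compMap C.ε (𝟙 D.X)) n a (appl D.Δ n a x)) = x :=
    congrArg (fun φ => appl φ n a x) D.counit
  rwa [h1]

/-- A family of subspaces is a sub-comodule if it is stable under the decomposition map. -/
def IsSubComod (V : Sub D.X) : Prop := ∀ n a, ∀ x ∈ V n a, appl D.Δ n a x ∈ compSub C.X V n a

lemma isSubComod_spanFam {V : Sub D.X} {S : Set (El D.X)} (hS : spanFam S = V)
    (h : ∀ x ∈ S, appl D.Δ x.1 x.2.1 x.2.2 ∈ compSub C.X V x.1 x.2.1) : D.IsSubComod V := by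
  have h1 : spanFam S ≤ fun n a => (compSub C.X V n a).comap (appl D.Δ n a) := spanFam_le.2 h
  rw [hS] at h1
  exact fun n a x hx => h1 n a hx

variable {D} in
lemma IsSubComod.sup {V W : Sub D.X} (hV : D.IsSubComod V) (hW : D.IsSubComod W) :
    D.IsSubComod (V ⊔ W) := by
  intro n a x hx
  obtain ⟨y, hy, z, hz, rfl⟩ := Submodule.mem_sup.1 (show x ∈ V n a ⊔ W n a from hx)
  rw [map_add]
  exact add_mem (compSub_mono C.X le_sup_left n a (hV n a y hy))
    (compSub_mono C.X le_sup_right n a (hW n a z hz))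

variable {D} in
/-- A finite set lies in a finitely generated family with the property `P` if each of its elements
does, for a property `P` which is stable under finite sums. -/
lemma exists_finGen_of_finite {P : Sub D.X → Prop} (h0 : P ⊥)
    (hsup : ∀ V W, P V → P W → P (V ⊔ W)) {S : Set (El D.X)} (hS : S.Finite)
    (h : ∀ x ∈ S, ∃ V : Sub D.X, FinGen V ∧ P V ∧ x.2.2 ∈ V x.1 x.2.1) :
    ∃ V : Sub D.X, FinGen V ∧ P V ∧ spanFam S ≤ V := by
  induction S, hS using Set.Finite.induction_on with
  | empty =>
    refine ⟨⊥, ⟨∅, Set.finite_empty, ?_⟩, h0, spanFam_le.2 (by simp)⟩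
    funext n a
    exact Submodule.span_empty
  | @insert x S _ _ ih =>
    obtain ⟨V, hV, hPV, hSV⟩ := ih fun y hy => h y (Set.mem_insert_of_mem _ hy)
    obtain ⟨W, hW, hPW, hxW⟩ := h x (Set.mem_insert _ _)
    refine ⟨V ⊔ W, hV.sup hW, hsup V W hPV hPW, spanFam_le.2 ?_⟩
    rintro y (rfl | hy)
    · exact Submodule.mem_sup_right hxW
    · exact Submodule.mem_sup_left (spanFam_le.1 hSV y hy)

lemma isSubComod_bot : D.IsSubComod ⊥ := by
  intro n a x hx
  obtain rfl := (Submodule.mem_bot K).1 hx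
  rw [map_zero]
  exact zero_mem _

lemma finGen_span_singleton {X : SMod K} {n : ℕ} {a : ℤ} (x : X.at' n a) :
    FinGen (spanFam {(⟨n, a, x⟩ : El X)}) := ⟨_, Set.finite_singleton _, rfl⟩

/-- If the factors of the reduced decomposition of `x` lie in finitely generated sub-comodules, then
so does `x`. -/
lemma exists_subComod_of_toBar {V : Sub D.X}
    (hV : ∀ n a, ∀ y ∈ V n a, ∃ W : Sub D.X, FinGen W ∧ D.IsSubComod W ∧ y ∈ W n a)
    {n : ℕ} {a : ℤ} {x : D.X.at' n a}
    (hx : appl (D.coact C.toBar) n a x ∈ compSub C.bar V n a) :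
    ∃ W : Sub D.X, FinGen W ∧ D.IsSubComod W ∧ x ∈ W n a := by
  obtain ⟨S, hS, hSV, hz⟩ := exists_finite_mem_compSub hx
  obtain ⟨W, hW, hW', hSW⟩ := exists_finGen_of_finite (P := D.IsSubComod) D.isSubComod_bot
    (fun _ _ => IsSubComod.sup) hS fun y hy => hV _ _ _ (hSV y hy)
  obtain ⟨T, hT, hTW⟩ := hW
  have hxW : x ∈ (W ⊔ spanFam {(⟨n, a, x⟩ : El D.X)}) n a :=
    Submodule.mem_sup_right (mem_spanFam rfl)
  refine ⟨W ⊔ spanFam {(⟨n, a, x⟩ : El D.X)},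
    FinGen.sup ⟨T, hT, hTW⟩ (finGen_span_singleton x), ?_, hxW⟩
  refine D.isSubComod_spanFam (S := T ∪ {(⟨n, a, x⟩ : El D.X)})
    (by rw [spanFam_union, hTW]) ?_
  rintro y (hy | rfl)
  · refine compSub_mono C.X le_sup_left _ _ (hW' _ _ _ ?_)
    rw [← hTW]
    exact mem_spanFam hy
  · exact D.Δ_mem_compSub hxW
      (compSub_mono C.bar (hSW.trans le_sup_left) _ _ hz)

lemma exists_subComod (hC : C.IsConilpotent) (n : ℕ) (a : ℤ) (x : D.X.at' n a) :
    ∃ W : Sub D.X, FinGen W ∧ D.IsSubComod W ∧ x ∈ W n a := by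
  obtain ⟨N, hN⟩ := D.exists_mem_coradical hC n a x
  induction N generalizing n a x with
  | zero =>
    refine D.exists_subComod_of_toBar (V := ⊥) (fun n a y hy => ?_) (x := x) ?_
    · obtain rfl := (Submodule.mem_bot K).1 hy
      exact ⟨⊥, ⟨∅, Set.finite_empty, by funext n a; exact Submodule.span_empty⟩,
        D.isSubComod_bot, zero_mem _⟩
    · rw [D.coact_toBar_of_mem_coradical_zero hN]
      exact zero_mem _
  | succ N ih =>
    exact D.exists_subComod_of_toBar (V := D.coradical N) ih
      (D.coact_toBar_mem_of_mem_coradical_succ hN)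

/-- The image of a family of subspaces under the coderivation. -/
def dFam (V : Sub D.X) : Sub D.X := fun n a =>
  (V n (a + 1)).map (D.d.app n (a + 1) a (by omega))

lemma d_mem_dFam {V : Sub D.X} {n : ℕ} {a a' : ℤ} (h : a + (-1) = a') {x : D.X.at' n a}
    (hx : x ∈ V n a) : D.d.app n a a' h x ∈ D.dFam V n a' := by
  obtain rfl : a = a' + 1 := by omega
  exact Submodule.mem_map_of_mem hx

lemma finGen_dFam {V : Sub D.X} (hV : FinGen V) : FinGen (D.dFam V) := by
  obtain ⟨S, hS, rfl⟩ := hV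
  refine ⟨(fun x : El D.X => (⟨x.1, x.2.1 + (-1), D.d.app _ _ _ rfl x.2.2⟩ : El D.X)) '' S,
    hS.image _, ?_⟩
  funext n a
  refine le_antisymm (spanFam_le (V := D.dFam (spanFam S)).2 ?_ n a) ?_
  · rintro _ ⟨⟨n, a, x⟩, hx, rfl⟩
    exact D.d_mem_dFam rfl (mem_spanFam hx)
  · rw [dFam, spanFam, Submodule.map_span_le]
    intro x hx
    refine mem_spanFam ⟨_, hx, ?_⟩
    have : ∀ (b : ℤ) (h : a + 1 + (-1) = b), (⟨n, a + 1 + (-1), D.d.app n (a + 1) _ rfl x⟩ : El D.X)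
        = ⟨n, b, D.d.app n (a + 1) b h x⟩ := by
      rintro b rfl; rfl
    exact this a _

/-- A sub-comodule `V` generates the sub-coalgebra `V + d V`, because `d²` is expressed in terms of
the decomposition map. -/
lemma isSubCoalg_sup_dFam {V : Sub D.X} (hV : D.IsSubComod V) : IsSubCoalg (V ⊔ D.dFam V) where
  Δ_mem n a x hx := by
    obtain ⟨y, hy, z, hz, rfl⟩ := Submodule.mem_sup.1 (show x ∈ V n a ⊔ D.dFam V n a from hx)
    obtain ⟨z, hz, rfl⟩ := hz
    rw [map_add, D.coder]
    refine add_mem (compSub_mono C.X le_sup_left n a (hV n a y hy)) (add_mem ?_ ?_)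
    · exact compSub_mono C.X le_sup_left n a (compLeft_mem_compSub C.d _ (hV _ _ _ hz))
    · exact compInf_mem_compSub D.d le_sup_left
        (fun n a a' h x hx => Submodule.mem_sup_right (D.d_mem_dFam h hx)) _ (hV _ _ _ hz)
  d_mem n a a' h x hx := by
    obtain ⟨y, hy, z, hz, rfl⟩ := Submodule.mem_sup.1 (show x ∈ V n a ⊔ D.dFam V n a from hx)
    obtain ⟨z, hz, rfl⟩ := hz
    rw [map_add]
    refine add_mem (Submodule.mem_sup_right (D.d_mem_dFam h hy)) (Submodule.mem_sup_left ?_)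
    rw [D.d_sq n (a + 1) a a' _ h (by omega)]
    exact D.arityZero.leftUnitor_mem (compLeft_mem_compSub C.θ _ (hV _ _ _ hz))

/-- Over a conilpotent curved cooperad, every finitely generated family of subspaces of a coalgebra
lies in a finitely generated sub-coalgebra. -/
theorem exists_isSubCoalg (hC : C.IsConilpotent) {V : Sub D.X} (hV : FinGen V) :
    ∃ W : Sub D.X, FinGen W ∧ IsSubCoalg W ∧ V ≤ W := by
  obtain ⟨S, hS, rfl⟩ := hV
  obtain ⟨W, hW, hW', hSW⟩ := exists_finGen_of_finite (P := D.IsSubComod) D.isSubComod_bot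
    (fun _ _ => IsSubComod.sup) hS fun y _ => D.exists_subComod hC _ _ y.2.2
  exact ⟨W ⊔ D.dFam W, hW.sup (D.finGen_dFam hW), D.isSubCoalg_sup_dFam hW',
    hSW.trans le_sup_left⟩

end FiniteDimensional

end Coalg

namespace SMod

variable {K : Type u} [Field K]

/-! ### Colimits of graded modules -/

section Colimits

variable {J : Type u} [SmallCategory J]

/-- The morphisms `ι j : X j ⟶ L` exhibit `L` as the colimit, in each arity and degree, of the
diagram with objects `X j` and transition morphisms `m u`. The diagram is not bundled as a functor,
so that the objects `X j` can be the underlying modules of a diagram of coalgebras. -/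
structure IsColimitFamily (X : J → SMod K) (m : ∀ {j j' : J}, (j ⟶ j') → (X j ⟶ X j')) (L : SMod K)
    (ι : ∀ j, X j ⟶ L) : Prop where
  map_comp : ∀ {j j' j'' : J} (u : j ⟶ j') (v : j' ⟶ j''), m (u ≫ v) = m u ≫ m v
  w : ∀ {j j' : J} (u : j ⟶ j') (n : ℕ) (a : ℤ) (x : (X j).at' n a),
    appl (ι j') n a (appl (m u) n a x) = appl (ι j) n a x
  ext : ∀ {n : ℕ} {a : ℤ} {M : Type u} [AddCommGroup M] [Module K M] {f g : L.at' n a →ₗ[K] M},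
    (∀ j x, f (appl (ι j) n a x) = g (appl (ι j) n a x)) → ∀ x, f x = g x
  exists_desc : ∀ {n : ℕ} {a : ℤ} {M : Type u} [AddCommGroup M] [Module K M]
    (f : ∀ j, (X j).at' n a →ₗ[K] M),
    (∀ {j j' : J} (u : j ⟶ j') x, f j' (appl (m u) n a x) = f j x) →
    ∃ g : L.at' n a →ₗ[K] M, ∀ j x, g (appl (ι j) n a x) = f j x
  exists_rep : IsFiltered J → ∀ {n : ℕ} {a : ℤ} (x : L.at' n a), ∃ j y, appl (ι j) n a y = x
  exists_map_eq : IsFiltered J → ∀ {n : ℕ} {a : ℤ} {j : J} {x y : (X j).at' n a},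
    appl (ι j) n a x = appl (ι j) n a y →
    ∃ (j' : J) (u : j ⟶ j'), appl (m u) n a x = appl (m u) n a y

/-- The component of arity `n` and degree `a`, as a functor. -/
def evalFunctor (n : ℕ) (a : ℤ) : SMod K ⥤ ModuleCat.{u} K where
  obj V := V.at' n a
  map f := ModuleCat.ofHom (appl f n a)

/-- The action of a bijection, as a natural transformation. -/
def actNat {n n' : ℕ} (φ : Fin n ≃ Fin n') (a : ℤ) :
    evalFunctor (K := K) n' a ⟶ evalFunctor n a where
  app V := ModuleCat.ofHom (V.act φ a)
  naturality V W f := by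
    ext x
    exact (appl_act f φ a x).symm

variable (G : J ⥤ SMod K)

/-- The canonical maps to the components of the colimit. -/
def evalι (n : ℕ) (a : ℤ) (j : J) :
    (G.obj j).at' n a →ₗ[K] (colimit (G ⋙ evalFunctor n a) : ModuleCat K) :=
  (colimit.ι (G ⋙ evalFunctor n a) j).hom

lemma colimMap_evalι {n n' : ℕ} (φ : Fin n ≃ Fin n') (a : ℤ) (j : J) (x : (G.obj j).at' n' a) :
    (colimMap (Functor.whiskerLeft G (actNat φ a))).hom (evalι G n' a j x) =
      evalι G n a j ((G.obj j).act φ a x) :=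
  congrArg (fun f => f.hom x) (ι_colimMap (Functor.whiskerLeft G (actNat φ a)) j)

lemma colimit_evalFunctor_ext {n : ℕ} {a : ℤ} {M : Type u} [AddCommGroup M] [Module K M]
    {f g : (colimit (G ⋙ evalFunctor n a) : ModuleCat K) →ₗ[K] M}
    (h : ∀ j x, f (evalι G n a j x) = g (evalι G n a j x)) : f = g := by
  have : ModuleCat.ofHom f = ModuleCat.ofHom g := colimit.hom_ext fun j => by
    ext x
    exact h j x
  exact congrArg ModuleCat.Hom.hom this

/-- The colimit of a diagram of graded `𝕊`-modules, computed in each arity and degree. -/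
def colim : SMod K :=
  SMod.of (fun n a => (colimit (G ⋙ evalFunctor n a) : ModuleCat K))
    (fun φ a => (colimMap (Functor.whiskerLeft G (actNat φ a))).hom)
    (fun n a x => LinearMap.congr_fun (colimit_evalFunctor_ext G
      (f := (colimMap (Functor.whiskerLeft G (actNat (Equiv.refl (Fin n)) a))).hom)
      (g := LinearMap.id) fun j y => by
        rw [colimMap_evalι, act_refl]
        rfl) x)
    (fun {n n' n''} φ ψ a x => LinearMap.congr_fun (colimit_evalFunctor_ext G
      (f := (colimMap (Functor.whiskerLeft G (actNat (φ.trans ψ) a))).hom)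
      (g := (colimMap (Functor.whiskerLeft G (actNat φ a))).hom ∘ₗ
        (colimMap (Functor.whiskerLeft G (actNat ψ a))).hom) fun j y => by
        rw [colimMap_evalι, act_trans]
        refine Eq.trans ?_ (congrArg _ (colimMap_evalι G ψ a j y)).symm
        exact (colimMap_evalι G φ a j _).symm) x)

lemma isColimitFamily_colim : IsColimitFamily G.obj (fun u => G.map u) (colim G) (fun j =>
    homMk (fun n a => evalι G n a j) (fun φ a x => (colimMap_evalι G φ a j x).symm)) where
  map_comp u v := G.map_comp u v
  w u n a x := congrArg (fun f => f.hom x) (colimit.w (G ⋙ evalFunctor n a) u)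
  ext h x := LinearMap.congr_fun (colimit_evalFunctor_ext G h) x
  exists_desc {n a M _ _} f hf := by
    let c : Cocone (G ⋙ evalFunctor n a) :=
      { pt := ModuleCat.of K M
        ι :=
          { app := fun j => ModuleCat.ofHom (f j)
            naturality := fun _ _ u => by
              ext x
              exact hf u x } }
    exact ⟨(colimit.desc (G ⋙ evalFunctor n a) c).hom, fun j x =>
      congrArg (fun φ => φ.hom x) (colimit.ι_desc c j)⟩
  exists_rep _ {n a} x :=
    Concrete.isColimit_exists_rep (G ⋙ evalFunctor n a) (colimit.isColimit _) x
  exists_map_eq _ {n a j x y} h := by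
    obtain ⟨k, f, g, hfg⟩ := Concrete.isColimit_exists_of_rep_eq (G ⋙ evalFunctor n a)
      (colimit.isColimit _) x y h
    refine ⟨IsFiltered.coeq f g, f ≫ IsFiltered.coeqHom f g, ?_⟩
    have h1 := congrArg (appl (G.map (IsFiltered.coeqHom f g)) n a) hfg
    have h2 : ∀ (v : j ⟶ k) (z : (G.obj j).at' n a),
        appl (G.map (v ≫ IsFiltered.coeqHom f g)) n a z =
          appl (G.map (IsFiltered.coeqHom f g)) n a (appl (G.map v) n a z) := fun v z => by
      rw [G.map_comp, appl_comp]
    have h3 := h2 g y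
    rw [← IsFiltered.coeq_condition f g] at h3
    exact (h2 f x).trans (h1.trans h3.symm)

namespace IsColimitFamily

variable {X : J → SMod K} {m : ∀ {j j' : J}, (j ⟶ j') → (X j ⟶ X j')} {L : SMod K}
  {ι : ∀ j, X j ⟶ L} (hL : IsColimitFamily X m L ι)

include hL

lemma hom_ext {Y : SMod K} {f g : L ⟶ Y} (h : ∀ j, ι j ≫ f = ι j ≫ g) : f = g :=
  SMod.hom_ext fun n a x => hL.ext (f := appl f n a) (g := appl g n a)
    (fun j y => congrArg (fun φ => appl φ n a y) (h j)) x

lemma exists_descHom {Y : SMod K} (f : ∀ j, X j ⟶ Y)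
    (hf : ∀ {j j' : J} (u : j ⟶ j'), m u ≫ f j' = f j) :
    ∃ g : L ⟶ Y, ∀ j, ι j ≫ g = f j := by
  choose g hg using fun n a => hL.exists_desc (fun j => appl (f j) n a)
    (fun u x => congrArg (fun φ => appl φ n a x) (hf u))
  refine ⟨homMk g fun {n n'} φ a x => ?_, fun j => SMod.hom_ext fun n a x => hg n a j x⟩
  refine hL.ext (f := g n a ∘ₗ L.act φ a) (g := Y.act φ a ∘ₗ g n' a) (fun j y => ?_) x
  rw [LinearMap.comp_apply, LinearMap.comp_apply, ← appl_act, hg, hg, appl_act]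

lemma arityZero (h : ∀ j, ArityZero (X j)) : ArityZero L := fun n hn a => by
  have h0 : ∀ x : L.at' n a, x = 0 := fun x =>
    hL.ext (f := LinearMap.id) (g := 0) (fun j y => by
      have := h j n hn a
      rw [Subsingleton.elim y 0, map_zero, map_zero, map_zero]) x
  exact ⟨fun x y => by rw [h0 x, h0 y]⟩

end IsColimitFamily

end Colimits

end SMod

namespace Coalg

variable {K : Type u} [Field K] {C : CurvedCooperad K}

/-! ### Colimits of coalgebras -/

section Colimits

variable (C) in
/-- The underlying graded module. -/
def forget : Coalg C ⥤ SMod K where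
  obj D := D.X
  map φ := φ.f

variable {J : Type u} [SmallCategory J] (F : J ⥤ Coalg C)

/-- Any diagram of coalgebras has a colimit, and its underlying graded module is the colimit of the
underlying graded modules. -/
theorem exists_isColimit : ∃ c : Cocone F, Nonempty (IsColimit c) ∧
    IsColimitFamily (fun j => (F.obj j).X) (fun u => Hom.f (F.map u)) c.pt.X
      (fun j => Hom.f (c.ι.app j)) := by
  obtain ⟨L, ι, hL⟩ : ∃ (L : SMod K) (ι : ∀ j, (F.obj j).X ⟶ L),
      IsColimitFamily (fun j => (F.obj j).X) (fun u => Hom.f (F.map u)) L ι :=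
    ⟨_, _, isColimitFamily_colim (F ⋙ forget C)⟩
  have hw : ∀ {j j' : J} (u : j ⟶ j'), Hom.f (F.map u) ≫ ι j' = ι j := fun u =>
    SMod.hom_ext fun n a x => hL.w u n a x
  have hL0 : ArityZero L := hL.arityZero fun j => (F.obj j).arityZero
  obtain ⟨Δ, hΔ⟩ := hL.exists_descHom (fun j => (F.obj j).Δ ≫ compMap (𝟙 C.X) (ι j)) (fun u => by
    rw [← reassoc_of% (Hom.comul (F.map u)), ← compMap_comp_right, hw])
  choose d hd using fun (n : ℕ) (a a' : ℤ) (h : a + (-1) = a') =>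
    hL.exists_desc (fun j => appl (ι j) n a' ∘ₗ (F.obj j).d.app n a a' h) (fun u x => by
      rw [LinearMap.comp_apply, LinearMap.comp_apply, ← Hom.comm_d (F.map u), hL.w])
  let dL : DegMap (-1) L L :=
    { app := d
      comm := fun φ a a' h x => hL0.map_act (fun n => d n a a' h) φ x }
  have hd' : ∀ j (n : ℕ) (a a' : ℤ) (h : a + (-1) = a') (x : (F.obj j).X.at' n a),
      appl (ι j) n a' ((F.obj j).d.app n a a' h x) = dL.app n a a' h (appl (ι j) n a x) :=
    fun j n a a' h x => (hd n a a' h j x).symm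
  have hΔ' : ∀ j n a y, appl Δ n a (appl (ι j) n a y) =
      appl (compMap (𝟙 C.X) (ι j)) n a (appl (F.obj j).Δ n a y) := fun j n a y =>
    congrArg (fun φ => appl φ n a y) (hΔ j)
  let E : Coalg C :=
    { X := L
      arity_zero := hL0
      Δ := Δ
      coassoc := hL.hom_ext fun j => by
        rw [← coassoc_left_naturality (hΔ j).symm, ← coassoc_right_naturality (hΔ j).symm,
          (F.obj j).coassoc]
      counit := hL.hom_ext fun j => by
        rw [← counit_naturality (hΔ j).symm, (F.obj j).counit, Category.comp_id, Category.id_comp]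
      d := dL
      coder := fun n a a' h x => hL.ext (f := appl Δ n a' ∘ₗ dL.app n a a' h)
        (g := (compLeft C.d L).app n a a' h ∘ₗ appl Δ n a +
          (compInf C.X (𝟙 L) dL).app n a a' h ∘ₗ appl Δ n a)
        (fun j y => by
          rw [LinearMap.add_apply, LinearMap.comp_apply, LinearMap.comp_apply,
            LinearMap.comp_apply, hΔ', ← compLeft_naturality,
            ← compInf_naturality C.X (ι j) (F.obj j).d dL (hd' j), ← map_add, ← (F.obj j).coder,
            ← hd', hΔ']) x
      d_sq := fun n a a' a'' h h' h'' x => hL.ext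
        (f := dL.app n a' a'' h' ∘ₗ dL.app n a a' h)
        (g := appl (leftUnitor L) n a'' ∘ₗ (compLeft C.θ L).app n a a'' h'' ∘ₗ appl Δ n a)
        (fun j y => by
          rw [LinearMap.comp_apply, LinearMap.comp_apply, LinearMap.comp_apply, hΔ',
            ← compLeft_naturality, ← appl_comp, leftUnitor_naturality, appl_comp,
            ← (F.obj j).d_sq n a a' a'' h h' h'', hd', hd']) x }
  let c : Cocone F :=
    { pt := E
      ι :=
        { app := fun j => { f := ι j, comul := (hΔ j).symm, comm_d := hd' j }
          naturality := fun j j' u => Hom.ext ((hw u).trans (Category.comp_id _).symm) } }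
  have hdesc : ∀ s : Cocone F, ∃ g : E ⟶ s.pt, ∀ j, ι j ≫ Hom.f g = Hom.f (s.ι.app j) := by
    intro s
    obtain ⟨g, hg⟩ := hL.exists_descHom (fun j => Hom.f (s.ι.app j))
      (fun u => congrArg Hom.f (s.w u))
    refine ⟨{ f := g, comul := ?_, comm_d := ?_ }, hg⟩
    · refine hL.hom_ext fun j => ?_
      have h3 : (F.obj j).Δ ≫ compMap (𝟙 C.X) (Hom.f (s.ι.app j)) = Hom.f (s.ι.app j) ≫ s.pt.Δ :=
        Hom.comul (s.ι.app j)
      have h4 : ι j ≫ E.Δ = (F.obj j).Δ ≫ compMap (𝟙 C.X) (ι j) := hΔ j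
      rw [reassoc_of% h4, ← compMap_comp_right, hg, h3, reassoc_of% (hg j)]
    · intro n a a' h x
      refine hL.ext (f := appl g n a' ∘ₗ dL.app n a a' h) (g := s.pt.d.app n a a' h ∘ₗ appl g n a)
        (fun j y => ?_) x
      have h1 : ∀ n a y, appl g n a (appl (ι j) n a y) = appl (Hom.f (s.ι.app j)) n a y :=
        fun n a y => congrArg (fun φ => appl φ n a y) (hg j)
      rw [LinearMap.comp_apply, LinearMap.comp_apply, ← hd', h1, h1]
      exact Hom.comm_d (s.ι.app j) n a a' h y
  choose desc hdesc using hdesc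
  exact ⟨c, ⟨{
    desc := desc
    fac := fun s j => Hom.ext (hdesc s j)
    uniq := fun s g hg => Hom.ext (hL.hom_ext fun j =>
      (congrArg Hom.f (hg j)).trans (hdesc s j).symm) }⟩, hL⟩

instance : HasColimitsOfSize.{u, u} (Coalg C) where
  has_colimits_of_shape _ _ := ⟨fun F => by
    obtain ⟨c, ⟨hc⟩, -⟩ := exists_isColimit F
    exact ⟨⟨c, hc⟩⟩⟩

end Colimits

end Coalg

namespace SMod

variable {K : Type u} [Field K]

/-! ### Finitely generated graded modules and filtered colimits -/

section Filtered

variable {J : Type u} [SmallCategory J] [IsFiltered J]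

/-- In a filtered category, finitely many conditions which are all met eventually are met
simultaneously. -/
lemma FinGen.exists_le {Y : SMod K} {V : Sub Y} (hV : FinGen V) {i : J}
    (P : ∀ j, (i ⟶ j) → Sub Y) (hP : ∀ {j j' : J} (u : i ⟶ j) (v : j ⟶ j'), P j u ≤ P j' (u ≫ v))
    (h : ∀ n a, ∀ x ∈ V n a, ∃ (j : J) (u : i ⟶ j), x ∈ P j u n a) :
    ∃ (j : J) (u : i ⟶ j), V ≤ P j u := by
  obtain ⟨S, hS, rfl⟩ := hV
  induction S, hS using Set.Finite.induction_on with
  | empty => exact ⟨i, 𝟙 i, spanFam_le.2 fun x hx => hx.elim⟩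
  | @insert x S _ _ ih =>
    obtain ⟨j, u, hu⟩ := ih fun n a y hy =>
      h n a y (spanFam_le.2 (fun z hz => mem_spanFam (Set.mem_insert_of_mem _ hz)) n a hy)
    obtain ⟨j', u', hu'⟩ := h _ _ x.2.2 (mem_spanFam (Set.mem_insert x S))
    obtain ⟨k, v, v', hk⟩ := IsFiltered.span u u'
    refine ⟨k, u ≫ v, spanFam_le.2 fun z hz => ?_⟩
    rcases hz with rfl | hz
    · rw [hk]
      exact hP u' v' _ _ hu'
    · exact hP u v _ _ (hu _ _ (mem_spanFam hz))

namespace IsColimitFamily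

variable {X : J → SMod K} {m : ∀ {j j' : J}, (j ⟶ j') → (X j ⟶ X j')} {L : SMod K}
  {ι : ∀ j, X j ⟶ L} (hL : IsColimitFamily X m L ι)

include hL

/-- A morphism from a finitely generated graded module to a filtered colimit factors through some
stage. The factorization is the composite with a weak inverse of the map from a stage whose image
contains the generators. -/
lemma exists_lift (hX : ∀ j, ArityZero (X j)) {Y : SMod K} (hY : FinGen (⊤ : Sub Y)) (f : Y ⟶ L) :
    ∃ (j : J) (g : Y ⟶ X j), g ≫ ι j = f := by
  obtain ⟨i⟩ : Nonempty J := IsFiltered.nonempty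
  obtain ⟨j, -, hj⟩ := hY.exists_le (i := i)
    (fun j _ n a => (LinearMap.range (appl (ι j) n a)).comap (appl f n a))
    (fun u v n a x ⟨y, hy⟩ => ⟨appl (m v) n a y, (hL.w v n a y).trans hy⟩)
    (fun n a x _ => by
      obtain ⟨j, y, hy⟩ := hL.exists_rep ‹_› (appl f n a x)
      exact ⟨IsFiltered.max i j, IsFiltered.leftToMax i j, appl (m (IsFiltered.rightToMax i j)) n a y,
        (hL.w _ n a y).trans hy⟩)
  obtain ⟨k, hk⟩ := exists_weakInverse_hom (hX j) (ι j)
  refine ⟨j, f ≫ k, SMod.hom_ext fun n a x => ?_⟩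
  obtain ⟨y, hy⟩ := hj n a (Submodule.mem_top : x ∈ (⊤ : Sub Y) n a)
  rw [appl_comp, appl_comp, ← hy, hk]

/-- Two morphisms to a stage of a filtered diagram which agree in the colimit on a finitely generated
family agree on it at a later stage. -/
lemma exists_map_eq_of_finGen {i : J} {Y : SMod K} {V : Sub Y} (hV : FinGen V) (f g : Y ⟶ X i)
    (h : ∀ n a, ∀ x ∈ V n a, appl (ι i) n a (appl f n a x) = appl (ι i) n a (appl g n a x)) :
    ∃ (j : J) (u : i ⟶ j), V ≤ eqFam (f ≫ m u) (g ≫ m u) :=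
  hV.exists_le (fun j u => eqFam (f ≫ m u) (g ≫ m u))
    (fun u v n a x hx => by
      rw [mem_eqFam] at hx ⊢
      rw [hL.map_comp, ← Category.assoc, ← Category.assoc, appl_comp, hx, ← appl_comp])
    (fun n a x hx => hL.exists_map_eq ‹_› (h n a x hx))

/-- The functor `C ∘ -` preserves the vanishing of elements at a later stage of a filtered diagram:
an element `z` of `C ∘ X i` involves finitely many elements of `X i`. On these, for a weak inverse
`k` of `ι i`, the endomorphism `k ι` agrees with the identity at a later stage, so that the image
of `z` at this stage depends on its image in the colimit only. -/
lemma exists_compMap_eq_zero (hX : ∀ j, ArityZero (X j)) {C : SMod K} {i : J} {n : ℕ} {a : ℤ}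
    (z : (comp C (X i)).at' n a) (hz : appl (compMap (𝟙 C) (ι i)) n a z = 0) :
    ∃ (j : J) (u : i ⟶ j), appl (compMap (𝟙 C) (m u)) n a z = 0 := by
  obtain ⟨k, hk⟩ := exists_weakInverse_hom (hX i) (ι i)
  obtain ⟨S, hS, -, hzS⟩ := exists_finite_mem_compSub (mem_compSub_top z)
  obtain ⟨j, u, hu⟩ := hL.exists_map_eq_of_finGen ⟨S, hS, rfl⟩ (𝟙 (X i)) (ι i ≫ k)
    (fun n a x _ => (hk n a x).symm)
  refine ⟨j, u, ?_⟩
  have h1 := compMap_congr_of_mem_compSub hu hzS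
  rwa [Category.id_comp, Category.assoc, compMap_comp_right, appl_comp, hz, map_zero] at h1

lemma exists_comp_compMap_eq (hX : ∀ j, ArityZero (X j)) {C : SMod K} {i : J} {Y : SMod K}
    (hY : FinGen (⊤ : Sub Y)) (f g : Y ⟶ comp C (X i))
    (h : f ≫ compMap (𝟙 C) (ι i) = g ≫ compMap (𝟙 C) (ι i)) :
    ∃ (j : J) (u : i ⟶ j), f ≫ compMap (𝟙 C) (m u) = g ≫ compMap (𝟙 C) (m u) := by
  obtain ⟨j, u, hu⟩ := hY.exists_le
    (fun j u => eqFam (f ≫ compMap (𝟙 C) (m u)) (g ≫ compMap (𝟙 C) (m u)))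
    (fun u v n a x hx => by
      rw [mem_eqFam] at hx ⊢
      rw [hL.map_comp, compMap_comp_right, ← Category.assoc, ← Category.assoc, appl_comp, hx,
        ← appl_comp])
    (fun n a x _ => by
      obtain ⟨j, u, hu⟩ := hL.exists_compMap_eq_zero hX (appl f n a x - appl g n a x) (by
        rw [map_sub, sub_eq_zero]
        exact congrArg (fun φ => appl φ n a x) h)
      rw [map_sub, sub_eq_zero] at hu
      exact ⟨j, u, hu⟩)
  exact ⟨j, u, SMod.hom_ext fun n a x => hu n a Submodule.mem_top⟩

end IsColimitFamily

end Filtered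

end SMod

namespace Coalg

variable {K : Type u} [Field K] {C : CurvedCooperad K}

/-! ### Compactness of finite-dimensional coalgebras -/

section Compact

variable {J : Type u} [SmallCategory J] [IsFiltered J] {F : J ⥤ Coalg C} {c : Cocone F}
  (hc : IsColimitFamily (fun j => (F.obj j).X) (fun u => Hom.f (F.map u)) c.pt.X
    (fun j => Hom.f (c.ι.app j)))

include hc

/-- A morphism from a finite-dimensional coalgebra to a filtered colimit lifts to a morphism of
comodules to some stage. -/
lemma exists_comul_lift {E : Coalg C} (hE : FinGen (⊤ : Sub E.X)) (f : E ⟶ c.pt) :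
    ∃ (j : J) (g : E.X ⟶ (F.obj j).X), g ≫ Hom.f (c.ι.app j) = Hom.f f ∧
      E.Δ ≫ compMap (𝟙 C.X) g = g ≫ (F.obj j).Δ := by
  have hX := fun j => (F.obj j).arityZero
  obtain ⟨i, g, hg⟩ := hc.exists_lift hX hE (Hom.f f)
  obtain ⟨j, u, hu⟩ := hc.exists_comp_compMap_eq hX hE (E.Δ ≫ compMap (𝟙 C.X) g)
    (g ≫ (F.obj i).Δ) (by
      have h1 : (F.obj i).Δ ≫ compMap (𝟙 C.X) (Hom.f (c.ι.app i)) = Hom.f (c.ι.app i) ≫ c.pt.Δ :=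
        Hom.comul (c.ι.app i)
      have h2 : E.Δ ≫ compMap (𝟙 C.X) (Hom.f f) = Hom.f f ≫ c.pt.Δ := Hom.comul f
      rw [Category.assoc, Category.assoc, ← compMap_comp_right, hg, h1, reassoc_of% hg, h2])
  have h1 : (F.obj i).Δ ≫ compMap (𝟙 C.X) (Hom.f (F.map u)) = Hom.f (F.map u) ≫ (F.obj j).Δ :=
    Hom.comul (F.map u)
  have h2 : Hom.f (F.map u) ≫ Hom.f (c.ι.app j) = Hom.f (c.ι.app i) := congrArg Hom.f (c.w u)
  refine ⟨j, g ≫ Hom.f (F.map u), ?_, ?_⟩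
  · rw [Category.assoc, h2, hg]
  · rw [Category.assoc, Category.assoc, h1] at hu
    rw [Category.assoc, compMap_comp_right, hu]

lemma exists_factor {E : Coalg C} (hE : FinGen (⊤ : Sub E.X)) (f : E ⟶ c.pt) :
    ∃ (j : J) (g : E ⟶ F.obj j), g ≫ c.ι.app j = f := by
  obtain ⟨i, g, hg, hΔ⟩ := exists_comul_lift hc hE f
  have hg' : ∀ n a x, appl (Hom.f (c.ι.app i)) n a (appl g n a x) = appl (Hom.f f) n a x :=
    fun n a x => congrArg (fun φ => appl φ n a x) hg
  have hF : ∀ {j k : J} (v : i ⟶ j) (w : j ⟶ k) n a y, appl (Hom.f (F.map (v ≫ w))) n a y =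
      appl (Hom.f (F.map w)) n a (appl (Hom.f (F.map v)) n a y) := fun v w n a y => by
    rw [F.map_comp]
    rfl
  -- the lift `g` commutes with the coderivations at a later stage
  obtain ⟨j, v, hv⟩ := hE.exists_le (i := i)
    (fun j v n a => LinearMap.eqLocus
      (appl (Hom.f (F.map v)) n (a + -1) ∘ₗ appl g n (a + -1) ∘ₗ E.d.app n a _ rfl)
      ((F.obj j).d.app n a _ rfl ∘ₗ appl (Hom.f (F.map v)) n a ∘ₗ appl g n a))
    (fun {j k} v w n a x hx => by
      have h1 : appl (Hom.f (F.map v)) n (a + -1) (appl g n (a + -1) (E.d.app n a _ rfl x)) =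
        (F.obj j).d.app n a _ rfl (appl (Hom.f (F.map v)) n a (appl g n a x)) := hx
      have h2 : appl (Hom.f (F.map (v ≫ w))) n (a + -1) (appl g n (a + -1) (E.d.app n a _ rfl x)) =
          (F.obj k).d.app n a _ rfl (appl (Hom.f (F.map (v ≫ w))) n a (appl g n a x)) := by
        rw [hF, hF, h1, Hom.comm_d (F.map w)]
      exact h2)
    (fun n a x _ => by
      obtain ⟨j, v, hv⟩ := hc.exists_map_eq ‹_› (x := appl g n (a + -1) (E.d.app n a _ rfl x))
        (y := (F.obj i).d.app n a _ rfl (appl g n a x)) (by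
          rw [Hom.comm_d (c.ι.app i), hg', hg', Hom.comm_d f]
          rfl)
      rw [Hom.comm_d (F.map v)] at hv
      exact ⟨j, v, hv⟩)
  have h1 : (F.obj i).Δ ≫ compMap (𝟙 C.X) (Hom.f (F.map v)) = Hom.f (F.map v) ≫ (F.obj j).Δ :=
    Hom.comul (F.map v)
  have h2 : Hom.f (F.map v) ≫ Hom.f (c.ι.app j) = Hom.f (c.ι.app i) := congrArg Hom.f (c.w v)
  refine ⟨j, { f := g ≫ Hom.f (F.map v), comul := ?_, comm_d := ?_ }, Hom.ext ?_⟩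
  · rw [compMap_comp_right, reassoc_of% hΔ, h1, Category.assoc]
  · rintro n a _ rfl x
    exact hv n a (Submodule.mem_top : x ∈ (⊤ : Sub E.X) n a)
  · exact (Category.assoc _ _ _).trans ((congrArg (g ≫ ·) h2).trans hg)

lemma exists_map_eq_of_comp_eq {E : Coalg C} (hE : FinGen (⊤ : Sub E.X)) {i : J}
    (f g : E ⟶ F.obj i) (h : f ≫ c.ι.app i = g ≫ c.ι.app i) :
    ∃ (j : J) (u : i ⟶ j), f ≫ F.map u = g ≫ F.map u := by
  obtain ⟨j, u, hu⟩ := hc.exists_map_eq_of_finGen hE (Hom.f f) (Hom.f g)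
    (fun n a x _ => congrArg (fun φ => appl (Hom.f φ) n a x) h)
  exact ⟨j, u, Hom.ext (SMod.hom_ext fun n a x => hu n a Submodule.mem_top)⟩

end Compact

lemma finGen_top_iff (D : Coalg C) : FinGen (⊤ : Sub D.X) ↔ D.IsFiniteDimensional := by
  classical
  constructor
  · rintro ⟨S, hS, hS'⟩
    -- the components of non-zero arity vanish
    let g : El D.X → ⨁ a : ℤ, D.X.at' 0 a
      | ⟨0, a, x⟩ => DirectSum.lof K ℤ (fun a => D.X.at' 0 a) a x
      | ⟨_ + 1, _, _⟩ => 0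
    let N := Submodule.span K (g '' S)
    let V : Sub D.X
      | 0, a => N.comap (DirectSum.lof K ℤ (fun a => D.X.at' 0 a) a)
      | _ + 1, _ => ⊤
    have hV : ⊤ ≤ V := by
      rw [← hS', spanFam_le]
      rintro ⟨_ | n, a, x⟩ hx
      · exact Submodule.subset_span ⟨_, hx, rfl⟩
      · exact Submodule.mem_top
    refine Module.finite_def.2 ?_
    have h : N = ⊤ := by
      refine top_le_iff.1 fun x _ => ?_
      induction x using DirectSum.induction_on with
      | zero => exact zero_mem _
      | of a x => exact hV 0 a (Submodule.mem_top : x ∈ (⊤ : Sub D.X) 0 a)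
      | add x y hx hy => exact add_mem (hx Submodule.mem_top) (hy Submodule.mem_top)
    rw [← h]
    exact Submodule.fg_span (hS.image g)
  · intro h
    obtain ⟨S, hS⟩ := Module.finite_def.1 h
    let T : Set (El D.X) := ⋃ x ∈ S, (fun a => ⟨0, a, x a⟩) '' (DFinsupp.support x : Set ℤ)
    have hT : T.Finite :=
      S.finite_toSet.biUnion fun x _ => (DFinsupp.support x).finite_toSet.image _
    refine ⟨T, hT, top_le_iff.1 fun n a x _ => ?_⟩
    by_cases hn : n = 0
    · subst hn
      have h1 : ∀ z, DirectSum.component K ℤ (fun a => D.X.at' 0 a) a z ∈ spanFam T 0 a := fun z => by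
        have hz : z ∈ Submodule.span K (S : Set (⨁ a : ℤ, D.X.at' 0 a)) := hS ▸ Submodule.mem_top
        refine (Submodule.span_le (p := (spanFam T 0 a).comap
          (DirectSum.component K ℤ (fun a => D.X.at' 0 a) a))).2 (fun y hy => ?_) hz
        by_cases hy0 : y a = 0
        · exact (hy0 ▸ zero_mem _ : y a ∈ spanFam T 0 a)
        · exact mem_spanFam (Set.mem_biUnion hy ⟨a, DFinsupp.mem_support_iff.2 hy0, rfl⟩)
      have h2 := h1 (DirectSum.lof K ℤ (fun a => D.X.at' 0 a) a x)
      rwa [DirectSum.component.lof_self] at h2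
    · have := D.arity_zero n hn a
      rw [Subsingleton.elim x 0]
      exact zero_mem _

theorem IsFiniteDimensional.isFinitelyPresentable {E : Coalg C} (hE : E.IsFiniteDimensional) :
    IsFinitelyPresentable.{u} E := by
  rw [isFinitelyPresentable_iff_preservesFilteredColimitsOfSize]
  refine ⟨fun J _ _ => ⟨fun {F} => ?_⟩⟩
  rw [← finGen_top_iff] at hE
  obtain ⟨c, ⟨hc⟩, hF⟩ := exists_isColimit F
  refine preservesColimit_of_preserves_colimit_cocone hc
    (Types.FilteredColimit.isColimitOf' _ _ (fun f => ?_) (fun i f g h => ?_))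
  · obtain ⟨j, g, hg⟩ := exists_factor hF hE f
    exact ⟨j, g, hg.symm⟩
  · exact exists_map_eq_of_comp_eq hF hE f g h

/-! ### The diagram of finite-dimensional sub-coalgebras -/

section FinSub

variable {D : Coalg C}

/-- A morphism whose image is contained in a sub-coalgebra factors through it. -/
lemma exists_lift_of_range_le {E E' : Coalg C} (φ : E' ⟶ D)
    (hφ : ∀ n a, Function.Injective (appl (Hom.f φ) n a)) (ψ : E ⟶ D)
    (h : ∀ n a, LinearMap.range (appl (Hom.f ψ) n a) ≤ LinearMap.range (appl (Hom.f φ) n a)) :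
    ∃ χ : E ⟶ E', χ ≫ φ = ψ := by
  obtain ⟨r, hr⟩ := exists_retraction E'.arityZero (Hom.f φ) hφ
  have hr' : ∀ n a y, appl r n a (appl (Hom.f φ) n a y) = y := fun n a y =>
    congrArg (fun f => appl f n a y) hr
  have hχ : (Hom.f ψ ≫ r) ≫ Hom.f φ = Hom.f ψ := SMod.hom_ext fun n a x => by
    obtain ⟨y, hy⟩ := h n a ⟨x, rfl⟩
    rw [appl_comp, appl_comp, ← hy, hr']
  have hχ' : ∀ n a x, appl (Hom.f φ) n a (appl (Hom.f ψ ≫ r) n a x) = appl (Hom.f ψ) n a x :=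
    fun n a x => congrArg (fun f => appl f n a x) hχ
  refine ⟨{ f := Hom.f ψ ≫ r, comul := ?_, comm_d := fun n a a' h x => ?_ }, Hom.ext hχ⟩
  · refine compMap_mono_of_retract hr ?_
    rw [Category.assoc, ← compMap_comp_right, hχ, Hom.comul ψ, Category.assoc, Hom.comul φ,
      ← Category.assoc, hχ]
  · refine hφ n a' ?_
    rw [hχ', Hom.comm_d ψ, Hom.comm_d φ, hχ']

/-- The image of a finite-dimensional sub-coalgebra. -/
def FinSub.range (E : FinSub D) : Sub D.X := fun n a =>
  LinearMap.range (appl (Hom.f E.obj.hom) n a)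

lemma FinSub.finGen_range (E : FinSub D) : FinGen (FinSub.range E) := by
  have h := FinGen.map (Hom.f E.obj.hom) ((finGen_top_iff E.obj.left).2 E.property.2)
  convert h using 3
  exact LinearMap.range_eq_map _

lemma FinSub.exists_hom {E E' : FinSub D} (h : FinSub.range E ≤ FinSub.range E') :
    Nonempty (E ⟶ E') := by
  obtain ⟨χ, hχ⟩ := exists_lift_of_range_le E'.obj.hom E'.property.1 E.obj.hom h
  exact ⟨ObjectProperty.homMk (Over.homMk χ hχ)⟩

/-- The category of finite-dimensional sub-coalgebras is a preorder. -/
lemma FinSub.hom_eq {E E' : FinSub D} (u v : E ⟶ E') : u = v := by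
  refine ObjectProperty.hom_ext _ (Over.OverMorphism.ext (Hom.ext (SMod.hom_ext fun n a x =>
    E'.property.1 n a ?_)))
  have hu := congrArg (fun f => appl (Hom.f f) n a x) (Over.w u.hom)
  have hv := congrArg (fun f => appl (Hom.f f) n a x) (Over.w v.hom)
  exact hu.trans hv.symm

/-- Finite-dimensional graded subspaces are contained in finite-dimensional sub-coalgebras. -/
lemma FinSub.exists_le_range (hC : C.IsConilpotent) {V : Sub D.X} (hV : FinGen V) :
    ∃ E : FinSub D, V ≤ FinSub.range E := by
  obtain ⟨W, hW, hW', hVW⟩ := D.exists_isSubCoalg hC hV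
  obtain ⟨E, φ, hφ, hφW⟩ := hW'.exists_hom
  obtain ⟨r, hr⟩ := exists_retraction E.arityZero (Hom.f φ) hφ
  have hE : FinGen (⊤ : Sub E.X) := by
    convert FinGen.map r hW using 3 with n a
    refine (top_le_iff.1 fun x _ => ⟨appl (Hom.f φ) n a x, ?_, ?_⟩).symm
    · exact hφW n a ▸ ⟨x, rfl⟩
    · exact congrArg (fun f => appl f n a x) hr
  refine ⟨⟨Over.mk φ, hφ, (finGen_top_iff E).1 hE⟩, fun n a x hx => ?_⟩
  have h : x ∈ LinearMap.range (appl (Hom.f φ) n a) := by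
    rw [hφW n a]
    exact hVW n a hx
  exact h

lemma FinSub.isFiltered (hC : C.IsConilpotent) (D : Coalg C) : IsFiltered (FinSub D) where
  cocone_objs E E' := by
    obtain ⟨E'', h⟩ := FinSub.exists_le_range hC (E.finGen_range.sup E'.finGen_range)
    obtain ⟨u⟩ := FinSub.exists_hom (le_sup_left.trans h)
    obtain ⟨u'⟩ := FinSub.exists_hom (le_sup_right.trans h)
    exact ⟨E'', u, u', trivial⟩
  cocone_maps _ E' u v := ⟨E', 𝟙 E', by rw [FinSub.hom_eq u v]⟩
  nonempty := by
    obtain ⟨E, -⟩ := FinSub.exists_le_range hC (D := D) ⟨∅, Set.finite_empty, rfl⟩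
    exact ⟨E⟩

lemma FinSub.exists_mem_range (hC : C.IsConilpotent) {n : ℕ} {a : ℤ} (x : D.X.at' n a) :
    ∃ (E : FinSub D) (y : E.obj.left.X.at' n a), appl (Hom.f E.obj.hom) n a y = x := by
  obtain ⟨E, h⟩ := FinSub.exists_le_range hC (finGen_span_singleton x)
  exact ⟨E, h n a (mem_spanFam rfl)⟩

lemma FinSub.hom_ext (hC : C.IsConilpotent) {Y : SMod K} {f g : D.X ⟶ Y}
    (h : ∀ E : FinSub D, Hom.f E.obj.hom ≫ f = Hom.f E.obj.hom ≫ g) : f = g :=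
  SMod.hom_ext fun n a x => by
    obtain ⟨E, y, rfl⟩ := FinSub.exists_mem_range hC x
    exact congrArg (fun φ => appl φ n a y) (h E)

lemma FinSub.exists_desc (hC : C.IsConilpotent) {T : Coalg C} (σ : ∀ E : FinSub D, E.obj.left ⟶ T)
    (hσ : ∀ {E E' : FinSub D} (u : E ⟶ E'), u.hom.left ≫ σ E' = σ E) :
    ∃ g : D ⟶ T, ∀ E : FinSub D, E.obj.hom ≫ g = σ E := by
  have := FinSub.isFiltered hC D
  have hs : ∀ {E E' : FinSub D} (u : E ⟶ E') n a y,
      appl (Hom.f (σ E')) n a (appl (Hom.f u.hom.left) n a y) =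
        appl (Hom.f (σ E)) n a y :=
    fun u n a y => congrArg (fun f => appl (Hom.f f) n a y) (hσ u)
  have hw : ∀ {E E' : FinSub D} (u : E ⟶ E') n a y,
      appl (Hom.f E'.obj.hom) n a (appl (Hom.f u.hom.left) n a y) =
        appl (Hom.f E.obj.hom) n a y :=
    fun u n a y => congrArg (fun f => appl (Hom.f f) n a y) (Over.w u.hom)
  -- the image of an element of `D` does not depend on the sub-coalgebra in which it is computed
  have hrel : ∀ {n a} {E E' : FinSub D} {y : E.obj.left.X.at' n a} {y' : E'.obj.left.X.at' n a},
      appl (Hom.f E.obj.hom) n a y = appl (Hom.f E'.obj.hom) n a y' →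
      appl (Hom.f (σ E)) n a y = appl (Hom.f (σ E')) n a y' := by
    intro n a E E' y y' h
    rw [← hs (IsFiltered.leftToMax E E'), ← hs (IsFiltered.rightToMax E E')]
    congr 1
    refine (IsFiltered.max E E').property.1 n a ?_
    rw [hw, hw, h]
  choose E y hy using fun (n : ℕ) (a : ℤ) (x : D.X.at' n a) => FinSub.exists_mem_range hC x
  let g : D.X ⟶ T.X := homOfArityZero T.arityZero fun n a =>
    { toFun := fun x => appl (Hom.f (σ (E n a x))) n a (y n a x)
      map_add' := fun x x' => by
        rw [← hs (IsFiltered.leftToMax (E n a x) (E n a x')),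
          ← hs (IsFiltered.rightToMax (E n a x) (E n a x')), ← map_add]
        refine hrel ?_
        rw [map_add, hw, hw, hy, hy, hy]
      map_smul' := fun t x => by
        rw [RingHom.id_apply, ← map_smul]
        refine hrel ?_
        rw [map_smul, hy, hy] }
  have hg : ∀ E : FinSub D, Hom.f E.obj.hom ≫ g = Hom.f (σ E) := fun E =>
    SMod.hom_ext fun n a z => hrel (hy n a _)
  refine ⟨{ f := g, comul := FinSub.hom_ext hC fun E => ?_, comm_d := fun n a a' h x => ?_ },
    fun E => Hom.ext (hg E)⟩
  · have h1 : E.obj.left.Δ ≫ compMap (𝟙 C.X) (Hom.f E.obj.hom) = Hom.f E.obj.hom ≫ D.Δ :=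
      Hom.comul E.obj.hom
    have h2 : E.obj.left.Δ ≫ compMap (𝟙 C.X) (Hom.f (σ E)) =
      Hom.f (σ E) ≫ T.Δ := Hom.comul (σ E)
    rw [← reassoc_of% h1, ← compMap_comp_right, hg, h2, reassoc_of% (hg E)]
  · obtain ⟨E, z, rfl⟩ := FinSub.exists_mem_range hC x
    have h1 : ∀ b z, appl g n b (appl (Hom.f E.obj.hom) n b z) =
      appl (Hom.f (σ E)) n b z := fun b z => congrArg (fun f => appl f n b z) (hg E)
    have h2 : appl (Hom.f E.obj.hom) n a' (E.obj.left.d.app n a a' h z) =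
      D.d.app n a a' h (appl (Hom.f E.obj.hom) n a z) := Hom.comm_d E.obj.hom n a a' h z
    rw [← h2, h1, h1]
    exact Hom.comm_d (σ E) n a a' h z

theorem FinSub.nonempty_isColimit (hC : C.IsConilpotent) (D : Coalg C) :
    Nonempty (IsColimit (FinSub.cocone D)) := by
  choose desc hdesc using fun s : Cocone (FinSub.diagram D) =>
    FinSub.exists_desc hC (fun E => s.ι.app E) (fun u => s.w u)
  exact ⟨{
    desc := desc
    fac := hdesc
    uniq := fun s g hg => Hom.ext (FinSub.hom_ext hC fun E =>
      congrArg Hom.f ((hg E).trans (hdesc s E).symm)) }⟩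

end FinSub

end Coalg

namespace SMod

variable {K : Type u} [Field K]

/-! ### Essential smallness -/

/-- The graded vector space `K ^ r a` in degree `a`, in arity `0`. The factor `PLift (n = 0)` of the
index set makes the components of non-zero arity vanish. -/
def std (K : Type u) [Field K] (r : ℤ → ℕ) : SMod K :=
  SMod.of (fun n a => PLift (n = 0) × Fin (r a) → K)
    (fun φ _ => LinearMap.funLeft K K
      (Prod.map (fun h => ⟨(Fin.equiv_iff_eq.1 ⟨φ⟩).symm.trans h.down⟩) id))
    (fun _ _ _ => rfl) (fun _ _ _ _ => rfl)

lemma std_arityZero (r : ℤ → ℕ) : ArityZero (std K r) := fun n hn a => by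
  have : IsEmpty (PLift (n = 0)) := ⟨fun h => hn h.down⟩
  exact (inferInstance : Subsingleton (PLift (n = 0) × Fin (r a) → K))

lemma ArityZero.exists_std {X : SMod K} (hX : ArityZero X)
    (hfin : ∀ a, Module.Finite K (X.at' 0 a)) :
    ∃ (r : ℤ → ℕ) (i : std K r ⟶ X) (p : X ⟶ std K r), i ≫ p = 𝟙 _ ∧ p ≫ i = 𝟙 _ := by
  let r : ℤ → ℕ := fun a => Module.finrank K (X.at' 0 a)
  have h : ∀ n a, Nonempty ((std K r).at' n a ≃ₗ[K] X.at' n a) := fun n a => by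
    by_cases hn : n = 0
    · subst hn
      have h1 : Module.finrank K (PLift (0 = 0) × Fin (r a) → K) = Module.finrank K (X.at' 0 a) := by
        rw [Module.finrank_fintype_fun_eq_card]
        simp [r]
      exact ⟨(LinearEquiv.ofFinrankEq _ _ h1 :
        (PLift (0 = 0) × Fin (r a) → K) ≃ₗ[K] X.at' 0 a)⟩
    · have := hX n hn a
      have := std_arityZero (K := K) r n hn a
      exact ⟨0⟩
  have e := fun n a => (h n a).some
  exact ⟨r, homOfArityZero hX fun n a => (e n a).toLinearMap,
    homOfArityZero (std_arityZero r) fun n a => (e n a).symm.toLinearMap,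
    SMod.hom_ext fun n a x => (e n a).symm_apply_apply x,
    SMod.hom_ext fun n a x => (e n a).apply_symm_apply x⟩

end SMod

namespace Coalg

variable {K : Type u} [Field K] {C : CurvedCooperad K}

section Small

/-- The underlying data of a coalgebra, which determine it. -/
def data (E : Coalg C) : Σ X : SMod K, (X ⟶ comp C.X X) × DegMap (-1) X X := ⟨E.X, E.Δ, E.d⟩

lemma data_injective : Function.Injective (data (C := C)) := by
  rintro ⟨X, _, Δ, _, _, d, _, _⟩ ⟨X', _, Δ', _, _, d', _, _⟩ h
  cases h
  rfl

/-- Any finite-dimensional coalgebra is isomorphic to one on a standard graded vector space, by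
transport of structure. -/
lemma exists_iso_std {E : Coalg C} (hE : E.IsFiniteDimensional) :
    ∃ (E' : Coalg C) (r : ℤ → ℕ), E'.X = std K r ∧ Nonempty (E ≅ E') := by
  have hfin : ∀ a, Module.Finite K (E.X.at' 0 a) := fun a => by
    have : Module.Finite K (⨁ a : ℤ, E.X.at' 0 a) := hE
    exact Module.Finite.of_surjective (DirectSum.component K ℤ (fun a => E.X.at' 0 a) a)
      (fun x => ⟨DirectSum.lof K ℤ (fun a => E.X.at' 0 a) a x, DirectSum.component.lof_self _ _ _⟩)
  obtain ⟨r, i, p, hip, hpi⟩ := E.arityZero.exists_std hfin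
  have hΔ : i ≫ E.Δ ≫ compMap (𝟙 C.X) (p ≫ i) = i ≫ E.Δ := by
    rw [hpi, compMap_id, Category.comp_id]
  have hpi' : ∀ n a x, appl (p ≫ i) n a x = x := fun n a x => congrArg (fun f => appl f n a x) hpi
  refine ⟨E.restrict i p hip hΔ fun n a a' h y => hpi' _ _ _, r, rfl, ⟨?_⟩⟩
  refine Iso.symm ⟨E.restrictHom i p hip hΔ _, ⟨p, ?_, fun n a a' h x => ?_⟩, Hom.ext hip,
    Hom.ext hpi⟩
  · change E.Δ ≫ compMap (𝟙 C.X) p = p ≫ i ≫ E.Δ ≫ compMap (𝟙 C.X) p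
    rw [reassoc_of% hpi]
  · change appl p n a' (E.d.app n a a' h x) =
      appl p n a' (E.d.app n a a' h (appl i n a (appl p n a x)))
    rw [← appl_comp, hpi']

instance : ObjectProperty.EssentiallySmall.{u} (IsFiniteDimensional (C := C)) := by
  -- the possible structure maps on standard graded vector spaces form a small set
  let T := Σ r : ℤ → ℕ, (std K r ⟶ comp C.X (std K r)) × DegMap (-1) (std K r) (std K r)
  let T' := {t : T // ∃ E : Coalg C, E.data = ⟨std K t.1, t.2⟩}
  let G : T' → Coalg C := fun t => t.2.choose
  refine ⟨ObjectProperty.ofObj G, inferInstance, fun E hE => ?_⟩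
  obtain ⟨E', r, hr, ⟨e⟩⟩ := exists_iso_std hE
  have h : ∃ t : (std K r ⟶ comp C.X (std K r)) × DegMap (-1) (std K r) (std K r),
      E'.data = ⟨std K r, t⟩ := by
    rw [← hr]
    exact ⟨_, rfl⟩
  obtain ⟨t, ht⟩ := h
  let t' : T' := ⟨⟨r, t⟩, E', ht⟩
  have h1 : G t' = E' := data_injective (t'.2.choose_spec.trans ht.symm)
  exact ⟨G t', ⟨t'⟩, ⟨e ≪≫ eqToIso h1.symm⟩⟩

/-- Sub-coalgebras are determined, up to isomorphism, by their images. -/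
instance (D : Coalg C) : EssentiallySmall.{u} (FinSub D) := by
  rw [essentiallySmall_iff]
  refine ⟨?_, inferInstance⟩
  refine small_of_injective (β := Sub D.X)
    (f := fun E => FinSub.range ((fromSkeleton _).obj E)) fun E E' h => ?_
  obtain ⟨u⟩ := FinSub.exists_hom (le_of_eq h)
  obtain ⟨v⟩ := FinSub.exists_hom (ge_of_eq h)
  exact skeleton_skeletal _ ⟨(fromSkeleton _).preimageIso
    ⟨u, v, FinSub.hom_eq _ _, FinSub.hom_eq _ _⟩⟩

end Small

/-! ### Presentability -/

attribute [local instance] Cardinal.fact_isRegular_aleph0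

/-- Finite-dimensional coalgebras form a small generator: the diagram of the finite-dimensional
sub-coalgebras is replaced by an equivalent small one. -/
theorem isLocallyFinitelyPresentable (hC : C.IsConilpotent) :
    IsLocallyFinitelyPresentable.{u} (Coalg C) := by
  have h : ObjectProperty.IsCardinalFilteredGenerator (IsFiniteDimensional (C := C))
      Cardinal.aleph0.{u} :=
    { le_isCardinalPresentable := fun E hE => hE.isFinitelyPresentable
      exists_colimitsOfShape := fun D => by
        have hD := FinSub.isFiltered hC D
        obtain ⟨hc⟩ := FinSub.nonempty_isColimit hC D
        let e := equivSmallModel.{u} (FinSub D)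
        refine ⟨SmallModel.{u} (FinSub D), inferInstance,
          (isCardinalFiltered_aleph0_iff _).2 (IsFiltered.of_equivalence e), ?_⟩
        rw [← ObjectProperty.colimitsOfShape_congr _ e]
        exact ⟨{ toColimitPresentation := ⟨FinSub.diagram D, (FinSub.cocone D).ι, hc⟩
                 prop_diag_obj := fun E => E.property.2 }⟩ }
  have := h.hasCardinalFilteredGenerator
  exact {}

end Coalg

end

theorem mainTheorem5 {K : Type u} [Field K] (C : CurvedCooperad K) (hC : C.IsConilpotent) :
    IsLocallyFinitelyPresentable.{u} (Coalg C) ∧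
    (∀ D : Coalg C, IsFiltered (Coalg.FinSub D) ∧
      (∀ (a : ℤ) (x : D.X.at' 0 a), ∃ (E : Coalg.FinSub D) (y : E.obj.left.X.at' 0 a),
        SMod.appl (Coalg.Hom.f E.obj.hom) 0 a y = x) ∧
      Nonempty (IsColimit (Coalg.FinSub.cocone D))) ∧
    (∀ E : Coalg C, E.IsFiniteDimensional → IsFinitelyPresentable.{u} E) :=
  ⟨Coalg.isLocallyFinitelyPresentable hC, fun D => ⟨Coalg.FinSub.isFiltered hC D,
    fun _ x => Coalg.FinSub.exists_mem_range hC x, Coalg.FinSub.nonempty_isColimit hC D⟩,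
    fun _ hE => hE.isFinitelyPresentable⟩
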